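/- **Setting.** Let $N\ge 1$, $n=\lfloor N/2\rfloor$, and number the rows and columns of $N\times N$ matrices by $(a_1,\dots,a_N)=(-n,\dots,n)$, where $0$ is omitted if $N=2n$. Consider either the orthogonal case $\mathfrak g_N=\mathfrak o_N$ ($N$ arbitrary) or the symplectic case $\mathfrak g_N=\mathfrak{sp}_N$ ($N$ even); upper signs in $\pm$ refer to the orthogonal case, lower signs to the symplectic case. Put $\theta_{ij}=1$ in the orthogonal case, $\theta_{ij}=\operatorname{sgn} i\cdot\operatorname{sgn} j$ in the symplectic case, and $(A^t)_{ij}=\theta_{ij}A_{-j,-i}$. The extended twisted Yangian $\mathrm X(\mathfrak g_N)$ is the associative unital algebra over $\mathbb C$ with generators $s_{ij}^{(r)}$, $r\ge1$, and defining relations, for $s_{ij}(u)=\delta_{ij}+\sum_{r\ge1}s_{ij}^{(r)}u^{-r}$, $$\begin{aligned}(u^2-v^2)[s_{ij}(u),s_{kl}(v)]={}&(u+v)\big(s_{kj}(u)s_{il}(v)-s_{kj}(v)s_{il}(u)\big)\\&-(u-v)\big(\theta_{k,-j}s_{i,-k}(u)s_{-j,l}(v)-\theta_{i,-l}s_{k,-i}(v)s_{-l,j}(u)\big)\\&+\theta_{i,-j}\big(s_{k,-i}(u)s_{-j,l}(v)-s_{k,-i}(v)s_{-j,l}(u)\big).\end{aligned}$$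 The twisted Yangian $\mathrm Y(\mathfrak g_N)$ is the quotient of $\mathrm X(\mathfrak g_N)$ by $\theta_{ij}s_{-j,-i}(-u)=s_{ij}(u)\pm\dfrac{s_{ij}(u)-s_{ij}(-u)}{2u}$. Put $S(u)=(s_{ij}(u))$, a matrix over $\mathrm Y(\mathfrak g_N)[[u^{-1}]]$. Let $e_{ij}$ be the matrix units, $R^t(u)=1-Qu^{-1}$ with $Q=\sum_{i,j}\theta_{ij}\,e_{-j,-i}\otimes e_{ji}$, and let $A_k=\sum_{\sigma\in\mathfrak S_k}\operatorname{sgn}\sigma\cdot P_\sigma$ be the anti-symmetrizer on $(\mathbb C^N)^{\otimes k}$. With $u_p=u-p+1$, let $S_p=S_p(u_p)$ act in the $p$-th copy of $\operatorname{End}\mathbb C^N$, let $R^t_{pq}=R^t_{pq}(-u_p-u_q)$ act in the $p$-th and $q$-th copies, and put $$\langle S_1,\dots,S_k\rangle=S_1(R^t_{12}\cdots R^t_{1k})\,S_2\,(R^t_{23}\cdots R^t_{2k})\cdots S_k .$$ The Sklyanin minors $s^{b_1\cdots b_k}_{c_1\cdots c_k}(u)\in \mathrm Y(\mathfrak g_N)[[u^{-1}]]$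 are defined by $$A_k\langle S_1,\dots,S_k\rangle=\sum s^{b_1\cdots b_k}_{c_1\cdots c_k}(u)\otimes e_{b_1c_1}\otimes\cdots\otimes e_{b_kc_k}$$ (for $k=0$ the minor is $1$). The Sklyanin determinant is $\operatorname{sdet}S(u)=s^{a_1\cdots a_N}_{a_1\cdots a_N}(u)$, and the Sklyanin comatrix $\widehat S(u)$ is the unique matrix with $\widehat S(u)\,S(u-N+1)=\operatorname{sdet}S(u)\cdot 1$. Denote by $\widehat s^{\,t}_{ij}(u)$ the entries of $\widehat S^{\,t}(u)$. Finally, let $\alpha_p(u)=1$ in the orthogonal case and $\alpha_p(u)=\dfrac{u+1/2}{u-p+1/2}$ in the symplectic case. All rational functions of $u$ are expanded as series in $u^{-1}$. **Proposition.** For any $i,j\in\{1,\dots,N\}$ the following identity holds in $\mathrm Y(\mathfrak g_N)[[u^{-1}]]$: $$\widehat s^{\,t}_{a_ia_j}(u)=(-1)^{i+j}\,\alpha_{N-1}(u)\; s^{a_1\cdots\widehat{a_j}\cdots a_N}_{a_1\cdots\widehat{a_i}\cdots a_N}(-u+N-2),$$ where the hats on the indices on the right-hand side mark the indices to be omitted.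 -/

import Mathlib

open scoped PowerSeries Kronecker

namespace SkewTwisted

/-! Series in `u⁻¹` with coefficients in an algebra `A` are elements of `A⟦X⟧`, where the formal
variable `X` stands for `u⁻¹`; the coefficient of `u⁻ʳ` is `PowerSeries.coeff r`. -/

/-- The two families of Lie algebras `𝔤_N`: `𝔬_N` and `𝔰𝔭_N`. -/
inductive LieCase : Type
  | orthogonal
  | symplectic

/-- The double sign `±`: the upper sign is for the orthogonal case and the lower sign is for the
symplectic case. -/
def LieCase.sign : LieCase → ℂ
  | .orthogonal => 1
  | .symplectic => -1

/-! ### Indices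

With `n = ⌊N/2⌋`, the rows and columns of `N × N` matrices are numbered by
`-n, …, -1, 0, 1, …, n` if `N = 2n+1` and by `-n, …, -1, 1, …, n` if `N = 2n`. We write
`(a_1, …, a_N) = (-n, …, n)` for the increasing enumeration of these indices and represent the
index `a_i` by its (zero-based) position, an element of `Fin N`. The index `-a_i` is then
represented by `Fin.rev i`. -/

/-- The integer index `a_i` in the position `i`. -/
def label (N : ℕ) (i : Fin N) : ℤ :=
  if N % 2 = 0 ∧ N / 2 ≤ (i : ℕ) then (i : ℤ) - (N / 2 : ℕ) + 1 else (i : ℤ) - (N / 2 : ℕ)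

theorem label_strictMono (N : ℕ) : StrictMono (label N) := by
  intro i j h
  have h' : (i : ℕ) < j := h
  unfold label
  split_ifs <;> omega

theorem label_rev (N : ℕ) (i : Fin N) : label N i.rev = - label N i := by
  have hi := i.isLt
  unfold label
  rw [Fin.val_rev]
  split_ifs <;> omega

theorem label_range (N : ℕ) :
    Set.range (label N) = {a : ℤ | |a| ≤ (N / 2 : ℕ) ∧ (N % 2 = 0 → a ≠ 0)} := by
  ext a
  simp only [Set.mem_range, Set.mem_ofPred_eq, abs_le]
  constructor
  · rintro ⟨i, rfl⟩
    have hi := i.isLt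
    unfold label
    split_ifs <;> omega
  · rintro ⟨⟨h1, h2⟩, h3⟩
    by_cases h : N % 2 = 0 ∧ 0 < a
    · refine ⟨⟨(a + (N / 2 : ℕ) - 1).toNat, by omega⟩, ?_⟩
      unfold label
      split_ifs <;> simp only at * <;> omega
    · refine ⟨⟨(a + (N / 2 : ℕ)).toNat, by omega⟩, ?_⟩
      unfold label
      split_ifs <;> simp only at * <;> omega

/-- `θ_{ij}`, which is `1` in the orthogonal case and `sgn i · sgn j` in the symplectic case. -/
def theta (c : LieCase) {N : ℕ} (i j : Fin N) : ℂ :=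
  match c with
  | .orthogonal => 1
  | .symplectic => (((label N i).sign * (label N j).sign : ℤ) : ℂ)

/-- The transposition `(M^t)_{ij} = θ_{ij} M_{-j,-i}`. -/
def transp (c : LieCase) {N : ℕ} {R : Type*} [SMul ℂ R] (M : Matrix (Fin N) (Fin N) R) :
    Matrix (Fin N) (Fin N) R :=
  Matrix.of fun i j => theta c i j • M j.rev i.rev

/-! ### Series in `u⁻¹` -/

noncomputable section

/-- The expansion `(a u + b)⁻¹ = u⁻¹ (a + b u⁻¹)⁻¹` as a series in `u⁻¹`, for `a ≠ 0`. -/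
def invLin (a b : ℂ) : ℂ⟦X⟧ :=
  PowerSeries.X * (PowerSeries.C a + PowerSeries.C b * PowerSeries.X)⁻¹

/-- The series `f(a u + b)` in `u⁻¹`, for `a ≠ 0`: if `f(u) = ∑ f_r u⁻ʳ`, then it is
`∑ f_r (a u + b)⁻ʳ`, and the coefficient of `u⁻ᵐ` only involves the terms with `r ≤ m`. -/
def substLin {A : Type*} [Ring A] [Algebra ℂ A] (a b : ℂ) (f : A⟦X⟧) : A⟦X⟧ :=
  PowerSeries.mk fun m => ∑ r ∈ Finset.range (m + 1),
    PowerSeries.coeff m (invLin a b ^ r) • PowerSeries.coeff r f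

/-- A series with complex coefficients, regarded as a series with coefficients in `A`. -/
def scal (A : Type*) [Ring A] [Algebra ℂ A] (f : ℂ⟦X⟧) : A⟦X⟧ :=
  PowerSeries.map (algebraMap ℂ A) f

/-- `α_p(u)`, which is `1` in the orthogonal case and, in the symplectic case,
`(u + 1/2) / (u - p + 1/2) = (1 + u⁻¹/2) / (1 + (1/2 - p) u⁻¹)`. -/
def alpha (c : LieCase) (p : ℂ) : ℂ⟦X⟧ :=
  match c with
  | .orthogonal => 1
  | .symplectic => (1 + PowerSeries.C (1 / 2) * PowerSeries.X) *
      (1 + PowerSeries.C (1 / 2 - p) * PowerSeries.X)⁻¹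

/-! ### The extended twisted Yangian and the twisted Yangian -/

/-- The free algebra on generators `s_{ij}^{(r)}`, `r = 1, 2, …`; the triple `(i, j, r)` stands
for the generator `s_{ij}^{(r+1)}`. -/
abbrev FreeGen (N : ℕ) : Type := FreeAlgebra ℂ (Fin N × Fin N × ℕ)

/-- The coefficient of `u⁻ʳ` in `s_{ij}(u) = δ_{ij} + s_{ij}^{(1)} u⁻¹ + s_{ij}^{(2)} u⁻² + ⋯`,
for any integer `r`. -/
def freeCoeff {N : ℕ} (i j : Fin N) : ℤ → FreeGen N
  | Int.ofNat 0 => if i = j then 1 else 0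
  | Int.ofNat (r + 1) => FreeAlgebra.ι ℂ (i, j, r)
  | Int.negSucc _ => 0

/-! Series in `u⁻¹, v⁻¹` are given by their coefficients at `u⁻ʳ v⁻ᵗ`, where `r, t` are integers, so
that multiplication by `u` shifts `r` by one and multiplication by `v` shifts `t` by one. -/

/-- Coefficients of `[s_{ij}(u), s_{kl}(v)]`. -/
def relComm {N : ℕ} (i j k l : Fin N) (r t : ℤ) : FreeGen N :=
  freeCoeff i j r * freeCoeff k l t - freeCoeff k l t * freeCoeff i j r

/-- Coefficients of `s_{kj}(u) s_{il}(v) - s_{kj}(v) s_{il}(u)`. -/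
def relB {N : ℕ} (i j k l : Fin N) (r t : ℤ) : FreeGen N :=
  freeCoeff k j r * freeCoeff i l t - freeCoeff k j t * freeCoeff i l r

/-- Coefficients of `θ_{k,-j} s_{i,-k}(u) s_{-j,l}(v) - θ_{i,-l} s_{k,-i}(v) s_{-l,j}(u)`. -/
def relC (c : LieCase) {N : ℕ} (i j k l : Fin N) (r t : ℤ) : FreeGen N :=
  theta c k j.rev • (freeCoeff i k.rev r * freeCoeff j.rev l t) -
    theta c i l.rev • (freeCoeff k i.rev t * freeCoeff l.rev j r)

/-- Coefficients of `θ_{i,-j} (s_{k,-i}(u) s_{-j,l}(v) - s_{k,-i}(v) s_{-j,l}(u))`. -/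
def relD (c : LieCase) {N : ℕ} (i j k l : Fin N) (r t : ℤ) : FreeGen N :=
  theta c i j.rev •
    (freeCoeff k i.rev r * freeCoeff j.rev l t - freeCoeff k i.rev t * freeCoeff j.rev l r)

/-- The defining relations of the extended twisted Yangian, coefficient by coefficient:
`(u²-v²)[s_{ij}(u), s_{kl}(v)] = (u+v) (s_{kj}(u) s_{il}(v) - s_{kj}(v) s_{il}(u))`
`  - (u-v) (θ_{k,-j} s_{i,-k}(u) s_{-j,l}(v) - θ_{i,-l} s_{k,-i}(v) s_{-l,j}(u))`
`  + θ_{i,-j} (s_{k,-i}(u) s_{-j,l}(v) - s_{k,-i}(v) s_{-j,l}(u))`. -/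
inductive ExtRel (c : LieCase) (N : ℕ) : FreeGen N → FreeGen N → Prop
  | quaternary (i j k l : Fin N) (r t : ℤ) : ExtRel c N
      (relComm i j k l (r + 2) t - relComm i j k l r (t + 2))
      ((relB i j k l (r + 1) t + relB i j k l r (t + 1)) -
        (relC c i j k l (r + 1) t - relC c i j k l r (t + 1)) + relD c i j k l r t)

/-- The extended twisted Yangian `X(𝔤_N)`. -/
abbrev ExtYangian (c : LieCase) (N : ℕ) : Type := RingQuot (ExtRel c N)

/-- The generating series `s_{ij}(u)` with coefficients in `X(𝔤_N)`. -/
def extSeries (c : LieCase) {N : ℕ} (i j : Fin N) : (ExtYangian c N)⟦X⟧ :=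
  PowerSeries.mk fun r => RingQuot.mkAlgHom ℂ (ExtRel c N) (freeCoeff i j r)

/-- The symmetry relation
`θ_{ij} s_{-j,-i}(-u) = s_{ij}(u) ± (s_{ij}(u) - s_{ij}(-u)) / (2u)`, coefficient by
coefficient. -/
inductive SymmRel (c : LieCase) (N : ℕ) : ExtYangian c N → ExtYangian c N → Prop
  | symm (i j : Fin N) (m : ℕ) : SymmRel c N
      (PowerSeries.coeff m (theta c i j • substLin (-1) 0 (extSeries c j.rev i.rev)))
      (PowerSeries.coeff m (extSeries c i j + c.sign • (scal (ExtYangian c N) (invLin 2 0) *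
        (extSeries c i j - substLin (-1) 0 (extSeries c i j)))))

/-- The twisted Yangian `Y(𝔤_N)`. -/
abbrev TwYangian (c : LieCase) (N : ℕ) : Type := RingQuot (SymmRel c N)

/-- The matrix `S(u) = (s_{ij}(u))` with entries in `Y(𝔤_N)[[u⁻¹]]`. -/
def genS (c : LieCase) (N : ℕ) : Matrix (Fin N) (Fin N) (TwYangian c N)⟦X⟧ :=
  Matrix.of fun i j =>
    PowerSeries.map (RingQuot.mkAlgHom ℂ (SymmRel c N) : ExtYangian c N →+* TwYangian c N)
      (extSeries c i j)

/-! ### Sklyanin minors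

An element `∑ x^{a_1 … a_k}_{b_1 … b_k} ⊗ e_{a_1 b_1} ⊗ ⋯ ⊗ e_{a_k b_k}` of
`A[[u⁻¹]] ⊗ (End ℂ^N)^{⊗k}` is the matrix over `A⟦X⟧` whose rows and columns are numbered by
`Fin k → Fin N` and whose `(a, b)` entry is `x^{a_1 … a_k}_{b_1 … b_k}`. -/

/-- The matrix `M` acting on the `p`-th copy of `ℂ^N`. -/
def onOne {k N : ℕ} {R : Type*} [Zero R] (p : Fin k) (M : Matrix (Fin N) (Fin N) R) :
    Matrix (Fin k → Fin N) (Fin k → Fin N) R :=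
  Matrix.of fun x y => open Classical in if ∀ q, q ≠ p → x q = y q then M (x p) (y p) else 0

/-- The element `M` of `End ℂ^N ⊗ End ℂ^N` acting on the copies of `ℂ^N` numbered by `p` and `q`,
for `p ≠ q`. -/
def onTwo {k N : ℕ} {R : Type*} [Zero R] (p q : Fin k)
    (M : Matrix (Fin N × Fin N) (Fin N × Fin N) R) :
    Matrix (Fin k → Fin N) (Fin k → Fin N) R :=
  Matrix.of fun x y => open Classical in
    if ∀ w, w ≠ p → w ≠ q → x w = y w then M (x p, x q) (y p, y q) else 0

/-- `Q = ∑ θ_{ij} e_{-j,-i} ⊗ e_{ji}`. -/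
def opQ (c : LieCase) (N : ℕ) : Matrix (Fin N × Fin N) (Fin N × Fin N) ℂ :=
  ∑ i : Fin N, ∑ j : Fin N, theta c i j •
    (Matrix.single j.rev i.rev (1 : ℂ) ⊗ₖ Matrix.single j i (1 : ℂ))

/-- The operator `P_σ` on `(ℂ^N)^{⊗k}`. -/
def opP {k N : ℕ} (R : Type*) [Zero R] [One R] (σ : Equiv.Perm (Fin k)) :
    Matrix (Fin k → Fin N) (Fin k → Fin N) R :=
  Matrix.of fun x y => if x = y ∘ σ.symm then 1 else 0

/-- The anti-symmetrizer `A_k = ∑ sgn σ · P_σ`. -/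
def antisym (k N : ℕ) (R : Type*) [Ring R] : Matrix (Fin k → Fin N) (Fin k → Fin N) R :=
  ∑ σ : Equiv.Perm (Fin k), ((Equiv.Perm.sign σ : ℤˣ) : ℤ) • opP R σ

/-- A power series of matrices, regarded as a matrix of power series. -/
def matOfSeries {A : Type*} [Ring A] {N : ℕ} (P : (Matrix (Fin N) (Fin N) A)⟦X⟧) : Matrix (Fin N) (Fin N) A⟦X⟧ :=
  Matrix.of fun i j => PowerSeries.mk fun m => PowerSeries.coeff m P i j

theorem isUnit_of_constantCoeff {A : Type*} [Ring A] {N : ℕ}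
    (M : Matrix (Fin N) (Fin N) A⟦X⟧)
    (hM : ∀ i j, PowerSeries.constantCoeff (M i j) = if i = j then 1 else 0) : IsUnit M := by
  have hmul : ∀ P P' : (Matrix (Fin N) (Fin N) A)⟦X⟧,
      matOfSeries (P * P') = matOfSeries P * matOfSeries P' := by
    intro P P'
    ext i j m
    simp only [matOfSeries, Matrix.of_apply, PowerSeries.coeff_mk, Matrix.mul_apply, map_sum,
      PowerSeries.coeff_mul, Matrix.sum_apply]
    exact Finset.sum_comm
  have hone : matOfSeries (1 : (Matrix (Fin N) (Fin N) A)⟦X⟧) = 1 := by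
    ext i j m
    by_cases hij : i = j <;> by_cases hm : m = 0 <;>
      simp [matOfSeries, PowerSeries.coeff_one, Matrix.one_apply, hij, hm]
  set P : (Matrix (Fin N) (Fin N) A)⟦X⟧ :=
    PowerSeries.mk fun m => Matrix.of fun i j => PowerSeries.coeff m (M i j) with hP
  have hPM : matOfSeries P = M := by
    ext i j m
    simp [matOfSeries, hP]
  have hc : PowerSeries.constantCoeff P = ((1 : (Matrix (Fin N) (Fin N) A)ˣ) : _) := by
    ext i j
    rw [← PowerSeries.coeff_zero_eq_constantCoeff_apply, hP, PowerSeries.coeff_mk]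
    simp [hM, Matrix.one_apply]
  refine ⟨⟨M, matOfSeries (PowerSeries.invOfUnit P 1), ?_, ?_⟩, rfl⟩
  · rw [← hPM, ← hmul, PowerSeries.mul_invOfUnit P 1 hc, hone]
  · rw [← hPM, ← hmul, PowerSeries.invOfUnit_mul P 1 hc, hone]

section Minors

variable {A : Type*} [Ring A] [Algebra ℂ A] {N : ℕ}

/-- `S(a u + b)`, entry by entry. -/
def substMat (a b : ℂ) (S : Matrix (Fin N) (Fin N) A⟦X⟧) : Matrix (Fin N) (Fin N) A⟦X⟧ :=
  S.map (substLin a b)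

/-- `R^t_{pq}(a u + b)`, where `R^t(u) = 1 - Q u⁻¹`, for `a ≠ 0`. -/
def opRt (A : Type*) [Ring A] [Algebra ℂ A] (c : LieCase) {k N : ℕ} (p q : Fin k) (a b : ℂ) :
    Matrix (Fin k → Fin N) (Fin k → Fin N) A⟦X⟧ :=
  1 - scal A (invLin a b) • onTwo p q ((opQ c N).map (algebraMap ℂ A⟦X⟧))

/-- `⟨S_1, …, S_k⟩ = S_1 (R^t_{12} ⋯ R^t_{1k}) S_2 (R^t_{23} ⋯ R^t_{2k}) ⋯ S_k` with
`S_p = S_p(u_p)` and `R^t_{pq} = R^t_{pq}(-u_p - u_q)`, specialized at `u_p = u - p + 1`. In the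
zero-based numbering, `u_p = u - p` and `-u_p - u_q = -2u + (p + q)`. -/
def bracket (c : LieCase) (k : ℕ) (S : Matrix (Fin N) (Fin N) A⟦X⟧) :
    Matrix (Fin k → Fin N) (Fin k → Fin N) A⟦X⟧ :=
  ((List.finRange k).map fun p =>
    onOne p (substMat 1 (-((p : ℕ) : ℂ)) S) *
      (((List.finRange k).filter fun q => p < q).map fun q =>
        opRt A c p q (-2) (((p : ℕ) : ℂ) + ((q : ℕ) : ℂ))).prod).prod

/-- The Sklyanin minor `s^{a_1 … a_k}_{b_1 … b_k}(u)` of the matrix `S(u)`, that is, a matrix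
element of `A_k ⟨S_1, …, S_k⟩`. -/
def skMinor (c : LieCase) (S : Matrix (Fin N) (Fin N) A⟦X⟧) {k : ℕ} (a b : Fin k → Fin N) :
    A⟦X⟧ :=
  (antisym k N A⟦X⟧ * bracket c k S) a b

/-- The Sklyanin determinant `sdet S(u) = s^{-n … n}_{-n … n}(u)`. -/
def sdet (c : LieCase) (S : Matrix (Fin N) (Fin N) A⟦X⟧) : A⟦X⟧ :=
  skMinor c S (id : Fin N → Fin N) id

/-- The Sklyanin comatrix `Ŝ(u)`, the matrix such that `Ŝ(u) S(u-N+1) = sdet S(u)`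
(see `skComatrix_mul` and `skComatrix_unique`). -/
def skComatrix (c : LieCase) (S : Matrix (Fin N) (Fin N) A⟦X⟧) : Matrix (Fin N) (Fin N) A⟦X⟧ :=
  sdet c S • Ring.inverse (substMat 1 (-(N : ℂ) + 1) S)

/-! The matrix `S(u-N+1)` is invertible as soon as `S(u)` has constant term `1`, so that the
comatrix exists and is unique. -/

theorem isUnit_substMat (a b : ℂ) (S : Matrix (Fin N) (Fin N) A⟦X⟧)
    (hS : ∀ i j, PowerSeries.constantCoeff (S i j) = if i = j then 1 else 0) :
    IsUnit (substMat a b S) := by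
  apply isUnit_of_constantCoeff
  intro i j
  rw [← hS i j, ← PowerSeries.coeff_zero_eq_constantCoeff_apply,
    ← PowerSeries.coeff_zero_eq_constantCoeff_apply]
  simp [substMat, substLin]

theorem skComatrix_mul (c : LieCase) (S : Matrix (Fin N) (Fin N) A⟦X⟧)
    (hS : ∀ i j, PowerSeries.constantCoeff (S i j) = if i = j then 1 else 0) :
    skComatrix c S * substMat 1 (-(N : ℂ) + 1) S = sdet c S • 1 := by
  rw [skComatrix, Matrix.smul_mul, Ring.inverse_mul_cancel _ (isUnit_substMat _ _ S hS)]

theorem skComatrix_unique (c : LieCase) (S T : Matrix (Fin N) (Fin N) A⟦X⟧)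
    (hS : ∀ i j, PowerSeries.constantCoeff (S i j) = if i = j then 1 else 0)
    (hT : T * substMat 1 (-(N : ℂ) + 1) S = sdet c S • 1) : T = skComatrix c S :=
  (isUnit_substMat _ _ S hS).mul_right_cancel (hT.trans (skComatrix_mul c S hS).symm)

end Minors

theorem constantCoeff_genS (c : LieCase) (N : ℕ) (i j : Fin N) :
    PowerSeries.constantCoeff (genS c N i j) = if i = j then 1 else 0 := by
  rw [← PowerSeries.coeff_zero_eq_constantCoeff_apply]
  have h : freeCoeff i j ((0 : ℕ) : ℤ) = if i = j then 1 else 0 := rfl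
  simp only [genS, extSeries, Matrix.of_apply, PowerSeries.coeff_map, PowerSeries.coeff_mk, h]
  split_ifs <;> simp

/-- The sequence `1, …, ĵ, …, N` of all positions except `j`, in increasing order. -/
def skip {N : ℕ} (j : Fin N) (p : Fin (N - 1)) : Fin N :=
  if (p : ℕ) < j then ⟨p, by omega⟩ else ⟨p + 1, by omega⟩

end

end SkewTwisted

/-! Write `k = N - 1`, let `M(u)` be the matrix of signed minors of order `k` (`signedMinor`), and
let `κ` be the series `kappa`. The theorem comes from expanding the Sklyanin determinant along its
first and along its last factor, and comparing the two expansions.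

The quaternary relations specialised at `u + a`, `u + b` form the reflection equation
(`reflection_equation`), and the operators `R`, `R^t` satisfy a Yang-Baxter relation. Hence `R_{ab}`
exchanges two neighbouring sites of the bracket (`rp_mul_brk`). At consecutive shifts `R = 1 - P`,
so `A_k⟨S_1,…,S_k⟩` is skew-symmetric in its lower indices as well as its upper ones
(`minors_mul_opP`). Skew-symmetry turns a product of operators `R^t_{q0}` into `1 - y ∑ Q_{q0}`
(`fusion_contract`), and a product of operators `R_{0q}` extends `A_k` to `A_{k+1}` (`fusion_swap`).
These give the two expansions `cofactor_mul_first` and `cofactor_mul_last`.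

In the first expansion the signed minors at `u` multiply a combination of `S(u+1)` and its
transpose, which the symmetry relation turns into a multiple of `S^t(-u-1)`
(`IsSymmetric.combination`). Thus `κ(u+1) (Mᵀ)^t(u) S(-u-1) = sdet(u+1)` (`kappa_smul_mul`), where
`Mᵀ` is the ordinary matrix transpose. The reflection `u ↦ -u + k - 1` then gives `κ(k-u)
(Mᵀ)^t(-u+N-2) S(u-N+1) = sdet(-u+k)`. This is the claimed formula up to the ratio of `sdet(u)` and
`sdet(-u+k)`.

That ratio is found from the last expansion, which expresses `sdet(u) S(u-k)⁻¹` through `Mᵀ` and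
`(Mᵀ)^t`. Eliminating the minors gives a relation between determinants alone (`comatrix_relations`).
It says that an explicit rational factor times `sdet(-u+k) sdet(u)⁻¹` is invariant under `u ↦ u+1`.
A series in `u⁻¹` with this property is constant (`eq_C_of_periodic`), and the constant is `1` by
comparison at infinity. This is the functional equation `sdet_eq`. The argument never uses
centrality of the determinant: the order of its factors is kept throughout. -/

namespace SkewTwisted

noncomputable section

open PowerSeries

/-! ### Affine substitutions in series in `u⁻¹`, and series as modules over `ℂ⟦X⟧` -/

section Substitution

theorem invLin_mul {a : ℂ} (ha : a ≠ 0) (b : ℂ) : invLin a b * (C a + C b * X) = X := by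
  rw [invLin, mul_assoc, PowerSeries.inv_mul_cancel, mul_one]
  simpa using ha

theorem X_dvd_invLin (a b : ℂ) : (X : ℂ⟦X⟧) ∣ invLin a b := ⟨_, rfl⟩

theorem coeff_invLin_pow (a b : ℂ) {m r : ℕ} (h : m < r) : coeff m (invLin a b ^ r) = 0 :=
  X_pow_dvd_iff.1 (pow_dvd_pow_of_dvd (X_dvd_invLin a b) r) m h

theorem isUnit_of_invLin {a b : ℂ} (ha : a ≠ 0) : IsUnit (C a + C b * X : ℂ⟦X⟧) := by
  rw [PowerSeries.isUnit_iff_constantCoeff]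
  simpa using ha

theorem eq_invLin {a b : ℂ} (ha : a ≠ 0) {q : ℂ⟦X⟧} (h : q * (C a + C b * X) = X) :
    q = invLin a b :=
  (isUnit_of_invLin ha).mul_right_cancel (h.trans (invLin_mul ha b).symm)

variable {A : Type*} [Ring A] [Algebra ℂ A]

theorem coeff_substLin (a b : ℂ) (f : A⟦X⟧) {m n : ℕ} (h : m < n) :
    coeff m (substLin a b f) = ∑ r ∈ Finset.range n, coeff m (invLin a b ^ r) • coeff r f := by
  rw [substLin, coeff_mk]
  refine Finset.sum_subset (Finset.range_mono h) fun r _ hr => ?_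
  rw [coeff_invLin_pow a b (by simpa using hr), zero_smul]

/-- With `w = (a u + b)⁻¹`, both sides collect the terms `w^(r+t) f_r g_t`, one over a triangle of
exponents and the other over a square. The terms by which the regions differ vanish, because `w^s`
has order at least `s`. -/
theorem substLin_mul (a b : ℂ) (f g : A⟦X⟧) :
    substLin a b (f * g) = substLin a b f * substLin a b g := by
  ext m
  have hL : coeff m (substLin a b (f * g)) =
      ∑ s ∈ Finset.range (2 * m + 2), ∑ p ∈ Finset.HasAntidiagonal.antidiagonal s,
        coeff m (invLin a b ^ (p.1 + p.2)) • (coeff p.1 f * coeff p.2 g) := by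
    -- The square `r, t ≤ m` reaches total degree `2m`, so the sum over total degrees is extended
    -- far enough to contain it.
    rw [coeff_substLin a b _ (show m < 2 * m + 2 by omega)]
    refine Finset.sum_congr rfl fun s _ => ?_
    rw [coeff_mul, Finset.smul_sum]
    refine Finset.sum_congr rfl fun p hp => ?_
    rw [Finset.HasAntidiagonal.mem_antidiagonal.1 hp]
  have hR : coeff m (substLin a b f * substLin a b g) =
      ∑ r ∈ Finset.range (m + 1), ∑ t ∈ Finset.range (m + 1),
        coeff m (invLin a b ^ (r + t)) • (coeff r f * coeff t g) := by
    rw [coeff_mul]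
    have : ∀ p ∈ Finset.HasAntidiagonal.antidiagonal m,
        coeff p.1 (substLin a b f) * coeff p.2 (substLin a b g) =
        ∑ r ∈ Finset.range (m + 1), ∑ t ∈ Finset.range (m + 1),
          (coeff p.1 (invLin a b ^ r) * coeff p.2 (invLin a b ^ t)) •
            (coeff r f * coeff t g) := by
      intro p hp
      have hp' := Finset.HasAntidiagonal.mem_antidiagonal.1 hp
      rw [coeff_substLin a b f (show p.1 < m + 1 by omega),
        coeff_substLin a b g (show p.2 < m + 1 by omega), Finset.sum_mul_sum]
      simp only [smul_mul_smul_comm]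
    rw [Finset.sum_congr rfl this, Finset.sum_comm]
    refine Finset.sum_congr rfl fun r _ => ?_
    rw [Finset.sum_comm]
    refine Finset.sum_congr rfl fun t _ => ?_
    rw [pow_add, coeff_mul, Finset.sum_smul]
  rw [hL, hR, Finset.sum_sigma', ← Finset.sum_product']
  symm
  refine Finset.sum_of_injOn (fun p => ⟨p.1 + p.2, p⟩) ?_ ?_ ?_ ?_
  · intro p _ q _ h
    simp only [Sigma.mk.injEq] at h
    exact eq_of_heq h.2
  · intro p hp
    simp only [Finset.coe_product, Finset.coe_range, Set.mem_prod, Set.mem_Iio] at hp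
    simp only [Finset.coe_sigma, Set.mem_sigma_iff, Finset.coe_range, Set.mem_Iio, Finset.mem_coe,
      Finset.HasAntidiagonal.mem_antidiagonal, and_true]
    omega
  · rintro ⟨s, p⟩ hs hn
    simp only [Finset.mem_sigma, Finset.HasAntidiagonal.mem_antidiagonal] at hs
    simp only [Finset.coe_product, Finset.coe_range, Set.mem_image, Set.mem_prod, Set.mem_Iio,
      not_exists, not_and] at hn
    rw [coeff_invLin_pow a b, zero_smul]
    by_contra hc
    change ¬ (m < p.1 + p.2) at hc
    refine hn p ⟨by omega, by omega⟩ ?_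
    obtain ⟨-, rfl⟩ := hs
    rfl
  · intro p _
    rfl

/-- The substitution `u ↦ a u + b` as a ring homomorphism. -/
def substHom (A : Type*) [Ring A] [Algebra ℂ A] (a b : ℂ) : A⟦X⟧ →+* A⟦X⟧ where
  toFun := substLin a b
  map_one' := by
    ext m
    rw [coeff_substLin a b _ (Nat.lt_succ_self m),
      Finset.sum_eq_single 0 (fun r _ hr => by simp [coeff_one, hr]) (by simp)]
    by_cases hm : m = 0 <;> simp [coeff_one, hm]
  map_mul' := substLin_mul a b
  map_zero' := by ext m; simp [substLin]
  map_add' f g := by ext m; simp [substLin, Finset.sum_add_distrib]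

@[simp] theorem substHom_apply (a b : ℂ) (f : A⟦X⟧) : substHom A a b f = substLin a b f := rfl

theorem substLin_smul (a b c : ℂ) (f : A⟦X⟧) : substLin a b (c • f) = c • substLin a b f := by
  ext m
  simp only [substLin, coeff_mk, coeff_smul, Finset.smul_sum]
  exact Finset.sum_congr rfl fun r _ => smul_comm _ _ _

theorem substLin_C (a b c : ℂ) : substLin a b (C c : ℂ⟦X⟧) = C c := by
  rw [← mul_one (C c), ← smul_eq_C_mul, substLin_smul, ← substHom_apply, map_one]

theorem substLin_X (a b : ℂ) : substLin a b (X : ℂ⟦X⟧) = invLin a b := by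
  ext m
  rw [coeff_substLin a b _ (show m < m + 2 by omega), Finset.sum_eq_single 1]
  · simp
  · intro r _ hr
    simp [coeff_X, hr]
  · simp

theorem substLin_invLin {a c : ℂ} (ha : a ≠ 0) (hc : c ≠ 0) (b d : ℂ) :
    substLin a b (invLin c d) = invLin (c * a) (c * b + d) := by
  have h := congrArg (substHom ℂ a b) (invLin_mul hc d)
  simp only [map_mul, map_add, substHom_apply, substLin_C, substLin_X] at h
  apply eq_invLin (mul_ne_zero hc ha)
  have h2 := invLin_mul ha b
  have hX : invLin a b ≠ 0 := by
    intro h0; rw [h0, zero_mul] at h2; exact X_ne_zero h2.symm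
  apply mul_right_cancel₀ hX
  simp only [map_add, map_mul]
  linear_combination X * h + substLin a b (invLin c d) * C c * h2

/-- Applying the outer substitution, a ring homomorphism, to each power of `(c u + d)⁻¹` reduces the
claim to `substLin_invLin`. -/
theorem substLin_substLin {a c : ℂ} (ha : a ≠ 0) (hc : c ≠ 0) (b d : ℂ) (f : A⟦X⟧) :
    substLin a b (substLin c d f) = substLin (c * a) (c * b + d) f := by
  ext m
  rw [coeff_substLin a b _ (Nat.lt_succ_self m), coeff_substLin _ _ f (Nat.lt_succ_self m)]
  have h1 : ∀ r ∈ Finset.range m.succ, coeff m (invLin a b ^ r) • coeff r (substLin c d f) =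
      ∑ t ∈ Finset.range m.succ,
        (coeff m (invLin a b ^ r) • coeff r (invLin c d ^ t)) • coeff t f := by
    intro r hr
    rw [coeff_substLin c d f (Finset.mem_range.1 hr), Finset.smul_sum]
    simp only [smul_smul, smul_eq_mul]
  rw [Finset.sum_congr rfl h1, Finset.sum_comm]
  refine Finset.sum_congr rfl fun t _ => ?_
  rw [← Finset.sum_smul, ← coeff_substLin a b _ (Nat.lt_succ_self m), ← substHom_apply, map_pow,
    substHom_apply, substLin_invLin ha hc]

theorem constantCoeff_substLin (a b : ℂ) (f : A⟦X⟧) :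
    constantCoeff (substLin a b f) = constantCoeff f := by
  rw [← coeff_zero_eq_constantCoeff_apply, ← coeff_zero_eq_constantCoeff_apply]
  simp [substLin]

theorem map_substLin {A' : Type*} [Ring A'] [Algebra ℂ A'] (φ : A →ₐ[ℂ] A') (a b : ℂ) (f : A⟦X⟧) :
    PowerSeries.map (φ : A →+* A') (substLin a b f) =
      substLin a b (PowerSeries.map (φ : A →+* A') f) := by
  ext m
  simp [substLin]

theorem map_scal {A' : Type*} [Ring A'] [Algebra ℂ A'] (φ : A →ₐ[ℂ] A') (f : ℂ⟦X⟧) :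
    PowerSeries.map (φ : A →+* A') (scal A f) = scal A' f := by
  ext m
  simp [scal]

theorem substLin_scal (a b : ℂ) (f : ℂ⟦X⟧) :
    substLin a b (scal A f) = scal A (substLin a b f) := by
  ext m
  simp [scal, substLin, Algebra.smul_def]

theorem scal_commute (f : ℂ⟦X⟧) (g : A⟦X⟧) : Commute (scal A f) g := by
  ext m
  rw [coeff_mul, coeff_mul, ← Finset.Nat.sum_antidiagonal_swap]
  refine Finset.sum_congr rfl fun p _ => ?_
  simp only [scal, coeff_map, Prod.fst_swap, Prod.snd_swap]
  exact Algebra.commutes _ _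

/-- The algebra of series over a complex algebra is an algebra over `ℂ⟦X⟧`. -/
abbrev seriesAlgebra (A : Type*) [Ring A] [Algebra ℂ A] : Algebra ℂ⟦X⟧ A⟦X⟧ :=
  RingHom.toAlgebra' (PowerSeries.map (algebraMap ℂ A)) fun f g => scal_commute f g

attribute [local instance] seriesAlgebra

theorem series_smul_def (f : ℂ⟦X⟧) (g : A⟦X⟧) : f • g = scal A f * g := rfl

theorem substLin_series_smul (a b : ℂ) (f : ℂ⟦X⟧) (g : A⟦X⟧) :
    substLin a b (f • g) = substLin a b f • substLin a b g := by
  rw [series_smul_def, substLin_mul, substLin_scal, series_smul_def]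

theorem C_smul (z : ℂ) (g : A⟦X⟧) : (C z : ℂ⟦X⟧) • g = z • g := by
  ext m
  rw [series_smul_def, scal, map_C, coeff_C_mul, coeff_smul, Algebra.smul_def]

instance : IsScalarTower ℂ ℂ⟦X⟧ A⟦X⟧ :=
  ⟨fun z f g => by rw [smul_eq_C_mul, mul_smul, C_smul]⟩

/-- A nonzero complex series is a power of `X` times a unit, and multiplication by a power of `X`
only shifts coefficients. This torsion-freeness lets polynomial denominators be cleared in
noncommutative series. -/
theorem smul_left_cancel_of_ne_zero {f : ℂ⟦X⟧} (hf : f ≠ 0) {g h : A⟦X⟧} (e : f • g = f • h) :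
    g = h := by
  have key : ∀ n : ℕ, ∀ v w : A⟦X⟧, (X ^ n : ℂ⟦X⟧) • v = (X ^ n : ℂ⟦X⟧) • w → v = w := by
    intro n v w hvw
    have : ∀ v : A⟦X⟧, (X ^ n : ℂ⟦X⟧) • v = X ^ n * v := by
      intro v; rw [series_smul_def, scal, map_pow, map_X]
    rw [this, this] at hvw
    ext m
    have := congrArg (coeff (m + n)) hvw
    rwa [coeff_X_pow_mul, coeff_X_pow_mul] at this
  obtain ⟨n, hn⟩ : ∃ n : ℕ, n = f.order.toNat := ⟨_, rfl⟩
  obtain ⟨u, hu⟩ : ∃ u : ℂ⟦X⟧, IsUnit u ∧ f = X ^ n * u := by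
    refine ⟨divXPowOrder f, ?_, ?_⟩
    · rw [PowerSeries.isUnit_iff_constantCoeff, isUnit_iff_ne_zero]
      intro h0
      exact hf (constantCoeff_divXPowOrder_eq_zero_iff.1 h0)
    · rw [hn, X_pow_order_mul_divXPowOrder]
  obtain ⟨⟨u, rfl⟩, rfl⟩ := hu
  rw [mul_smul, mul_smul] at e
  have := key n _ _ e
  simpa [smul_smul] using congrArg (fun t => (↑u⁻¹ : ℂ⟦X⟧) • t) this

end Substitution

end

end SkewTwisted

namespace SkewTwisted

noncomputable section

open PowerSeries

attribute [local instance] seriesAlgebra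

/-! ### Evaluating series in two variables at `u + a` and `u + b` -/

section Evaluation

variable {A : Type*} [Ring A]

/-- The coefficient of `u⁻ʳ` in a series, for any integer `r`. -/
def intCoeff (f : A⟦X⟧) : ℤ → A
  | Int.ofNat r => coeff r f
  | Int.negSucc _ => 0

theorem intCoeff_of_neg (f : A⟦X⟧) {r : ℤ} (h : r < 0) : intCoeff f r = 0 := by
  obtain ⟨n, rfl⟩ := Int.eq_negSucc_of_lt_zero h
  rfl

variable [Algebra ℂ A]

/-- The value of the series with coefficients `c r t` at `u⁻ʳ v⁻ᵗ` after the substitution of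
`1 / (u + a)` and `1 / (u + b)` for `u⁻¹` and `v⁻¹`. -/
def evalTwo (a b : ℂ) (c : ℤ → ℤ → A) : A⟦X⟧ :=
  PowerSeries.mk fun m => ∑ r ∈ Finset.range (m + 1), ∑ t ∈ Finset.range (m + 1),
    coeff m (invLin 1 a ^ r * invLin 1 b ^ t) • c r t

theorem coeff_invLin_pow_mul (a b : ℂ) {m r t : ℕ} (h : m < r ∨ m < t) :
    coeff m (invLin 1 a ^ r * invLin 1 b ^ t) = 0 := by
  have h2 : (X : ℂ⟦X⟧) ^ (r + t) ∣ invLin 1 a ^ r * invLin 1 b ^ t := by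
    rw [pow_add]
    exact mul_dvd_mul (pow_dvd_pow_of_dvd (X_dvd_invLin _ _) _)
      (pow_dvd_pow_of_dvd (X_dvd_invLin _ _) _)
  exact X_pow_dvd_iff.1 h2 m (by omega)

theorem coeff_evalTwo (a b : ℂ) (c : ℤ → ℤ → A) {m n n' : ℕ} (h : m < n) (h' : m < n') :
    coeff m (evalTwo a b c) = ∑ r ∈ Finset.range n, ∑ t ∈ Finset.range n',
      coeff m (invLin 1 a ^ r * invLin 1 b ^ t) • c r t := by
  rw [evalTwo, coeff_mk]
  refine (Finset.sum_subset (Finset.range_mono h) fun r _ hr => ?_).trans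
    (Finset.sum_congr rfl fun r _ => Finset.sum_subset (Finset.range_mono h') fun t _ ht => ?_)
  · refine Finset.sum_eq_zero fun t _ => ?_
    rw [coeff_invLin_pow_mul a b (Or.inl (by simpa using hr)), zero_smul]
  · rw [coeff_invLin_pow_mul a b (Or.inr (by simpa using ht)), zero_smul]

theorem evalTwo_add (a b : ℂ) (c c' : ℤ → ℤ → A) :
    evalTwo a b (fun r t => c r t + c' r t) = evalTwo a b c + evalTwo a b c' := by
  ext m; simp [evalTwo, Finset.sum_add_distrib]

theorem evalTwo_sub (a b : ℂ) (c c' : ℤ → ℤ → A) :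
    evalTwo a b (fun r t => c r t - c' r t) = evalTwo a b c - evalTwo a b c' := by
  ext m; simp [evalTwo, smul_sub]

theorem evalTwo_smul (a b z : ℂ) (c : ℤ → ℤ → A) :
    evalTwo a b (fun r t => z • c r t) = z • evalTwo a b c := by
  ext m
  simp only [evalTwo, coeff_mk, coeff_smul, Finset.smul_sum]
  exact Finset.sum_congr rfl fun _ _ => Finset.sum_congr rfl fun _ _ => smul_comm _ _ _

/-- An index shift is multiplication by `u^(-p) v^(-q)`; the vanishing at negative indices ensures
that the shifted array contributes no new terms. -/
theorem evalTwo_shift (a b : ℂ) (c : ℤ → ℤ → A) (p q : ℕ)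
    (hc : ∀ r t : ℤ, r < 0 ∨ t < 0 → c r t = 0) :
    evalTwo a b (fun r t => c (r - p) (t - q)) =
      (invLin 1 a ^ p * invLin 1 b ^ q) • evalTwo a b c := by
  ext m
  rw [coeff_evalTwo a b _ (show m < p + (m + 1) by omega) (show m < q + (m + 1) by omega),
    Finset.sum_range_add, Finset.sum_eq_zero, zero_add]
  · have h1 : ∀ r : ℕ, ∑ t ∈ Finset.range (q + (m + 1)),
        coeff m (invLin 1 a ^ (p + r) * invLin 1 b ^ t) •
          c (((p + r : ℕ) : ℤ) - p) ((t : ℤ) - q) =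
        ∑ t ∈ Finset.range (m + 1),
          coeff m ((invLin 1 a ^ p * invLin 1 b ^ q) * (invLin 1 a ^ r * invLin 1 b ^ t)) •
            c r t := by
      intro r
      rw [Finset.sum_range_add, Finset.sum_eq_zero, zero_add]
      · refine Finset.sum_congr rfl fun t _ => ?_
        congr 2
        · ring
        · push_cast; ring
        · push_cast; ring
      · intro t ht
        rw [hc _ _ (Or.inr (by have := Finset.mem_range.1 ht; omega)), smul_zero]
    simp only [h1]
    rw [series_smul_def, coeff_mul]
    have h2 : ∀ x ∈ Finset.HasAntidiagonal.antidiagonal m,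
        coeff x.1 (scal A (invLin 1 a ^ p * invLin 1 b ^ q)) * coeff x.2 (evalTwo a b c) =
        ∑ r ∈ Finset.range (m + 1), ∑ t ∈ Finset.range (m + 1),
          (coeff x.1 (invLin 1 a ^ p * invLin 1 b ^ q) *
            coeff x.2 (invLin 1 a ^ r * invLin 1 b ^ t)) • c r t := by
      intro x hx
      have hx' := Finset.HasAntidiagonal.mem_antidiagonal.1 hx
      rw [coeff_evalTwo a b c (show x.2 < m + 1 by omega) (show x.2 < m + 1 by omega), scal,
        coeff_map, ← Algebra.smul_def, Finset.smul_sum]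
      simp only [Finset.smul_sum, smul_smul]
    rw [Finset.sum_congr rfl h2]
    symm
    rw [Finset.sum_comm]
    refine Finset.sum_congr rfl fun r _ => ?_
    rw [Finset.sum_comm]
    refine Finset.sum_congr rfl fun t _ => ?_
    rw [coeff_mul, Finset.sum_smul]
  · intro r hr
    refine Finset.sum_eq_zero fun t _ => ?_
    rw [hc _ _ (Or.inl (by have := Finset.mem_range.1 hr; omega)), smul_zero]

theorem evalTwo_mul (a b : ℂ) (f g : A⟦X⟧) :
    evalTwo a b (fun r t => intCoeff f r * intCoeff g t) = substLin 1 a f * substLin 1 b g := by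
  ext m
  rw [coeff_mul]
  have h : ∀ x ∈ Finset.HasAntidiagonal.antidiagonal m,
      coeff x.1 (substLin 1 a f) * coeff x.2 (substLin 1 b g) =
      ∑ r ∈ Finset.range (m + 1), ∑ t ∈ Finset.range (m + 1),
        (coeff x.1 (invLin 1 a ^ r) * coeff x.2 (invLin 1 b ^ t)) •
          (coeff r f * coeff t g) := by
    intro x hx
    have hx' := Finset.HasAntidiagonal.mem_antidiagonal.1 hx
    rw [coeff_substLin 1 a f (show x.1 < m + 1 by omega),
      coeff_substLin 1 b g (show x.2 < m + 1 by omega), Finset.sum_mul_sum]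
    simp only [smul_mul_smul_comm]
  rw [Finset.sum_congr rfl h, Finset.sum_comm, evalTwo, coeff_mk]
  refine Finset.sum_congr rfl fun r _ => ?_
  rw [Finset.sum_comm]
  refine Finset.sum_congr rfl fun t _ => ?_
  rw [coeff_mul, Finset.sum_smul]
  rfl

theorem evalTwo_swap (a b : ℂ) (c : ℤ → ℤ → A) :
    evalTwo a b (fun r t => c t r) = evalTwo b a c := by
  ext m
  rw [evalTwo, coeff_mk, evalTwo, coeff_mk, Finset.sum_comm]
  simp only [mul_comm]

theorem evalTwo_mul_swap (a b : ℂ) (f g : A⟦X⟧) :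
    evalTwo a b (fun r t => intCoeff g t * intCoeff f r) = substLin 1 b g * substLin 1 a f := by
  rw [evalTwo_swap a b fun t r => intCoeff g t * intCoeff f r, evalTwo_mul]

end Evaluation

/-! ### The defining relations as identities of series -/

section Relations

variable {c : LieCase} {N : ℕ} {A : Type*} [Ring A] [Algebra ℂ A]

theorem theta_symm (i j : Fin N) : theta c i j = theta c j i := by
  cases c
  · rfl
  · simp [theta, mul_comm]

theorem theta_rev_rev (i j : Fin N) : theta c i.rev j.rev = theta c i j := by
  cases c
  · rfl
  · simp [theta, label_rev, Int.sign_neg]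

theorem label_ne_zero (hN : Even N) (i : Fin N) : label N i ≠ 0 := by
  have hi := i.isLt
  rw [Nat.even_iff] at hN
  unfold label
  split_ifs <;> omega

/-- In the symplectic case an even `N` excludes the index `0`, so every sign squares to `1`. -/
theorem theta_mul (hN : c = LieCase.symplectic → Even N) (i j k : Fin N) :
    theta c i j * theta c j k = theta c i k := by
  cases c
  · simp [theta]
  · have h : (label N j).sign * (label N j).sign = 1 := by
      rw [← Int.sign_mul, Int.sign_eq_one_iff_pos]
      exact mul_self_pos.2 (label_ne_zero (hN rfl) j)
    simp only [theta]
    rw [← Int.cast_mul]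
    congr 1
    linear_combination (label N i).sign * (label N k).sign * h

theorem theta_self (hN : c = LieCase.symplectic → Even N) (i : Fin N) : theta c i i = 1 := by
  cases c
  · rfl
  · have h : (label N i).sign * (label N i).sign = 1 := by
      rw [← Int.sign_mul, Int.sign_eq_one_iff_pos]
      exact mul_self_pos.2 (label_ne_zero (hN rfl) i)
    simp [theta, h]

theorem theta_rev_left (i j : Fin N) : theta c i.rev j = c.sign * theta c i j := by
  cases c
  · simp [theta, LieCase.sign]
  · simp [theta, label_rev, Int.sign_neg, LieCase.sign]

theorem theta_rev_right (i j : Fin N) : theta c i j.rev = c.sign * theta c i j := by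
  rw [theta_symm, theta_rev_left, theta_symm]

theorem sign_mul_sign (c : LieCase) : c.sign * c.sign = 1 := by
  cases c <;> simp [LieCase.sign]

variable (c N) in
/-- The projection of the free algebra to the twisted Yangian. -/
def toTw : FreeGen N →ₐ[ℂ] TwYangian c N :=
  (RingQuot.mkAlgHom ℂ (SymmRel c N)).comp (RingQuot.mkAlgHom ℂ (ExtRel c N))

theorem genS_eq_mk (i j : Fin N) :
    genS c N i j = PowerSeries.mk fun r => toTw c N (freeCoeff i j r) := by
  ext r
  simp only [genS, extSeries, Matrix.of_apply, coeff_map, coeff_mk]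
  rfl

theorem toTw_freeCoeff (i j : Fin N) (r : ℤ) :
    toTw c N (freeCoeff i j r) = intCoeff (genS c N i j) r := by
  rcases r with r | r
  · rw [genS_eq_mk]
    simp [intCoeff]
  · simp [freeCoeff, intCoeff]

theorem toTw_quaternary (i j k l : Fin N) (r t : ℤ) :
    toTw c N (relComm i j k l (r + 2) t - relComm i j k l r (t + 2)) =
    toTw c N ((relB i j k l (r + 1) t + relB i j k l r (t + 1)) -
        (relC c i j k l (r + 1) t - relC c i j k l r (t + 1)) + relD c i j k l r t) := by
  simp only [toTw, AlgHom.comp_apply]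
  rw [RingQuot.mkAlgHom_rel ℂ (ExtRel.quaternary i j k l r t)]

/-- The quaternary relations for the coefficients of a matrix of series. -/
def IsQuaternary (c : LieCase) {N : ℕ} {A : Type*} [Ring A] [Algebra ℂ A]
    (S : Matrix (Fin N) (Fin N) A⟦X⟧) : Prop :=
  ∀ (i j k l : Fin N) (r t : ℤ),
    (intCoeff (S i j) (r + 2) * intCoeff (S k l) t - intCoeff (S k l) t * intCoeff (S i j) (r + 2)) -
      (intCoeff (S i j) r * intCoeff (S k l) (t + 2) -
        intCoeff (S k l) (t + 2) * intCoeff (S i j) r) =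
    ((intCoeff (S k j) (r + 1) * intCoeff (S i l) t - intCoeff (S k j) t * intCoeff (S i l) (r + 1)) +
      (intCoeff (S k j) r * intCoeff (S i l) (t + 1) -
        intCoeff (S k j) (t + 1) * intCoeff (S i l) r)) -
    ((theta c k j.rev • (intCoeff (S i k.rev) (r + 1) * intCoeff (S j.rev l) t) -
        theta c i l.rev • (intCoeff (S k i.rev) t * intCoeff (S l.rev j) (r + 1))) -
      (theta c k j.rev • (intCoeff (S i k.rev) r * intCoeff (S j.rev l) (t + 1)) -
        theta c i l.rev • (intCoeff (S k i.rev) (t + 1) * intCoeff (S l.rev j) r))) +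
    theta c i j.rev • (intCoeff (S k i.rev) r * intCoeff (S j.rev l) t -
      intCoeff (S k i.rev) t * intCoeff (S j.rev l) r)

/-- The symmetry relation for a matrix of series. -/
def IsSymmetric (c : LieCase) {N : ℕ} {A : Type*} [Ring A] [Algebra ℂ A]
    (S : Matrix (Fin N) (Fin N) A⟦X⟧) : Prop :=
  ∀ i j : Fin N, theta c i j • substLin (-1) 0 (S j.rev i.rev) =
    S i j + c.sign • (invLin 2 0 • (S i j - substLin (-1) 0 (S i j)))

theorem isQuaternary_genS (c : LieCase) (N : ℕ) : IsQuaternary c (genS c N) := by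
  intro i j k l r t
  have h := toTw_quaternary (c := c) i j k l r t
  simpa only [relComm, relB, relC, relD, map_sub, map_add, map_mul, map_smul,
    toTw_freeCoeff] using h

/-- Stating the transfer for an arbitrary algebra homomorphism keeps the quotient construction of
the Yangian out of the computation. -/
theorem symm_map {A' : Type*} [Ring A'] [Algebra ℂ A'] (φ : A →ₐ[ℂ] A') (z w : ℂ) (q : ℂ⟦X⟧)
    (f g : A⟦X⟧)
    (h : ∀ m, φ (coeff m (z • substLin (-1) 0 f)) =
      φ (coeff m (g + w • (scal A q * (g - substLin (-1) 0 g))))) :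
    z • substLin (-1) 0 (PowerSeries.map (φ : A →+* A') f) =
      PowerSeries.map (φ : A →+* A') g + w • (q • (PowerSeries.map (φ : A →+* A') g -
        substLin (-1) 0 (PowerSeries.map (φ : A →+* A') g))) := by
  have h' : PowerSeries.map (φ : A →+* A') (z • substLin (-1) 0 f) =
      PowerSeries.map (φ : A →+* A') (g + w • (scal A q * (g - substLin (-1) 0 g))) := by
    ext m
    rw [coeff_map, coeff_map]
    exact h m
  have h2 : ∀ (z : ℂ) (f : A⟦X⟧), PowerSeries.map (φ : A →+* A') (z • f) =
      z • PowerSeries.map (φ : A →+* A') f := by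
    intro z f; ext n; simp
  rw [h2, map_add, h2, map_mul, map_sub, map_substLin, map_substLin, map_scal] at h'
  exact h'

theorem genS_apply (i j : Fin N) : genS c N i j =
    PowerSeries.map (RingQuot.mkAlgHom ℂ (SymmRel c N) : ExtYangian c N →+* TwYangian c N)
      (extSeries c i j) := rfl

theorem mkAlgHom_symm (i j : Fin N) (m : ℕ) : RingQuot.mkAlgHom ℂ (SymmRel c N)
      (PowerSeries.coeff m (theta c i j • substLin (-1) 0 (extSeries c j.rev i.rev))) =
    RingQuot.mkAlgHom ℂ (SymmRel c N)
      (PowerSeries.coeff m (extSeries c i j + c.sign • (scal (ExtYangian c N) (invLin 2 0) *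
        (extSeries c i j - substLin (-1) 0 (extSeries c i j))))) :=
  RingQuot.mkAlgHom_rel ℂ (SymmRel.symm i j m)

theorem isSymmetric_genS (c : LieCase) (N : ℕ) : IsSymmetric c (genS c N) := by
  intro i j
  have h := symm_map (A := ExtYangian c N) (A' := TwYangian c N)
    (RingQuot.mkAlgHom ℂ (SymmRel c N)) (theta c i j) c.sign (invLin 2 0)
    (extSeries c j.rev i.rev) (extSeries c i j) (mkAlgHom_symm i j)
  rw [genS_apply, genS_apply]
  exact h

theorem invLin_ne_zero {a : ℂ} (ha : a ≠ 0) (b : ℂ) : invLin a b ≠ 0 := by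
  intro h
  have := invLin_mul ha b
  rw [h, zero_mul] at this
  exact X_ne_zero this.symm

/-- For `U = 1/(u+a)`, `V = 1/(u+b)` and `r = -1/(2u+a+b)` these are partial fractions: `V - U =
(a-b)UV` and `U + V = (2u+a+b)UV`. -/
theorem invLin_relations {a b : ℂ} (hab : a ≠ b) :
    invLin 1 b - invLin 1 a = C (a - b) * (invLin 1 a * invLin 1 b) ∧
    invLin (-2) (-a - b) * (invLin 1 a + invLin 1 b) = -(invLin 1 a * invLin 1 b) ∧
    C (a - b) * (C (a - b)⁻¹ : ℂ⟦X⟧) = 1 ∧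
    C (a - b) * (invLin 1 a ^ 2 * invLin 1 b ^ 2) ≠ 0 := by
  have hU : invLin 1 a * (1 + C a * X) = X := by simpa using invLin_mul one_ne_zero a
  have hV : invLin 1 b * (1 + C b * X) = X := by simpa using invLin_mul one_ne_zero b
  have hr : invLin (-2) (-a - b) * (C (-2) + C (-a - b) * X) = X := invLin_mul (by norm_num) _
  have h2 : (C (-2) : ℂ⟦X⟧) = -2 := by rw [map_neg, map_ofNat]
  simp only [h2, map_sub, map_neg] at hr
  have hd : C (a - b) * (C (a - b)⁻¹ : ℂ⟦X⟧) = 1 := by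
    rw [← map_mul, mul_inv_cancel₀ (sub_ne_zero.2 hab), map_one]
  refine ⟨?_, ?_, hd, ?_⟩
  · apply mul_left_cancel₀ (X_ne_zero (R := ℂ))
    rw [map_sub]
    linear_combination -invLin 1 b * hU + invLin 1 a * hV
  · apply mul_left_cancel₀ (X_ne_zero (R := ℂ))
    linear_combination -(invLin 1 a * invLin 1 b) * hr -
      invLin (-2) (-a - b) * invLin 1 b * hU - invLin (-2) (-a - b) * invLin 1 a * hV
  · refine mul_ne_zero (left_ne_zero_of_mul_eq_one hd)
      (mul_ne_zero (pow_ne_zero _ (invLin_ne_zero one_ne_zero a))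
        (pow_ne_zero _ (invLin_ne_zero one_ne_zero b)))

/-- With `u + a` and `u + b` in place of `u` and `v`, the difference of the variables is the
constant `a - b` and their sum is `-1/r`. Dividing the relation by the product of the two therefore
leaves only the coefficients `1/(a-b)`, `r` and their product. -/
theorem evalTwo_relation {a b : ℂ} (hab : a ≠ b) (x y z w : ℤ → ℤ → A)
    (hx : ∀ r t : ℤ, r < 0 ∨ t < 0 → x r t = 0) (hy : ∀ r t : ℤ, r < 0 ∨ t < 0 → y r t = 0)
    (hz : ∀ r t : ℤ, r < 0 ∨ t < 0 → z r t = 0) (hw : ∀ r t : ℤ, r < 0 ∨ t < 0 → w r t = 0)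
    (key : ∀ r t : ℤ, x (r + 2) t - x r (t + 2) =
      (y (r + 1) t + y r (t + 1)) - (z (r + 1) t - z r (t + 1)) + w r t) :
    evalTwo a b x = (C (a - b)⁻¹ : ℂ⟦X⟧) • evalTwo a b y +
      invLin (-2) (-a - b) • evalTwo a b z -
      (C (a - b)⁻¹ * invLin (-2) (-a - b)) • evalTwo a b w := by
  -- Multiplication by `u⁻² v⁻²` removes all positive powers, which cannot be evaluated as series in
  -- `u⁻¹`.
  have key' : ∀ r t : ℤ, x r (t - 2) - x (r - 2) t =
      (y (r - 1) (t - 2) + y (r - 2) (t - 1)) - (z (r - 1) (t - 2) - z (r - 2) (t - 1)) +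
        w (r - 2) (t - 2) := by
    intro r t
    have h := key (r - 2) (t - 2)
    rwa [show r - 2 + 2 = r by ring, show t - 2 + 2 = t by ring, show r - 2 + 1 = r - 1 by ring,
      show t - 2 + 1 = t - 1 by ring] at h
  have E := congrArg (evalTwo a b) (funext fun r => funext fun t => key' r t)
  rw [evalTwo_sub a b (fun r t => x r (t - 2)), evalTwo_add a b _ fun r t => w (r - 2) (t - 2),
    evalTwo_sub a b (fun r t => y (r - 1) (t - 2) + y (r - 2) (t - 1)),
    evalTwo_add a b fun r t => y (r - 1) (t - 2),
    evalTwo_sub a b fun r t => z (r - 1) (t - 2)] at E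
  have e1 := evalTwo_shift a b x 0 2 hx
  have e2 := evalTwo_shift a b x 2 0 hx
  have e3 := evalTwo_shift a b y 1 2 hy
  have e4 := evalTwo_shift a b y 2 1 hy
  have e5 := evalTwo_shift a b z 1 2 hz
  have e6 := evalTwo_shift a b z 2 1 hz
  have e7 := evalTwo_shift a b w 2 2 hw
  simp only [Nat.cast_zero, Nat.cast_one, Nat.cast_ofNat, sub_zero] at e1 e2 e3 e4 e5 e6 e7
  rw [e1, e2, e3, e4, e5, e6, e7] at E
  clear e1 e2 e3 e4 e5 e6 e7 key key' hx hy hz hw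
  obtain ⟨hUV, hrUV, hd, hne⟩ := invLin_relations hab
  generalize evalTwo a b x = x at *
  generalize evalTwo a b y = y at *
  generalize evalTwo a b z = z at *
  generalize evalTwo a b w = w at *
  generalize invLin 1 a = U at *
  generalize invLin 1 b = V at *
  generalize invLin (-2) (-a - b) = r at *
  generalize (C (a - b)⁻¹ : ℂ⟦X⟧) = d at *
  generalize (C (a - b) : ℂ⟦X⟧) = e at *
  apply smul_left_cancel_of_ne_zero hne
  -- Here `-r` is the inverse of the sum of the two variables, so only the constant `e = a - b`
  -- remains to be divided out.
  have E' := congrArg (fun t => -r • t) E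
  simp only [smul_sub (-r), smul_add (-r), smul_smul (-r)] at E'
  rw [smul_sub (e * _), smul_add (e * _), smul_smul, smul_smul, smul_smul]
  have c1 : e * (U ^ 2 * V ^ 2) = -r * (U ^ 0 * V ^ 2) - -r * (U ^ 2 * V ^ 0) := by
    linear_combination (e * U * V) * hrUV + r * (U + V) * hUV
  have c2 : e * (U ^ 2 * V ^ 2) * d = -r * (U ^ 1 * V ^ 2) + -r * (U ^ 2 * V ^ 1) := by
    linear_combination (U ^ 2 * V ^ 2) * hd + U * V * hrUV
  have c3 : e * (U ^ 2 * V ^ 2) * r = -(-r * (U ^ 1 * V ^ 2)) + -r * (U ^ 2 * V ^ 1) := by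
    linear_combination -r * U * V * hUV
  have c4 : e * (U ^ 2 * V ^ 2) * (d * r) = -(-r * (U ^ 2 * V ^ 2)) := by
    linear_combination (U ^ 2 * V ^ 2) * r * hd
  rw [c2, c3, c4, c1, sub_smul, E', add_smul, add_smul, neg_smul, neg_smul]
  abel

/-- The relation of two generating series at `u + a` and `u + b`, after division by the polynomial
factor. -/
theorem IsQuaternary.eval {S : Matrix (Fin N) (Fin N) A⟦X⟧} (hS : IsQuaternary c S) {a b : ℂ}
    (hab : a ≠ b) (i j k l : Fin N) :
    substLin 1 a (S i j) * substLin 1 b (S k l) -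
      substLin 1 b (S k l) * substLin 1 a (S i j) =
    (C (a - b)⁻¹ : ℂ⟦X⟧) • (substLin 1 a (S k j) * substLin 1 b (S i l) -
      substLin 1 b (S k j) * substLin 1 a (S i l)) +
    invLin (-2) (-a - b) • (theta c k j.rev •
        (substLin 1 a (S i k.rev) * substLin 1 b (S j.rev l)) -
      theta c i l.rev •
        (substLin 1 b (S k i.rev) * substLin 1 a (S l.rev j))) -
    (C (a - b)⁻¹ * invLin (-2) (-a - b)) • (theta c i j.rev •
      (substLin 1 a (S k i.rev) * substLin 1 b (S j.rev l) -
        substLin 1 b (S k i.rev) * substLin 1 a (S j.rev l))) := by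
  have hneg : ∀ (f : A⟦X⟧) {r : ℤ}, r < 0 → intCoeff f r = 0 := fun f r h => intCoeff_of_neg f h
  have h := evalTwo_relation hab
    (fun r t => intCoeff (S i j) r * intCoeff (S k l) t - intCoeff (S k l) t * intCoeff (S i j) r)
    (fun r t => intCoeff (S k j) r * intCoeff (S i l) t - intCoeff (S k j) t * intCoeff (S i l) r)
    (fun r t => theta c k j.rev • (intCoeff (S i k.rev) r * intCoeff (S j.rev l) t) -
      theta c i l.rev • (intCoeff (S k i.rev) t * intCoeff (S l.rev j) r))
    (fun r t => theta c i j.rev • (intCoeff (S k i.rev) r * intCoeff (S j.rev l) t -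
      intCoeff (S k i.rev) t * intCoeff (S j.rev l) r))
    (by rintro r t (h | h) <;> simp [hneg _ h]) (by rintro r t (h | h) <;> simp [hneg _ h])
    (by rintro r t (h | h) <;> simp [hneg _ h]) (by rintro r t (h | h) <;> simp [hneg _ h])
    (hS i j k l)
  simpa only [evalTwo_sub, evalTwo_smul, evalTwo_mul, evalTwo_mul_swap] using h

end Relations

end

end SkewTwisted

/-! ### Operators on tensor space and the reflection equation -/

namespace SkewTwisted

noncomputable section

open Equiv

/-- The properties of the numbers `θ_{ij}` used below. -/
structure IsTheta {𝕜 : Type*} [CommRing 𝕜] {N : ℕ} (θ : Fin N → Fin N → 𝕜) : Prop where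
  mul : ∀ i j l, θ i j * θ j l = θ i l
  self : ∀ i, θ i i = 1
  rev_rev : ∀ i j, θ i.rev j.rev = θ i j

/-- The operator `Q` acting on the sites `p` and `q`. -/
def siteQ {𝕜 : Type*} [CommRing 𝕜] (B : Type*) [Ring B] [Algebra 𝕜 B] {k N : ℕ}
    (θ : Fin N → Fin N → 𝕜) (p q : Fin k) : Matrix (Fin k → Fin N) (Fin k → Fin N) B :=
  Matrix.of fun x y =>
    if (∀ w, w ≠ p → w ≠ q → x w = y w) ∧ x q = (x p).rev ∧ y q = (y p).rev then
      algebraMap 𝕜 B (θ (x q) (y q)) else 0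

section Action

variable {𝕜 : Type*} [CommRing 𝕜] {B : Type*} [Ring B] [Algebra 𝕜 B] {k N : ℕ}
  {θ : Fin N → Fin N → 𝕜}

theorem opP_mul_apply (σ : Perm (Fin k)) (M : Matrix (Fin k → Fin N) (Fin k → Fin N) B)
    (x y : Fin k → Fin N) : (opP B σ * M : Matrix (Fin k → Fin N) (Fin k → Fin N) B) x y = M (x ∘ σ) y := by
  rw [Matrix.mul_apply, Finset.sum_eq_single (x ∘ σ)]
  · simp [opP, Function.comp_assoc]
  · intro z _ hz
    simp only [opP, Matrix.of_apply]
    rw [if_neg, zero_mul]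
    rintro rfl
    simp [Function.comp_assoc] at hz
  · simp

theorem mul_opP_apply (σ : Perm (Fin k)) (M : Matrix (Fin k → Fin N) (Fin k → Fin N) B)
    (x y : Fin k → Fin N) : (M * opP B σ : Matrix (Fin k → Fin N) (Fin k → Fin N) B) x y = M x (y ∘ σ.symm) := by
  rw [Matrix.mul_apply, Finset.sum_eq_single (y ∘ σ.symm)]
  · simp [opP]
  · intro z _ hz
    simp only [opP, Matrix.of_apply]
    rw [if_neg hz, mul_zero]
  · simp

theorem opP_one : opP B (1 : Perm (Fin k)) = (1 : Matrix (Fin k → Fin N) (Fin k → Fin N) B) := by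
  ext x y
  simp only [opP, Matrix.of_apply, Matrix.one_apply]
  rfl

theorem opP_mul (σ τ : Perm (Fin k)) :
    opP B (σ * τ) = (opP B σ * opP B τ : Matrix (Fin k → Fin N) (Fin k → Fin N) B) := by
  ext x y
  rw [← mul_one (opP B (σ * τ)), ← mul_one (opP B τ), opP_mul_apply, opP_mul_apply, opP_mul_apply]
  rfl

theorem onOne_mul_apply (p : Fin k) (T : Matrix (Fin N) (Fin N) B)
    (M : Matrix (Fin k → Fin N) (Fin k → Fin N) B) (x y : Fin k → Fin N) :
    (onOne p T * M) x y = ∑ j, T (x p) j * M (Function.update x p j) y := by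
  rw [Matrix.mul_apply]
  symm
  refine Finset.sum_of_injOn (fun j => Function.update x p j)
    ((Function.update_injective x p).injOn) (by simp) ?_ ?_
  · intro z _ hz
    simp only [onOne, Matrix.of_apply]
    rw [if_neg, zero_mul]
    intro h
    refine hz ⟨z p, by simp, ?_⟩
    ext1 q
    by_cases hq : q = p
    · subst hq; simp
    · simp [hq, h q hq]
  · intro j _
    simp only [onOne, Matrix.of_apply, Function.update_self]
    rw [if_pos]
    intro q hq
    simp [hq]

/-- On its two sites `Q` projects, up to signs, onto the span of one vector pairing opposite
indices. Hence the condition on the row and a single sum over the pairs `(-i, i)`. -/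
theorem siteQ_mul_apply {p q : Fin k} (hpq : p ≠ q)
    (M : Matrix (Fin k → Fin N) (Fin k → Fin N) B) (x y : Fin k → Fin N) :
    (siteQ B θ p q * M) x y = if x q = (x p).rev then
      ∑ i, θ (x q) i • M (Function.update (Function.update x p i.rev) q i) y else 0 := by
  rw [Matrix.mul_apply]
  split_ifs with hx
  · symm
    refine Finset.sum_of_injOn (fun i => Function.update (Function.update x p i.rev) q i)
      ?_ (by simp) ?_ ?_
    · intro i _ j _ h
      have := congrFun h q
      simpa using this
    · intro z _ hz
      simp only [siteQ, Matrix.of_apply]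
      rw [if_neg, zero_mul]
      rintro ⟨h, -, h2⟩
      refine hz ⟨z q, by simp, ?_⟩
      ext1 w
      by_cases hw : w = q
      · subst hw; simp
      · by_cases hw' : w = p
        · subst hw'; simp [hw, h2]
        · simp [hw, hw', h w hw' hw]
    · intro i _
      simp only [siteQ, Matrix.of_apply, Function.update_self]
      rw [if_pos, ← Algebra.smul_def]
      refine ⟨fun w h1 h2 => by simp [h1, h2], hx, by simp [hpq]⟩
  · refine Finset.sum_eq_zero fun z _ => ?_
    simp only [siteQ, Matrix.of_apply]
    rw [if_neg (fun h => hx h.2.1), zero_mul]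

theorem opP_mul_onOne (σ : Perm (Fin k)) (p : Fin k) (T : Matrix (Fin N) (Fin N) B) :
    opP B σ * onOne p T = onOne (σ p) T * opP B σ := by
  ext x y
  rw [← mul_one (onOne p T), ← mul_one (opP B σ), mul_assoc, opP_mul_apply, one_mul,
    onOne_mul_apply, onOne_mul_apply]
  refine Finset.sum_congr rfl fun j _ => ?_
  rw [opP_mul_apply, Function.comp_apply]
  refine congrArg (fun v => _ * (1 : Matrix (Fin k → Fin N) (Fin k → Fin N) B) v y) ?_
  ext1 q
  by_cases hq : q = p
  · subst hq; simp
  · simp [hq]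

theorem opP_mul_siteQ (σ : Perm (Fin k)) {p q : Fin k} (hpq : p ≠ q) :
    opP B σ * siteQ B θ p q = siteQ B θ (σ p) (σ q) * opP B σ := by
  ext x y
  rw [← mul_one (siteQ B θ p q), ← mul_one (opP B σ), mul_assoc, opP_mul_apply, one_mul,
    siteQ_mul_apply hpq, siteQ_mul_apply (σ.injective.ne hpq)]
  refine if_congr Iff.rfl (Finset.sum_congr rfl fun j _ => ?_) rfl
  rw [opP_mul_apply, Function.comp_apply]
  refine congrArg (fun v => _ • (1 : Matrix (Fin k → Fin N) (Fin k → Fin N) B) v y) ?_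
  ext1 w
  by_cases hw : w = q
  · subst hw; simp
  · by_cases hw' : w = p
    · subst hw'; simp [hw]
    · simp [hw, hw']

theorem siteQ_symm (hθ : IsTheta θ) (p q : Fin k) : siteQ B θ p q = siteQ B θ q p := by
  ext x y
  simp only [siteQ, Matrix.of_apply]
  have h : ((∀ w, w ≠ p → w ≠ q → x w = y w) ∧ x q = (x p).rev ∧ y q = (y p).rev) ↔
      ((∀ w, w ≠ q → w ≠ p → x w = y w) ∧ x p = (x q).rev ∧ y p = (y q).rev) := by
    refine and_congr ⟨fun h w a b => h w b a, fun h w a b => h w b a⟩ (and_congr ?_ ?_)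
    all_goals constructor <;> intro h <;> rw [h, Fin.rev_rev]
  by_cases h1 : (∀ w, w ≠ p → w ≠ q → x w = y w) ∧ x q = (x p).rev ∧ y q = (y p).rev
  · rw [if_pos h1, if_pos (h.1 h1), h1.2.1, h1.2.2, hθ.rev_rev]
  · rw [if_neg h1, if_neg (fun h2 => h1 (h.2 h2))]

/-- Two contractions sharing the site `c` form a chain: the intermediate index is forced, and what
remains is one contraction with the index at `a` transported to `b`. This is how `Q` turns into a
permutation against an antisymmetrizer. -/
theorem siteQ_mul_siteQ (hθ : IsTheta θ) {a b c : Fin k} (hab : a ≠ b) (hca : c ≠ a)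
    (hcb : c ≠ b) :
    siteQ B θ c a * siteQ B θ c b =
      (opP B (swap a b) * siteQ B θ c b : Matrix (Fin k → Fin N) (Fin k → Fin N) B) := by
  ext x y
  rw [← mul_one (siteQ B θ c b), siteQ_mul_apply hca, opP_mul_apply, siteQ_mul_apply hcb]
  simp only [Function.comp_apply, swap_apply_right, swap_apply_of_ne_of_ne hca hcb]
  refine if_congr Iff.rfl ?_ rfl
  rw [Finset.sum_eq_single (x b)]
  · rw [siteQ_mul_apply hcb, if_pos (by simp [hca, hab.symm, hcb.symm])]
    rw [Finset.smul_sum]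
    refine Finset.sum_congr rfl fun j _ => ?_
    rw [smul_smul]
    congr 1
    · simp [hab.symm, hcb.symm, hθ.mul]
    · refine congrArg (fun v => (1 : Matrix (Fin k → Fin N) (Fin k → Fin N) B) v y) ?_
      ext1 w
      by_cases h1 : w = b
      · subst h1; simp
      · by_cases h2 : w = c
        · subst h2; simp [h1]
        · by_cases h3 : w = a
          · subst h3; simp [h1, h2]
          · simp [h1, h2, h3, swap_apply_of_ne_of_ne]
  · intro i _ hi
    rw [siteQ_mul_apply hcb, if_neg, smul_zero]
    simp [hca, hab.symm, hcb.symm, hi.symm]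
  · simp

theorem commute_onOne_siteQ (T : Matrix (Fin N) (Fin N) B) {p a b : Fin k} (hab : a ≠ b)
    (hpa : p ≠ a) (hpb : p ≠ b) : Commute (onOne p T) (siteQ B θ a b) := by
  change onOne p T * siteQ B θ a b = siteQ B θ a b * onOne p T
  rw [← mul_one (onOne p T * _), ← mul_one (siteQ B θ a b * _), mul_assoc, mul_assoc]
  ext x y
  simp only [siteQ_mul_apply hab, onOne_mul_apply]
  simp only [ne_eq, hpa.symm, hpb.symm, not_false_eq_true, Function.update_of_ne, hpa, hpb]
  split_ifs
  · simp only [Finset.mul_sum, Finset.smul_sum]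
    rw [Finset.sum_comm]
    refine Finset.sum_congr rfl fun i _ => Finset.sum_congr rfl fun j _ => ?_
    rw [mul_smul_comm, Function.update_comm hpa, Function.update_comm hpb]
  · simp

theorem commute_siteQ_siteQ {p q a b : Fin k} (hpq : p ≠ q) (hab : a ≠ b)
    (hpa : p ≠ a) (hpb : p ≠ b) (hqa : q ≠ a) (hqb : q ≠ b) :
    Commute (siteQ B θ p q : Matrix (Fin k → Fin N) (Fin k → Fin N) B) (siteQ B θ a b) := by
  change siteQ B θ p q * siteQ B θ a b = siteQ B θ a b * siteQ B θ p q
  rw [← mul_one (siteQ B θ p q * _), ← mul_one (siteQ B θ a b * _), mul_assoc, mul_assoc]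
  ext x y
  simp only [siteQ_mul_apply hab, siteQ_mul_apply hpq]
  simp only [ne_eq, hpa.symm, hpb.symm, hqa.symm, hqb.symm, not_false_eq_true,
    Function.update_of_ne, hpa, hpb, hqa, hqb]
  split_ifs
  · simp only [Finset.smul_sum]
    rw [Finset.sum_comm]
    refine Finset.sum_congr rfl fun i _ => Finset.sum_congr rfl fun j _ => ?_
    rw [smul_comm]
    congr 3
    rw [Function.update_comm hqa, Function.update_comm hpa, Function.update_comm hqb,
      Function.update_comm hpb]
  · simp
  · simp
  · rfl

/-- The relation between two matrices of generators, entry by entry. -/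
def PairRelation (θ : Fin N → Fin N → 𝕜) (d r : 𝕜) (S T : Matrix (Fin N) (Fin N) B) : Prop :=
  ∀ i j p l : Fin N, S i j * T p l - T p l * S i j =
    d • (S p j * T i l - T p j * S i l) +
    r • (θ p j.rev • (S i p.rev * T j.rev l) - θ i l.rev • (T p i.rev * S l.rev j)) -
    (d * r) • (θ i j.rev • (S p i.rev * T j.rev l - T p i.rev * S j.rev l))

theorem onOne_mul_onOne_apply {a b : Fin k} (hab : a ≠ b) (S T : Matrix (Fin N) (Fin N) B)
    (x y : Fin k → Fin N) : (onOne a S * onOne b T) x y =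
      open Classical in if ∀ w, w ≠ a → w ≠ b → x w = y w then S (x a) (y a) * T (x b) (y b)
        else 0 := by
  rw [onOne_mul_apply, Finset.sum_eq_single (y a)]
  · simp only [onOne, Matrix.of_apply]
    rw [Function.update_of_ne hab.symm]
    by_cases h : ∀ w, w ≠ a → w ≠ b → x w = y w
    · rw [if_pos h, if_pos]
      intro w hw
      by_cases hwa : w = a
      · subst hwa; simp
      · simp [hwa, h w hwa hw]
    · rw [if_neg h, if_neg, mul_zero]
      intro h'
      refine h fun w h1 h2 => ?_
      have := h' w h2
      rwa [Function.update_of_ne h1] at this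
  · intro j _ hj
    simp only [onOne, Matrix.of_apply]
    rw [if_neg, mul_zero]
    intro h
    have := h a hab
    rw [Function.update_self] at this
    exact hj this
  · simp

theorem onOne_mul_siteQ_mul_onOne_apply {a b : Fin k} (hab : a ≠ b)
    (S T : Matrix (Fin N) (Fin N) B) (x y : Fin k → Fin N) :
    (onOne a S * (siteQ B θ a b * onOne b T)) x y =
      open Classical in if ∀ w, w ≠ a → w ≠ b → x w = y w then
        θ (x b) (y a).rev • (S (x a) (x b).rev * T (y a).rev (y b)) else 0 := by
  rw [onOne_mul_apply, Finset.sum_eq_single (x b).rev]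
  · rw [siteQ_mul_apply hab, if_pos (by simp [hab.symm]), Finset.sum_eq_single (y a).rev]
    · simp only [onOne, Matrix.of_apply]
      by_cases h : ∀ w, w ≠ a → w ≠ b → x w = y w
      · rw [if_pos h, if_pos]
        · simp [hab.symm]
        · intro w hw
          by_cases hwa : w = a
          · subst hwa; simp [hab]
          · simp [hwa, hw, h w hwa hw]
      · rw [if_neg h, if_neg, smul_zero, mul_zero]
        intro h'
        refine h fun w h1 h2 => ?_
        have := h' w h2
        simpa [h1, h2] using this
    · intro i _ hi
      simp only [onOne, Matrix.of_apply]
      rw [if_neg, smul_zero]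
      intro h
      have := h a hab
      rw [Function.update_of_ne hab, Function.update_self] at this
      exact hi (by rw [← this, Fin.rev_rev])
    · simp
  · intro j _ hj
    rw [siteQ_mul_apply hab, if_neg, mul_zero]
    simp only [Function.update_self, Function.update_of_ne hab.symm]
    intro h
    exact hj (by rw [h, Fin.rev_rev])
  · simp

/-- The reflection equation. -/
theorem reflection_equation (hθ : IsTheta θ) {a b : Fin k} (hab : a ≠ b) {d r : 𝕜}
    {S T : Matrix (Fin N) (Fin N) B} (h : PairRelation θ d r S T) :
    (1 - d • opP B (swap a b)) * (onOne a S * ((1 - r • siteQ B θ a b) * onOne b T)) =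
    onOne b T * ((1 - r • siteQ B θ a b) * onOne a S) * (1 - d • opP B (swap a b)) := by
  have e1 : ∀ x y : Fin k → Fin N,
      (∀ w, w ≠ a → w ≠ b → (x ∘ swap a b) w = y w) ↔ ∀ w, w ≠ a → w ≠ b → x w = y w := by
    intro x y
    refine forall_congr' fun w => forall_congr' fun h1 => forall_congr' fun h2 => ?_
    rw [Function.comp_apply, swap_apply_of_ne_of_ne h1 h2]
  have e2 : ∀ x y : Fin k → Fin N,
      (∀ w, w ≠ b → w ≠ a → x w = (y ∘ swap a b) w) ↔ ∀ w, w ≠ a → w ≠ b → x w = y w := by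
    intro x y
    refine forall_congr' fun w => ⟨fun h h1 h2 => ?_, fun h h1 h2 => ?_⟩
    · have := h h2 h1
      rwa [Function.comp_apply, swap_apply_of_ne_of_ne h1 h2] at this
    · rw [Function.comp_apply, swap_apply_of_ne_of_ne h2 h1]
      exact h h2 h1
  have e3 : ∀ x y : Fin k → Fin N,
      (∀ w, w ≠ b → w ≠ a → x w = y w) ↔ ∀ w, w ≠ a → w ≠ b → x w = y w :=
    fun x y => forall_congr' fun w => ⟨fun h h1 h2 => h h2 h1, fun h h1 h2 => h h2 h1⟩
  -- The entry formula needs the sites of `Q` in the order of the neighbouring matrices, which is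
  -- opposite on the two sides of the equation.
  rw [siteQ_symm hθ a b]
  conv_lhs => rw [siteQ_symm hθ b a]
  ext x y
  simp only [sub_mul, one_mul, mul_sub, mul_one, smul_mul_assoc, mul_smul_comm, Matrix.sub_apply,
    Matrix.smul_apply, opP_mul_apply, mul_opP_apply, onOne_mul_onOne_apply hab,
    onOne_mul_onOne_apply hab.symm, onOne_mul_siteQ_mul_onOne_apply hab,
    onOne_mul_siteQ_mul_onOne_apply hab.symm, symm_swap, e1, e2, e3]
  by_cases hxy : ∀ w, w ≠ a → w ≠ b → x w = y w
  · simp only [if_pos hxy, Function.comp_apply, swap_apply_left, swap_apply_right]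
    -- Each matrix entry of the reflection equation is a rearrangement of one instance of the pair
    -- relation.
    have := h (x a) (y a) (x b) (y b)
    rw [sub_eq_iff_eq_add] at this
    rw [this]
    simp only [smul_sub, mul_smul, smul_comm r d]
    abel
  · simp only [if_neg hxy, smul_zero, sub_zero]

end Action

end

end SkewTwisted

namespace SkewTwisted

noncomputable section

open Equiv

/-! ### Yang-Baxter relation and fusion in an abstract algebra -/

section AbstractAlgebra

variable {𝕜 : Type*} [CommRing 𝕜] {E : Type*} [Ring E] [Algebra 𝕜 E]

/-- After expansion the cubic terms agree and all remaining terms reduce to multiples of `P * Q` and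
`P * Q'`. The discrepancy is `r r' - d (r - r')` times `P * Q' - P * Q`. -/
theorem yang_baxter {P Q Q' : E} {d r r' : 𝕜} (h1 : P * Q = Q' * P) (h2 : P * Q' = Q * P)
    (h3 : Q * Q' = P * Q') (h4 : Q' * Q = P * Q) (h : r * r' = d * (r - r')) :
    (1 - d • P) * ((1 - r • Q) * (1 - r' • Q')) = (1 - r' • Q') * ((1 - r • Q) * (1 - d • P)) := by
  have h5 : P * (Q * Q') = Q' * (Q * P) := by rw [← mul_assoc, h1, mul_assoc, h2]
  simp only [mul_sub, sub_mul, one_mul, mul_one, smul_mul_assoc, mul_smul_comm, h5]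
  rw [h3, h4, ← h1, ← h2]
  linear_combination (norm := module) h • (P * Q' - P * Q)

/-- The hypotheses amount to `d_i = 1/(x+i)` and `y = 1/x`. Since `A T P_q = -A T` for the sum `T`
of the later `P`'s, each new factor rescales `T` by `1 + y`, and the identity `(1/(x+1))(1 + 1/x) =
1/x` makes the product telescope into a sum. -/
theorem fusion_swap {ι : Type*} {A : E} {P : ι → E} (d : ι → 𝕜) (l : List ι)
    (hP : ∀ a ∈ l, ∀ b ∈ l, a ≠ b → A * P b * P a = -(A * P b)) (hl : l.Nodup) (x y : 𝕜)
    (hd : ∀ (i : ℕ) (h : i < l.length), d l[i] * (x + i) = 1) (hxy : y * x = 1) :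
    A * (l.reverse.map fun q => 1 - d q • P q).prod = A * (1 - y • (l.map P).sum) := by
  induction l generalizing x y with
  | nil => simp
  | cons q l ih =>
    rw [List.reverse_cons, List.map_append, List.prod_append, List.map_singleton,
      List.prod_singleton, ← mul_assoc]
    have hq : d q * x = 1 := by
      have : d q * (x + (0 : ℕ)) = 1 := hd 0 (by simp)
      simpa using this
    have hqy : d q = y := by linear_combination y * hq - d q * hxy
    rcases l with _ | ⟨q', l⟩
    · simp [hqy]
    · have hy' : d q' * (x + 1) = 1 := by
        have : d q' * (x + (1 : ℕ)) = 1 := hd 1 (by simp)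
        simpa using this
      have key : d q' * (1 + y) = y := by linear_combination y * hy' - d q' * hxy
      rw [ih (fun a ha b hb => hP a (List.mem_cons_of_mem _ ha) b (List.mem_cons_of_mem _ hb))
        (List.nodup_cons.1 hl).2 (x + 1) (d q') _ hy']
      · have hs : A * ((q' :: l).map P).sum * P q = -(A * ((q' :: l).map P).sum) := by
          have : ∀ l' : List ι, (∀ b ∈ l', b ∈ q' :: l) →
              A * (l'.map P).sum * P q = -(A * (l'.map P).sum) := by
            intro l' hl'
            induction l' with
            | nil => simp
            | cons b l' ih' =>
              have hb := hl' b (by simp)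
              rw [List.map_cons, List.sum_cons, mul_add, add_mul,
                ih' fun c hc => hl' c (List.mem_cons_of_mem _ hc),
                hP q (by simp) b (List.mem_cons_of_mem _ hb)
                  (by rintro rfl; exact (List.nodup_cons.1 hl).1 hb), neg_add]
          exact this _ fun b hb => hb
        rw [show ((q :: q' :: l).map P).sum = P q + ((q' :: l).map P).sum by
          rw [List.map_cons, List.sum_cons]]
        generalize ((q' :: l).map P).sum = T at hs ⊢
        simp only [mul_sub, sub_mul, mul_one, mul_smul_comm, smul_mul_assoc, hs, hqy, mul_add,
          smul_add, smul_neg]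
        linear_combination (norm := module) (-key) • (A * T)
      · intro i hi
        have := hd (i + 1) (by simpa using hi)
        rw [List.getElem_cons_succ] at this
        push_cast at this
        rw [add_assoc, add_comm (1 : 𝕜)]
        exact this

/-- Here `A T Q_q = -m A Q_q` when `T` is the sum of the `m` preceding contractions. The new
contraction thus acquires the coefficient `r_q (1 + m y)`, which is `y`. -/
theorem fusion_contract {ι : Type*} {A : E} {Q : ι → E} (r : ι → 𝕜) (l : List ι)
    (hQ : ∀ a ∈ l, ∀ b ∈ l, a ≠ b → A * Q a * Q b = -(A * Q b)) (hl : l.Nodup) (y : 𝕜)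
    (hr : ∀ (i : ℕ) (h : i < l.length), r l[i] * (1 + i * y) = y) :
    A * (l.map fun q => 1 - r q • Q q).prod = A * (1 - y • (l.map Q).sum) := by
  induction l using List.reverseRecOn with
  | nil => simp
  | append_singleton l q ih =>
    rw [List.nodup_append] at hl
    have key : r q * (1 + l.length * y) = y := by
      have := hr l.length (by simp)
      rwa [List.getElem_concat_length rfl] at this
    have hs : A * (l.map Q).sum * Q q = -((l.length : 𝕜) • (A * Q q)) := by
      have : ∀ l' : List ι, (∀ b ∈ l', b ∈ l) →
          A * (l'.map Q).sum * Q q = -((l'.length : 𝕜) • (A * Q q)) := by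
        intro l' hl'
        induction l' with
        | nil => simp
        | cons b l' ih' =>
          have hb := hl' b (by simp)
          rw [List.map_cons, List.sum_cons, mul_add, add_mul,
            ih' fun c hc => hl' c (List.mem_cons_of_mem _ hc),
            hQ b (by simp [hb]) q (by simp)
              (by rintro rfl; exact hl.2.2 b hb b (by simp) rfl)]
          rw [List.length_cons, Nat.cast_succ, add_smul, one_smul, neg_add, add_comm]
      exact this _ fun b hb => hb
    rw [List.map_append, List.prod_append, List.map_singleton, List.prod_singleton, ← mul_assoc,
      ih (fun a ha b hb => hQ a (by simp [ha]) b (by simp [hb])) hl.1, List.map_append,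
      List.sum_append, List.map_singleton, List.sum_singleton]
    · generalize (l.map Q).sum = T at hs ⊢
      simp only [mul_sub, sub_mul, mul_one, mul_smul_comm, smul_mul_assoc, hs, mul_add,
        smul_add, smul_neg]
      linear_combination (norm := module) (-key) • (A * Q q)
    · intro i hi
      have := hr i (by rw [List.length_append]; omega)
      rwa [List.getElem_append_left hi] at this

end AbstractAlgebra

/-! ### Sites exchanged inside the bracket -/

/-- The matrices `S_p`, the numbers `1 / (-u_p - u_q)` and `1 / (u_p - u_q)` and the relations
between them. -/
structure BracketData (𝕜 B : Type*) [CommRing 𝕜] [Ring B] [Algebra 𝕜 B] {N : ℕ}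
    (θ : Fin N → Fin N → 𝕜) (k : ℕ) where
  S : Fin k → Matrix (Fin N) (Fin N) B
  r : Fin k → Fin k → 𝕜
  d : Fin k → Fin k → 𝕜
  r_symm : ∀ a b, r a b = r b a
  pair : ∀ a b, a ≠ b → PairRelation θ (d a b) (r a b) (S a) (S b)
  mul_r : ∀ a b c, a ≠ b → r c a * r c b = d a b * (r c a - r c b)

namespace BracketData

variable {𝕜 : Type*} [CommRing 𝕜] {B : Type*} [Ring B] [Algebra 𝕜 B] {k N : ℕ}
  {θ : Fin N → Fin N → 𝕜}

section

variable (D : BracketData 𝕜 B θ k)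

/-- The operator `R^t_{pq}`. -/
def rt (p q : Fin k) : Matrix (Fin k → Fin N) (Fin k → Fin N) B :=
  1 - D.r p q • siteQ B θ p q

/-- The operator `R_{pq}`. -/
def rp (p q : Fin k) : Matrix (Fin k → Fin N) (Fin k → Fin N) B :=
  1 - D.d p q • opP B (swap p q)

/-- The product `⟨S_{p_1}, …, S_{p_m}⟩` for a list of sites `p_1, …, p_m`. -/
def brk : List (Fin k) → Matrix (Fin k → Fin N) (Fin k → Fin N) B
  | [] => 1
  | p :: l => onOne p (D.S p) * ((l.map (D.rt p)).prod * brk l)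

theorem rt_symm (hθ : IsTheta θ) (p q : Fin k) : D.rt p q = D.rt q p := by
  rw [rt, rt, D.r_symm, siteQ_symm hθ]

theorem commute_rt {X : Matrix (Fin k → Fin N) (Fin k → Fin N) B} {p q : Fin k}
    (h : Commute X (siteQ B θ p q)) : Commute X (D.rt p q) :=
  (Commute.one_right X).sub_right (h.smul_right _)

theorem commute_onOne_rt (T : Matrix (Fin N) (Fin N) B) {p a b : Fin k} (hab : a ≠ b)
    (hpa : p ≠ a) (hpb : p ≠ b) : Commute (onOne p T) (D.rt a b) :=
  D.commute_rt (commute_onOne_siteQ T hab hpa hpb)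

theorem commute_rt_rt {p q a b : Fin k} (hpq : p ≠ q) (hab : a ≠ b)
    (hpa : p ≠ a) (hpb : p ≠ b) (hqa : q ≠ a) (hqb : q ≠ b) :
    Commute (D.rt p q) (D.rt a b) :=
  D.commute_rt (D.commute_rt (commute_siteQ_siteQ hpq hab hpa hpb hqa hqb).symm).symm

theorem commute_rp_onOne (T : Matrix (Fin N) (Fin N) B) {p a b : Fin k}
    (hpa : p ≠ a) (hpb : p ≠ b) : Commute (D.rp a b) (onOne p T) := by
  have h : Commute (opP B (swap a b)) (onOne p T) := by
    have := opP_mul_onOne (swap a b) p T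
    rwa [swap_apply_of_ne_of_ne hpa hpb] at this
  exact (Commute.one_left _).sub_left (h.smul_left _)

theorem commute_rp_rt {p q a b : Fin k} (hpq : p ≠ q)
    (hpa : p ≠ a) (hpb : p ≠ b) (hqa : q ≠ a) (hqb : q ≠ b) :
    Commute (D.rp a b) (D.rt p q) := by
  have h : Commute (opP B (swap a b)) (siteQ B θ p q) := by
    have := opP_mul_siteQ (B := B) (θ := θ) (swap a b) hpq
    rwa [swap_apply_of_ne_of_ne hpa hpb, swap_apply_of_ne_of_ne hqa hqb] at this
  exact D.commute_rt ((Commute.one_left _).sub_left (h.smul_left _))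

theorem commute_brk {X : Matrix (Fin k → Fin N) (Fin k → Fin N) B} {l : List (Fin k)}
    (hl : l.Nodup) (h1 : ∀ p ∈ l, ∀ T, Commute X (onOne p T))
    (h2 : ∀ p ∈ l, ∀ q ∈ l, p ≠ q → Commute X (D.rt p q)) : Commute X (D.brk l) := by
  induction l with
  | nil => exact Commute.one_right X
  | cons p l ih =>
    rw [List.nodup_cons] at hl
    refine (h1 p (by simp) _).mul_right ((Commute.list_prod_right _ _ ?_).mul_right (ih hl.2
      (fun q hq => h1 q (by simp [hq])) fun q hq q' hq' => h2 q (by simp [hq]) q' (by simp [hq'])))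
    intro Y hY
    obtain ⟨q, hq, rfl⟩ := List.mem_map.1 hY
    exact h2 p (by simp) q (by simp [hq]) (by rintro rfl; exact hl.1 hq)

/-- The scalar condition of `yang_baxter` is the partial fraction identity `mul_r`; the operator
conditions are conjugation of `Q` by `P` and the chain rule for two contractions. -/
theorem rp_mul_rt_mul_rt (hθ : IsTheta θ) {a b c : Fin k} (hab : a ≠ b) (hca : c ≠ a)
    (hcb : c ≠ b) :
    D.rp a b * (D.rt c a * D.rt c b) = D.rt c b * (D.rt c a * D.rp a b) := by
  refine yang_baxter ?_ ?_ (siteQ_mul_siteQ hθ hab hca hcb) ?_ (D.mul_r a b c hab)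
  · rw [opP_mul_siteQ _ hca, swap_apply_of_ne_of_ne hca hcb, swap_apply_left]
  · rw [opP_mul_siteQ _ hcb, swap_apply_of_ne_of_ne hca hcb, swap_apply_right]
  · rw [siteQ_mul_siteQ hθ hab.symm hcb hca, swap_comm]

/-- Factors at disjoint pairs of sites commute, so the two products can be interleaved into pairs
`R^t_{aq} R^t_{bq}` and `R_{ab}` carried through one pair at a time. -/
theorem rp_mul_prod (hθ : IsTheta θ) {a b : Fin k} (hab : a ≠ b) {l : List (Fin k)}
    (hl : l.Nodup) (ha : a ∉ l) (hb : b ∉ l) :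
    D.rp a b * ((l.map (D.rt a)).prod * (l.map (D.rt b)).prod) =
      (l.map (D.rt b)).prod * ((l.map (D.rt a)).prod * D.rp a b) := by
  induction l with
  | nil => simp
  | cons q l ih =>
    simp only [List.mem_cons, not_or] at ha hb
    rw [List.nodup_cons] at hl
    simp only [List.map_cons, List.prod_cons]
    have hc : ∀ c c', c ≠ c' → c ∉ l → c' ∉ l → c ≠ q → c' ≠ q →
        Commute (l.map (D.rt c)).prod (D.rt c' q) := by
      intro c c' h1 h2 h2' h3 h4
      refine Commute.list_prod_left _ _ fun Y hY => ?_
      obtain ⟨q', hq', rfl⟩ := List.mem_map.1 hY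
      exact D.commute_rt_rt (by rintro rfl; exact h2 hq') h4 h1 h3
        (by rintro rfl; exact h2' hq') (by rintro rfl; exact hl.1 hq')
    have h1 := hc a b hab ha.2 hb.2 ha.1 hb.1
    have h2 := hc b a hab.symm hb.2 ha.2 hb.1 ha.1
    have h3 := D.rp_mul_rt_mul_rt hθ hab (c := q) (Ne.symm ha.1) (Ne.symm hb.1)
    rw [D.rt_symm hθ q a, D.rt_symm hθ q b] at h3
    calc D.rp a b * ((D.rt a q * (l.map (D.rt a)).prod) * (D.rt b q * (l.map (D.rt b)).prod))
        = D.rp a b * (D.rt a q * ((l.map (D.rt a)).prod * D.rt b q) * (l.map (D.rt b)).prod) := by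
          simp only [mul_assoc]
      _ = (D.rp a b * (D.rt a q * D.rt b q)) *
          ((l.map (D.rt a)).prod * (l.map (D.rt b)).prod) := by
          rw [h1.eq]; simp only [mul_assoc]
      _ = D.rt b q * (D.rt a q * (l.map (D.rt b)).prod) *
          ((l.map (D.rt a)).prod * D.rp a b) := by
          rw [h3]; simp only [mul_assoc]; rw [ih hl.2 ha.2 hb.2]
      _ = _ := by
          rw [← h2.eq]; simp only [mul_assoc]

/-- With nothing to the left of `a, b`, the reflection equation exchanges the two matrices and
`rp_mul_prod` exchanges their tails of `R^t`. A site `c` further left contributes `R^t_{ca}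
R^t_{cb}`, reordered by the Yang-Baxter relation. -/
theorem rp_mul_brk (hθ : IsTheta θ) {a b : Fin k} (l l' : List (Fin k))
    (hl : (l ++ a :: b :: l').Nodup) :
    D.rp a b * D.brk (l ++ a :: b :: l') = D.brk (l ++ b :: a :: l') * D.rp a b := by
  induction l with
  | nil =>
    simp only [List.nil_append, List.nodup_cons, List.mem_cons, not_or] at hl
    obtain ⟨⟨hab, ha⟩, hb, hl⟩ := hl
    have h1 : Commute (l'.map (D.rt a)).prod (onOne b (D.S b)) := by
      refine Commute.list_prod_left _ _ fun Y hY => ?_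
      obtain ⟨q, hq, rfl⟩ := List.mem_map.1 hY
      exact (D.commute_onOne_rt _ (by rintro rfl; exact ha hq) (Ne.symm hab)
        (by rintro rfl; exact hb hq)).symm
    have h2 : Commute (l'.map (D.rt b)).prod (onOne a (D.S a)) := by
      refine Commute.list_prod_left _ _ fun Y hY => ?_
      obtain ⟨q, hq, rfl⟩ := List.mem_map.1 hY
      exact (D.commute_onOne_rt _ (by rintro rfl; exact hb hq) hab
        (by rintro rfl; exact ha hq)).symm
    have h3 : Commute (D.rp a b) (D.brk l') := by
      refine D.commute_brk hl (fun p hp T => D.commute_rp_onOne T ?_ ?_)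
        fun p hp q hq hpq => D.commute_rp_rt hpq ?_ ?_ ?_ ?_
      all_goals rintro rfl; simp_all
    have h4 := reflection_equation hθ hab (D.pair a b hab)
    have h5 := D.rp_mul_prod hθ hab hl ha hb
    have h4' : D.rp a b * (onOne a (D.S a) * (D.rt a b * onOne b (D.S b))) =
      onOne b (D.S b) * (D.rt b a * onOne a (D.S a)) * D.rp a b := by
      rw [D.rt_symm hθ b a]; exact h4
    simp only [List.nil_append, brk, List.map_cons, List.prod_cons]
    calc D.rp a b * (onOne a (D.S a) * (D.rt a b * (l'.map (D.rt a)).prod *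
          (onOne b (D.S b) * ((l'.map (D.rt b)).prod * D.brk l'))))
        = D.rp a b * (onOne a (D.S a) * (D.rt a b * onOne b (D.S b))) *
          ((l'.map (D.rt a)).prod * (l'.map (D.rt b)).prod) * D.brk l' := by
          simp only [mul_assoc]
          rw [← mul_assoc (l'.map (D.rt a)).prod, h1.eq]
          simp only [mul_assoc]
      _ = onOne b (D.S b) * (D.rt b a * onOne a (D.S a)) *
          (D.rp a b * ((l'.map (D.rt a)).prod * (l'.map (D.rt b)).prod)) * D.brk l' := by
          rw [h4']; simp only [mul_assoc]
      _ = onOne b (D.S b) * (D.rt b a * (onOne a (D.S a) * (l'.map (D.rt b)).prod)) *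
          ((l'.map (D.rt a)).prod * (D.rp a b * D.brk l')) := by
          rw [h5]; simp only [mul_assoc]
      _ = _ := by
          rw [← h2.eq, h3.eq]; simp only [mul_assoc]
  | cons c l ih =>
    rw [List.cons_append, List.nodup_cons] at hl
    obtain ⟨hc, hl⟩ := hl
    have hca : c ≠ a := by rintro rfl; simp at hc
    have hcb : c ≠ b := by rintro rfl; simp at hc
    have hla : a ∉ l := by
      rw [List.nodup_append] at hl
      exact fun h => hl.2.2 a h a (by simp) rfl
    have hlb : b ∉ l := by
      rw [List.nodup_append] at hl
      exact fun h => hl.2.2 b h b (by simp) rfl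
    have hab : a ≠ b := by
      rw [List.nodup_append] at hl
      have := (List.nodup_cons.1 hl.2.1).1
      rintro rfl; simp at this
    have hla' : a ∉ l' := by
      rw [List.nodup_append] at hl
      have := (List.nodup_cons.1 hl.2.1).1
      intro h; simp [h] at this
    have hlb' : b ∉ l' := by
      rw [List.nodup_append] at hl
      exact (List.nodup_cons.1 (List.nodup_cons.1 hl.2.1).2).1
    have hcl : c ∉ l := fun h => hc (by simp [h])
    have hcl' : c ∉ l' := fun h => hc (by simp [h])
    have h1 := D.commute_rp_onOne (D.S c) hca hcb
    have hprod : ∀ l₀ : List (Fin k), c ∉ l₀ → a ∉ l₀ → b ∉ l₀ →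
        Commute (D.rp a b) (l₀.map (D.rt c)).prod := by
      intro l₀ h1 h2 h3
      refine Commute.list_prod_right _ _ fun Y hY => ?_
      obtain ⟨q, hq, rfl⟩ := List.mem_map.1 hY
      refine D.commute_rp_rt ?_ hca hcb ?_ ?_
      all_goals rintro rfl; simp_all
    have h2 := hprod l hcl hla hlb
    have h3 := hprod l' hcl' hla' hlb'
    have h4 := D.rp_mul_rt_mul_rt hθ hab hca hcb
    simp only [List.cons_append, brk, List.map_append, List.prod_append, List.map_cons,
      List.prod_cons]
    calc D.rp a b * (onOne c (D.S c) * ((l.map (D.rt c)).prod * (D.rt c a * (D.rt c b *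
          (l'.map (D.rt c)).prod)) * D.brk (l ++ a :: b :: l')))
        = (D.rp a b * onOne c (D.S c)) * ((l.map (D.rt c)).prod * (D.rt c a * D.rt c b) *
          (l'.map (D.rt c)).prod * D.brk (l ++ a :: b :: l')) := by simp only [mul_assoc]
      _ = onOne c (D.S c) * ((D.rp a b * (l.map (D.rt c)).prod) * ((D.rt c a * D.rt c b) *
          (l'.map (D.rt c)).prod * D.brk (l ++ a :: b :: l'))) := by
          rw [h1.eq]; simp only [mul_assoc]
      _ = onOne c (D.S c) * ((l.map (D.rt c)).prod * ((D.rp a b * (D.rt c a * D.rt c b)) *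
          ((l'.map (D.rt c)).prod * D.brk (l ++ a :: b :: l')))) := by
          rw [h2.eq]; simp only [mul_assoc]
      _ = onOne c (D.S c) * ((l.map (D.rt c)).prod * (D.rt c b * (D.rt c a *
          ((D.rp a b * (l'.map (D.rt c)).prod) * D.brk (l ++ a :: b :: l'))))) := by
          rw [h4]; simp only [mul_assoc]
      _ = onOne c (D.S c) * ((l.map (D.rt c)).prod * (D.rt c b * (D.rt c a *
          ((l'.map (D.rt c)).prod * (D.rp a b * D.brk (l ++ a :: b :: l')))))) := by
          rw [h3.eq]; simp only [mul_assoc]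
      _ = _ := by
          rw [ih hl]; simp only [mul_assoc]

/-- Each `R^t_{pa}` commutes with the bracket of the sites between `p` and `a`, so all of them can
be gathered in front of the last matrix. -/
theorem brk_append_singleton {a : Fin k} {l : List (Fin k)} (hl : l.Nodup) (ha : a ∉ l) :
    D.brk (l ++ [a]) =
      D.brk l * ((l.map fun q => D.rt q a).prod * onOne a (D.S a)) := by
  induction l with
  | nil => simp [brk]
  | cons p l ih =>
    rw [List.nodup_cons] at hl
    simp only [List.mem_cons, not_or] at ha
    have h : Commute (D.rt p a) (D.brk l) := by
      refine D.commute_brk hl.2 (fun q hq T => (D.commute_onOne_rt T (Ne.symm ha.1) ?_ ?_).symm)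
        fun q hq q' hq' hqq => D.commute_rt_rt (Ne.symm ha.1) hqq ?_ ?_ ?_ ?_
      all_goals rintro rfl; simp_all
    simp only [List.cons_append, brk, List.map_append, List.prod_append, List.map_cons,
      List.map_nil, List.prod_cons, List.prod_nil, mul_one]
    rw [ih hl.2 ha.2]
    simp only [mul_assoc]
    rw [← mul_assoc (D.rt p a) (D.brk l), h.eq]
    simp only [mul_assoc]

/-- Successive exchanges with its right neighbours carry the site `a` to the end. -/
theorem prod_rp_mul_brk (hθ : IsTheta θ) {a : Fin k} (l₀ l : List (Fin k))
    (hl : (l₀ ++ a :: l).Nodup) :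
    (l.reverse.map (D.rp a)).prod * D.brk (l₀ ++ a :: l) =
      D.brk (l₀ ++ l ++ [a]) * (l.reverse.map (D.rp a)).prod := by
  induction l generalizing l₀ with
  | nil => simp
  | cons q l ih =>
    have hl' : (l₀ ++ [q] ++ a :: l).Nodup := by
      refine (List.Perm.nodup_iff ?_).1 hl
      rw [List.append_assoc]
      exact (List.Perm.swap q a l).append_left l₀
    have := ih (l₀ ++ [q]) hl'
    rw [List.reverse_cons, List.map_append, List.prod_append, List.map_singleton,
      List.prod_singleton, mul_assoc, D.rp_mul_brk hθ l₀ l hl, ← mul_assoc]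
    simp only [List.append_assoc, List.singleton_append] at this ⊢
    rw [this]
    simp only [mul_assoc, List.cons_append]

end

end BracketData

end

end SkewTwisted

namespace SkewTwisted

noncomputable section

open Equiv

/-! ### Adding a site, and coset expansions of the antisymmetrizer -/

section Extension

variable {𝕜 : Type*} [CommRing 𝕜] {B : Type*} [Ring B] [Algebra 𝕜 B] {k N : ℕ}
  {θ : Fin N → Fin N → 𝕜}

/-- The operator `M` on the sites `1, …, k`, regarded as an operator on the sites `0, …, k`. -/
def extT (M : Matrix (Fin k → Fin N) (Fin k → Fin N) B) :
    Matrix (Fin (k + 1) → Fin N) (Fin (k + 1) → Fin N) B :=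
  Matrix.of fun x y => if x 0 = y 0 then M (Fin.tail x) (Fin.tail y) else 0

/-- The permutation `σ` of `1, …, k`, regarded as a permutation of `0, …, k`. -/
def extPerm (σ : Perm (Fin k)) : Perm (Fin (k + 1)) := Perm.decomposeFin.symm (0, σ)

theorem extPerm_zero (σ : Perm (Fin k)) : extPerm σ 0 = 0 := by simp [extPerm]

theorem extPerm_succ (σ : Perm (Fin k)) (i : Fin k) : extPerm σ i.succ = (σ i).succ := by
  simp [extPerm]

theorem sign_extPerm (σ : Perm (Fin k)) : Perm.sign (extPerm σ) = Perm.sign σ := by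
  simp [extPerm, Perm.decomposeFin.symm_sign]

theorem extPerm_inv (σ : Perm (Fin k)) : (extPerm σ)⁻¹ = extPerm σ⁻¹ := by
  rw [inv_eq_iff_mul_eq_one]
  ext1 i
  refine Fin.cases ?_ (fun i => ?_) i
  · simp [extPerm_zero]
  · simp [extPerm_succ]

theorem extPerm_swap (a b : Fin k) : extPerm (swap a b) = swap a.succ b.succ := by
  ext1 i
  refine Fin.cases ?_ (fun i => ?_) i
  · rw [extPerm_zero, swap_apply_of_ne_of_ne (Fin.succ_ne_zero _).symm (Fin.succ_ne_zero _).symm]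
  · rw [extPerm_succ, Equiv.swap_apply_def, Equiv.swap_apply_def]
    simp only [Fin.succ_inj]
    split_ifs <;> rfl

theorem exists_extPerm {σ : Perm (Fin (k + 1))} (h : σ 0 = 0) : ∃ τ, σ = extPerm τ := by
  refine ⟨(Perm.decomposeFin σ).2, ?_⟩
  have h1 : Perm.decomposeFin.symm (Perm.decomposeFin σ) = σ := Equiv.symm_apply_apply _ _
  have h2 : (Perm.decomposeFin σ).1 = 0 := by
    rw [← h, ← h1, ← Prod.mk.eta (p := Perm.decomposeFin σ), Perm.decomposeFin_symm_apply_zero, h1]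
  rw [extPerm, ← h2, Prod.mk.eta, h1]

theorem decomposeFin_symm_eq (p : Fin (k + 1)) (σ : Perm (Fin k)) :
    Perm.decomposeFin.symm (p, σ) = swap 0 p * extPerm σ := by
  ext1 i
  refine Fin.cases ?_ (fun i => ?_) i
  · simp [extPerm_zero]
  · simp [extPerm_succ]

theorem extT_mul_apply (M : Matrix (Fin k → Fin N) (Fin k → Fin N) B)
    (M' : Matrix (Fin (k + 1) → Fin N) (Fin (k + 1) → Fin N) B) (x y : Fin (k + 1) → Fin N) :
    (extT M * M') x y = ∑ w, M (Fin.tail x) w * M' (Fin.cons (x 0) w) y := by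
  rw [Matrix.mul_apply]
  symm
  refine Finset.sum_of_injOn (fun w : Fin k → Fin N => (Fin.cons (x 0) w : Fin (k + 1) → Fin N))
    ((Fin.cons_right_injective (α := fun _ => Fin N) (x 0)).injOn) (by simp) ?_ ?_
  · intro z _ hz
    simp only [extT, Matrix.of_apply]
    rw [if_neg, zero_mul]
    intro h
    exact hz ⟨Fin.tail z, by simp, by simp only [h, Fin.cons_self_tail]⟩
  · intro w _
    simp [extT]

theorem extT_mul (M M' : Matrix (Fin k → Fin N) (Fin k → Fin N) B) :
    extT (M * M') = extT M * extT M' := by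
  ext x y
  rw [extT_mul_apply]
  simp only [extT, Matrix.of_apply, Fin.cons_zero, Fin.tail_cons]
  split_ifs
  · rw [Matrix.mul_apply]
  · simp

theorem extT_one : extT (1 : Matrix (Fin k → Fin N) (Fin k → Fin N) B) = 1 := by
  ext x y
  have : x = y ↔ x 0 = y 0 ∧ Fin.tail x = Fin.tail y := by
    constructor
    · rintro rfl; simp
    · rintro ⟨h1, h2⟩
      rw [← Fin.cons_self_tail x, ← Fin.cons_self_tail y, h1, h2]
  simp only [extT, Matrix.of_apply, Matrix.one_apply, this]
  split_ifs <;> simp_all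

theorem extT_sub (M M' : Matrix (Fin k → Fin N) (Fin k → Fin N) B) :
    extT (M - M') = extT M - extT M' := by
  ext x y
  simp only [extT, Matrix.of_apply, Matrix.sub_apply]
  split_ifs <;> simp

theorem extT_zero : extT (0 : Matrix (Fin k → Fin N) (Fin k → Fin N) B) = 0 := by
  ext x y; simp [extT]

theorem extT_add (M M' : Matrix (Fin k → Fin N) (Fin k → Fin N) B) :
    extT (M + M') = extT M + extT M' := by
  ext x y
  simp only [extT, Matrix.of_apply, Matrix.add_apply]
  split_ifs <;> simp

variable (N k B) in
/-- `extT` as an additive homomorphism. -/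
def extTHom : Matrix (Fin k → Fin N) (Fin k → Fin N) B →+
    Matrix (Fin (k + 1) → Fin N) (Fin (k + 1) → Fin N) B where
  toFun := extT
  map_zero' := extT_zero
  map_add' := extT_add

theorem extT_smul (c : 𝕜) (M : Matrix (Fin k → Fin N) (Fin k → Fin N) B) :
    extT (c • M) = c • extT M := by
  ext x y
  simp only [extT, Matrix.of_apply, Matrix.smul_apply]
  split_ifs <;> simp

theorem extT_onOne (p : Fin k) (T : Matrix (Fin N) (Fin N) B) :
    extT (onOne p T) = onOne p.succ T := by
  ext x y
  simp only [extT, onOne, Matrix.of_apply]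
  have : (∀ q, q ≠ p.succ → x q = y q) ↔
      x 0 = y 0 ∧ ∀ q, q ≠ p → Fin.tail x q = Fin.tail y q := by
    rw [Fin.forall_fin_succ]
    simp [Fin.tail, (Fin.succ_ne_zero p).symm]
  by_cases h0 : x 0 = y 0
  · rw [if_pos h0]
    refine if_congr ?_ rfl rfl
    rw [this]; simp [h0]
  · rw [if_neg h0, if_neg]
    rw [this]; simp [h0]

theorem extT_siteQ (p q : Fin k) :
    extT (siteQ B θ p q) = siteQ B θ p.succ q.succ := by
  ext x y
  simp only [extT, siteQ, Matrix.of_apply]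
  have : (∀ w, w ≠ p.succ → w ≠ q.succ → x w = y w) ↔
      x 0 = y 0 ∧ ∀ w, w ≠ p → w ≠ q → Fin.tail x w = Fin.tail y w := by
    rw [Fin.forall_fin_succ]
    simp [Fin.tail, (Fin.succ_ne_zero p).symm, (Fin.succ_ne_zero q).symm]
  by_cases h0 : x 0 = y 0
  · rw [if_pos h0]
    refine if_congr ?_ rfl rfl
    rw [this]; simp [h0, Fin.tail]
  · rw [if_neg h0, if_neg]
    rw [this]; simp [h0]

theorem extT_opP (σ : Perm (Fin k)) :
    extT (opP B σ : Matrix (Fin k → Fin N) (Fin k → Fin N) B) = opP B (extPerm σ) := by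
  ext x y
  simp only [extT, opP, Matrix.of_apply]
  have h : x = y ∘ (extPerm σ).symm ↔ x 0 = y 0 ∧ Fin.tail x = Fin.tail y ∘ σ.symm := by
    have h' : (extPerm σ).symm = extPerm σ.symm := extPerm_inv σ
    rw [h', funext_iff, Fin.forall_fin_succ, funext_iff]
    simp [extPerm_zero, extPerm_succ, Fin.tail]
  by_cases h0 : x 0 = y 0
  · rw [if_pos h0]
    refine if_congr ?_ rfl rfl
    rw [h]; simp [h0]
  · rw [if_neg h0, if_neg]
    rw [h]; simp [h0]

variable (B N) in
/-- The alternating sum of transpositions of the site `0` with the others. -/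
def cosetSum (k : ℕ) : Matrix (Fin (k + 1) → Fin N) (Fin (k + 1) → Fin N) B :=
  1 - ∑ q : Fin k, opP B (swap 0 q.succ)

theorem antisym_mul_opP (τ : Perm (Fin k)) :
    antisym k N B * opP B τ = ((Perm.sign τ : ℤˣ) : ℤ) • antisym k N B := by
  rw [antisym, Finset.sum_mul, Finset.smul_sum, ← Equiv.sum_comp (Equiv.mulRight τ⁻¹)]
  refine Finset.sum_congr rfl fun σ _ => ?_
  rw [smul_mul_assoc, ← opP_mul, smul_smul, ← Units.val_mul]
  simp [mul_comm]

theorem opP_mul_antisym (τ : Perm (Fin k)) :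
    opP B τ * antisym k N B = ((Perm.sign τ : ℤˣ) : ℤ) • antisym k N B := by
  rw [antisym, Finset.mul_sum, Finset.smul_sum, ← Equiv.sum_comp (Equiv.mulLeft τ⁻¹)]
  refine Finset.sum_congr rfl fun σ _ => ?_
  rw [mul_smul_comm, ← opP_mul, smul_smul, ← Units.val_mul]
  simp

theorem extT_antisym : extT (antisym k N B) =
    ∑ σ : Perm (Fin k), ((Perm.sign σ : ℤˣ) : ℤ) • opP B (extPerm σ) := by
  change extTHom B k N _ = _
  rw [antisym, map_sum]
  refine Finset.sum_congr rfl fun σ _ => ?_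
  rw [map_zsmul]
  congr 1
  exact extT_opP σ

/-- The identity and the transpositions `(0 q)` represent the left cosets of the stabiliser of `0`;
the minus signs in `cosetSum` are those of the transpositions. -/
theorem antisym_succ : antisym (k + 1) N B = cosetSum B N k * extT (antisym k N B) := by
  rw [extT_antisym, antisym, ← Equiv.sum_comp Perm.decomposeFin.symm, Fintype.sum_prod_type,
    Fin.sum_univ_succ, cosetSum, sub_mul, one_mul, Finset.sum_mul, sub_eq_add_neg,
    ← Finset.sum_neg_distrib]
  congr 1
  · refine Finset.sum_congr rfl fun σ _ => ?_
    rw [← extPerm, sign_extPerm]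
  · refine Finset.sum_congr rfl fun q _ => ?_
    rw [Finset.mul_sum, ← Finset.sum_neg_distrib]
    refine Finset.sum_congr rfl fun σ _ => ?_
    rw [decomposeFin_symm_eq, opP_mul, mul_smul_comm, Perm.sign_mul, sign_extPerm,
      Perm.sign_swap (Fin.succ_ne_zero q).symm]
    simp

/-- Passing to inverses turns the left coset representatives into right ones. -/
theorem antisym_succ' : antisym (k + 1) N B = extT (antisym k N B) * cosetSum B N k := by
  rw [extT_antisym, antisym, ← Equiv.sum_comp (Equiv.inv _), ← Equiv.sum_comp Perm.decomposeFin.symm,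
    Fintype.sum_prod_type, Fin.sum_univ_succ, cosetSum, mul_sub, mul_one, Finset.mul_sum,
    sub_eq_add_neg, ← Finset.sum_neg_distrib]
  simp only [Equiv.inv_apply, decomposeFin_symm_eq, mul_inv_rev, extPerm_inv, Perm.sign_mul,
    Perm.sign_inv, sign_extPerm, opP_mul]
  congr 1
  · rw [← Equiv.sum_comp (Equiv.inv _)]
    refine Finset.sum_congr rfl fun σ _ => ?_
    rw [swap_self]
    simp only [Equiv.inv_apply, inv_inv, Perm.sign_inv]
    have : (Equiv.refl (Fin (k + 1)))⁻¹ = (1 : Perm (Fin (k + 1))) := rfl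
    rw [this, opP_one, mul_one]
    simp
  · refine Finset.sum_congr rfl fun q _ => ?_
    rw [Finset.sum_mul, ← Finset.sum_neg_distrib, ← Equiv.sum_comp (Equiv.inv _)]
    refine Finset.sum_congr rfl fun σ _ => ?_
    rw [Perm.sign_swap (Fin.succ_ne_zero q).symm, smul_mul_assoc]
    simp


theorem mul_opP_of_adjacent {M : Matrix (Fin (k + 1) → Fin N) (Fin (k + 1) → Fin N) B}
    (h : ∀ i : Fin k, M * opP B (swap i.castSucc i.succ) = -M) (σ : Perm (Fin (k + 1))) :
    M * opP B σ = ((Perm.sign σ : ℤˣ) : ℤ) • M := by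
  have hσ : σ ∈ Submonoid.closure (Set.range fun i : Fin k => swap i.castSucc i.succ) := by
    rw [Perm.mclosure_swap_castSucc_succ]; trivial
  induction hσ using Submonoid.closure_induction with
  | mem τ hτ =>
    obtain ⟨i, rfl⟩ := hτ
    rw [h, Perm.sign_swap i.castSucc_lt_succ.ne]
    simp
  | one => simp [opP_one]
  | mul τ τ' _ _ h1 h2 =>
    rw [opP_mul, ← mul_assoc, h1, smul_mul_assoc, h2, smul_smul, Perm.sign_mul, Units.val_mul]

theorem zsmul_matrix_cancel [IsAddTorsionFree B] {m n : Type*} {M M' : Matrix m n B} {c : ℤ}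
    (hc : c ≠ 0) (h : c • M = c • M') : M = M' := by
  ext i j
  have := congrFun (congrFun h i) j
  simp only [Matrix.smul_apply] at this
  exact zsmul_right_injective hc this

end Extension

/-! ### Skew-symmetry of the minors and expansions of the bracket -/

namespace BracketData

variable {𝕜 : Type*} [CommRing 𝕜] {B : Type*} [Ring B] [Algebra 𝕜 B] {k N : ℕ}
  {θ : Fin N → Fin N → 𝕜}

/-- The matrix `A_k ⟨S_1, …, S_k⟩`. -/
def minors (D : BracketData 𝕜 B θ k) : Matrix (Fin k → Fin N) (Fin k → Fin N) B :=
  antisym k N B * D.brk (List.finRange k)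

theorem opP_mul_minors (D : BracketData 𝕜 B θ k) (σ : Perm (Fin k)) :
    opP B σ * D.minors = ((Perm.sign σ : ℤˣ) : ℤ) • D.minors := by
  rw [minors, ← mul_assoc, opP_mul_antisym, smul_mul_assoc]

theorem finRange_split (i : Fin k) : ∃ l l' : List (Fin (k + 1)),
    List.finRange (k + 1) = l ++ i.castSucc :: i.succ :: l' := by
  refine ⟨(List.finRange (k + 1)).take i, (List.finRange (k + 1)).drop (i + 2), ?_⟩
  have hi := i.isLt
  conv_lhs => rw [← List.take_append_drop (i : ℕ) (List.finRange (k + 1))]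
  rw [List.drop_eq_getElem_cons (by simp), List.drop_eq_getElem_cons (by simp)]
  simp only [List.getElem_finRange]
  rfl

/-- For neighbouring sites `R = 1 - P`, and `A_k (1 - P) = 2 A_k`. So twice the matrix of minors
equals a product ending in `1 - P`, and right multiplication by `P` changes its sign. -/
theorem minors_mul_opP [IsAddTorsionFree B] (hθ : IsTheta θ) (D : BracketData 𝕜 B θ k)
    (hd : ∀ i j : Fin k, (j : ℕ) = i + 1 → D.d i j = 1) (σ : Perm (Fin k)) :
    D.minors * opP B σ = ((Perm.sign σ : ℤˣ) : ℤ) • D.minors := by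
  rcases k with _ | k
  · rw [Subsingleton.elim σ 1]
    simp [opP_one]
  · refine mul_opP_of_adjacent (fun i => ?_) σ
    obtain ⟨l, l', hl⟩ := finRange_split i
    have hne : i.castSucc ≠ i.succ := i.castSucc_lt_succ.ne
    have h1 := D.rp_mul_brk hθ l l' (hl ▸ List.nodup_finRange (k + 1))
    rw [← hl] at h1
    have h2 : D.rp i.castSucc i.succ = 1 - opP B (swap i.castSucc i.succ) := by
      rw [rp, hd _ _ (by simp), one_smul]
    have h3 : (2 : ℤ) • D.minors = antisym (k + 1) N B *
        (D.brk (l ++ i.succ :: i.castSucc :: l') * (1 - opP B (swap i.castSucc i.succ))) := by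
      rw [← h2, ← h1, ← mul_assoc, h2, mul_sub, mul_one, antisym_mul_opP, Perm.sign_swap hne,
        minors]
      simp only [Units.val_neg, Units.val_one, neg_smul, one_smul, sub_neg_eq_add, add_mul,
        two_smul]
    have h4 : (1 - opP B (swap i.castSucc i.succ)) * opP B (swap i.castSucc i.succ) =
        -(1 - opP B (swap i.castSucc i.succ) :
          Matrix (Fin (k + 1) → Fin N) (Fin (k + 1) → Fin N) B) := by
      rw [sub_mul, one_mul, ← opP_mul, swap_mul_self, opP_one, neg_sub]
    apply zsmul_matrix_cancel two_ne_zero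
    rw [← smul_mul_assoc, smul_neg, h3, mul_assoc, mul_assoc, h4, mul_neg, mul_neg]

/-- The restriction to the sites `1, …, k`. -/
def tail (D : BracketData 𝕜 B θ (k + 1)) : BracketData 𝕜 B θ k where
  S p := D.S p.succ
  r p q := D.r p.succ q.succ
  d p q := D.d p.succ q.succ
  r_symm _ _ := D.r_symm _ _
  pair _ _ h := D.pair _ _ (Fin.succ_injective _ |>.ne h)
  mul_r _ _ _ h := D.mul_r _ _ _ (Fin.succ_injective _ |>.ne h)

theorem extT_rt (D : BracketData 𝕜 B θ (k + 1)) (p q : Fin k) :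
    extT (D.tail.rt p q) = D.rt p.succ q.succ := by
  rw [rt, rt, extT_sub, extT_one, extT_smul, extT_siteQ]
  rfl

theorem extT_brk (D : BracketData 𝕜 B θ (k + 1)) (l : List (Fin k)) :
    extT (D.tail.brk l) = D.brk (l.map Fin.succ) := by
  induction l with
  | nil => exact extT_one
  | cons p l ih =>
    have h : ∀ l' : List (Fin k), extT (l'.map (D.tail.rt p)).prod =
        ((l'.map Fin.succ).map (D.rt p.succ)).prod := by
      intro l'
      induction l' with
      | nil => exact extT_one
      | cons q l' ih' =>
        simp only [List.map_cons, List.prod_cons, extT_mul, extT_rt]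
        rw [ih']
    simp only [List.map_cons, brk, extT_mul, extT_onOne, ih, h]
    rfl

theorem extT_smul_int (c : ℤ) (M : Matrix (Fin k → Fin N) (Fin k → Fin N) B) :
    extT (c • M) = c • extT M := map_zsmul (extTHom B k N) c M

/-- The contracted product of the operators `R^t_{q0}` times `S_0`. -/
def contracted (D : BracketData 𝕜 B θ (k + 1)) (y : 𝕜) :
    Matrix (Fin (k + 1) → Fin N) (Fin (k + 1) → Fin N) B :=
  (1 - y • ∑ q : Fin k, siteQ B θ q.succ 0) * onOne 0 (D.S 0)

theorem list_sum_finRange {E : Type*} [AddCommMonoid E] (f : Fin (k + 1) → E) :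
    (((List.finRange k).map Fin.succ).map f).sum = ∑ q : Fin k, f q.succ := by
  rw [List.map_map, ← List.ofFn_eq_map, List.sum_ofFn]
  rfl

/-- Site `0` stands last, so the operators `R^t_{q0}` follow the complete bracket of the other
sites. Right skew-symmetry gives `Q_{a0} Q_{b0} = P_{ab} Q_{b0} ↦ -Q_{b0}`, which is the hypothesis
of `fusion_contract`. -/
theorem minors_brk_append [IsAddTorsionFree B] (hθ : IsTheta θ) (D : BracketData 𝕜 B θ (k + 1))
    (hd : ∀ i j : Fin k, (j : ℕ) = i + 1 → D.d i.succ j.succ = 1) {y : 𝕜}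
    (hr : ∀ i : Fin k, D.r i.succ 0 * (1 + (i : ℕ) * y) = y) :
    extT (antisym k N B) * D.brk ((List.finRange k).map Fin.succ ++ [0]) =
      extT D.tail.minors * D.contracted y := by
  have hnd : ((List.finRange k).map Fin.succ).Nodup :=
    (List.nodup_finRange k).map (Fin.succ_injective k)
  have h0 : (0 : Fin (k + 1)) ∉ (List.finRange k).map Fin.succ := by
    simp [Fin.succ_ne_zero]
  rw [D.brk_append_singleton hnd h0, ← extT_brk, ← mul_assoc, ← extT_mul]
  change extT D.tail.minors * _ = _
  rw [← mul_assoc, contracted, ← mul_assoc]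
  congr 1
  have := fusion_contract (A := extT D.tail.minors) (Q := fun q => siteQ B θ q 0)
    (fun q => D.r q 0) ((List.finRange k).map Fin.succ) ?_ hnd y ?_
  · rw [list_sum_finRange] at this
    exact this
  · intro a ha b hb hab
    obtain ⟨a, -, rfl⟩ := List.mem_map.1 ha
    obtain ⟨b, -, rfl⟩ := List.mem_map.1 hb
    have hab' : a ≠ b := fun h => hab (congrArg _ h)
    have hM : extT D.tail.minors * opP B (swap a.succ b.succ) = -extT D.tail.minors := by
      rw [← extPerm_swap, ← extT_opP, ← extT_mul, minors_mul_opP hθ D.tail hd, Perm.sign_swap hab',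
        extT_smul_int]
      simp
    rw [siteQ_symm hθ a.succ 0, siteQ_symm hθ b.succ 0, mul_assoc,
      siteQ_mul_siteQ hθ hab (Fin.succ_ne_zero a).symm (Fin.succ_ne_zero b).symm, ← mul_assoc, hM,
      neg_mul]
  · intro i hi
    rw [List.length_map, List.length_finRange] at hi
    simpa using hr ⟨i, hi⟩

/-- Expansion of `A_{k+1} ⟨S_1, …, S_k, S_0⟩`. -/
theorem antisym_mul_brk_append [IsAddTorsionFree B] (hθ : IsTheta θ)
    (D : BracketData 𝕜 B θ (k + 1))
    (hd : ∀ i j : Fin k, (j : ℕ) = i + 1 → D.d i.succ j.succ = 1) {y : 𝕜}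
    (hr : ∀ i : Fin k, D.r i.succ 0 * (1 + (i : ℕ) * y) = y) :
    antisym (k + 1) N B * D.brk ((List.finRange k).map Fin.succ ++ [0]) =
      cosetSum B N k * (extT D.tail.minors * D.contracted y) := by
  rw [antisym_succ, mul_assoc, minors_brk_append hθ D hd hr]

/-- After fusion the sites `1, …, k` enter with equal coefficients, so permuting them only permutes
the terms of the sum. -/
theorem commute_opP_contracted (D : BracketData 𝕜 B θ (k + 1)) (y : 𝕜) (σ : Perm (Fin k)) :
    Commute (opP B (extPerm σ)) (D.contracted y) := by
  refine Commute.mul_right ?_ ?_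
  · refine (Commute.one_right _).sub_right (Commute.smul_right ?_ _)
    change _ * _ = _ * _
    rw [Finset.mul_sum, Finset.sum_mul, ← Equiv.sum_comp σ fun i => siteQ B θ i.succ 0 * _]
    refine Finset.sum_congr rfl fun q _ => ?_
    rw [opP_mul_siteQ _ (Fin.succ_ne_zero q), extPerm_zero, extPerm_succ]
  · have := opP_mul_onOne (extPerm σ) 0 (D.S 0)
    rwa [extPerm_zero] at this

theorem commute_extT_antisym_contracted (D : BracketData 𝕜 B θ (k + 1)) (y : 𝕜) :
    Commute (extT (antisym k N B)) (D.contracted y) := by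
  rw [extT_antisym]
  exact Commute.sum_left _ _ _ fun σ _ => Commute.smul_left (D.commute_opP_contracted y σ) _

theorem minors_mul_antisym [IsAddTorsionFree B] (hθ : IsTheta θ) (D : BracketData 𝕜 B θ k)
    (hd : ∀ i j : Fin k, (j : ℕ) = i + 1 → D.d i j = 1) :
    D.minors * antisym k N B = (k.factorial : ℤ) • D.minors := by
  rw [antisym, Finset.mul_sum]
  have : ∀ σ ∈ (Finset.univ : Finset (Perm (Fin k))),
      D.minors * (((Perm.sign σ : ℤˣ) : ℤ) • opP B σ) = D.minors := by
    intro σ _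
    rw [mul_smul_comm, minors_mul_opP hθ D hd, smul_smul, ← Units.val_mul, Int.units_mul_self,
      Units.val_one, one_smul]
  rw [Finset.sum_congr rfl this, Finset.sum_const, Finset.card_univ, Fintype.card_perm,
    Fintype.card_fin]
  simp

/-- Expansion of `A_{k+1} ⟨S_0, S_1, …, S_k⟩`. -/
theorem antisym_mul_brk_cons [IsAddTorsionFree B] (hθ : IsTheta θ)
    (D : BracketData 𝕜 B θ (k + 1))
    (hd : ∀ i j : Fin k, (j : ℕ) = i + 1 → D.d i.succ j.succ = 1)
    (hd0 : ∀ i : Fin k, D.d 0 i.succ * (1 + (i : ℕ)) = 1) {y : 𝕜}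
    (hr : ∀ i : Fin k, D.r i.succ 0 * (1 + (i : ℕ) * y) = y) :
    D.minors = extT D.tail.minors * D.contracted y * cosetSum B N k := by
  have hnd : ((List.finRange k).map Fin.succ).Nodup :=
    (List.nodup_finRange k).map (Fin.succ_injective k)
  have h0 : (0 : Fin (k + 1)) ∉ (List.finRange k).map Fin.succ := by
    simp [Fin.succ_ne_zero]
  -- `F` has two roles: it completes `A_k` on the sites `1, …, k` to `A_{k+1}`, and it carries site
  -- `0` to the end of the bracket.
  set F := ((((List.finRange k).map Fin.succ).reverse.map (D.rp 0)).prod) with hF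
  have hfus : extT (antisym k N B) * F = antisym (k + 1) N B := by
    have := fusion_swap (A := extT (antisym k N B)) (P := fun q => opP B (swap 0 q))
      (D.d 0) ((List.finRange k).map Fin.succ) ?_ hnd 1 1 ?_ (one_mul 1)
    · rw [list_sum_finRange, one_smul] at this
      rw [antisym_succ']
      exact this
    · intro a ha b hb hab
      obtain ⟨a, -, rfl⟩ := List.mem_map.1 ha
      obtain ⟨b, -, rfl⟩ := List.mem_map.1 hb
      have hab' : a ≠ b := fun h => hab (congrArg _ h)
      have h2 : swap 0 b.succ * swap 0 a.succ = swap a.succ b.succ * swap 0 b.succ := by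
        rw [mul_swap_eq_swap_mul, swap_apply_left,
          swap_apply_of_ne_of_ne (Fin.succ_ne_zero a) hab, swap_comm]
      rw [mul_assoc, ← opP_mul, h2, opP_mul, ← mul_assoc, ← extPerm_swap, ← extT_opP, ← extT_mul,
        antisym_mul_opP, Perm.sign_swap hab', extT_smul_int]
      simp
    · intro i hi
      rw [List.length_map, List.length_finRange] at hi
      simpa using hd0 ⟨i, hi⟩
  have hfin : List.finRange (k + 1) = [] ++ 0 :: (List.finRange k).map Fin.succ := by
    rw [List.nil_append, List.finRange_succ]
  have hpush := D.prod_rp_mul_brk hθ [] ((List.finRange k).map Fin.succ)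
    (hfin ▸ List.nodup_finRange (k + 1))
  rw [← hF] at hpush
  have h1 : D.minors = extT D.tail.minors * D.contracted y * F := by
    rw [minors, hfin, ← hfus, mul_assoc, hpush, List.nil_append, ← mul_assoc,
      minors_brk_append hθ D hd hr]
  have h2 := minors_mul_antisym hθ D.tail hd
  have h3 := (commute_extT_antisym_contracted D y).eq
  have h4 : ((k.factorial : ℤ)) • extT D.tail.minors =
      extT D.tail.minors * extT (antisym k N B) := by
    rw [← extT_mul, h2, extT_smul_int]
  -- Multiplying by `k!` allows a factor `A_k` to be inserted after the minors. It commutes past the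
  -- contraction and meets `F`, which it absorbs into `A_{k+1}`.
  apply zsmul_matrix_cancel (c := (k.factorial : ℤ)) (by exact_mod_cast k.factorial_ne_zero)
  rw [h1, ← smul_mul_assoc, ← smul_mul_assoc, ← smul_mul_assoc, ← smul_mul_assoc, h4]
  simp only [mul_assoc]
  rw [← mul_assoc _ (D.contracted y), h3, ← mul_assoc _ (D.contracted y), h3, mul_assoc, mul_assoc,
    hfus, antisym_succ']

end BracketData

end

end SkewTwisted

namespace SkewTwisted

noncomputable section

open Equiv

/-! ### Laplace-type expansions of alternating functions -/

section Alternating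

variable {B : Type*} [Ring B] {k : ℕ}

/-- The permutation `(d, 0, …, d - 1, d + 1, …, k)`. -/
def toFront (d : Fin (k + 1)) : Perm (Fin (k + 1)) := (Fin.cycleRange d).symm

theorem toFront_zero (d : Fin (k + 1)) : toFront d 0 = d := Fin.cycleRange_symm_zero d

theorem tail_toFront (d : Fin (k + 1)) : Fin.tail (toFront d) = d.succAbove :=
  funext fun j => Fin.cycleRange_symm_succ d j

theorem toFront_eq_cons (d : Fin (k + 1)) : (toFront d : Fin (k + 1) → Fin (k + 1)) =
    (Fin.cons d d.succAbove : Fin (k + 1) → Fin (k + 1)) := by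
  rw [← Fin.cons_self_tail (toFront d : Fin (k + 1) → Fin (k + 1)), tail_toFront, toFront_zero]

theorem sign_toFront (d : Fin (k + 1)) : Perm.sign (toFront d) = (-1) ^ (d : ℕ) := by
  rw [toFront, Perm.sign_symm, Fin.sign_cycleRange]

theorem sign_toFront_int (d : Fin (k + 1)) :
    ((Perm.sign (toFront d) : ℤˣ) : ℤ) = (-1) ^ (d : ℕ) := by
  rw [sign_toFront]; simp

/-- The value of a function that is alternating in all arguments except the first one. -/
theorem apply_perm_of_alternating {f : (Fin (k + 1) → Fin (k + 1)) → B}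
    (hf : ∀ (σ : Perm (Fin k)) (w : Fin (k + 1) → Fin (k + 1)),
      f (w ∘ extPerm σ) = ((Perm.sign σ : ℤˣ) : ℤ) • f w) (y : Perm (Fin (k + 1))) :
    ((Perm.sign y : ℤˣ) : ℤ) • f y = ((-1) ^ ((y 0 : Fin (k + 1)) : ℕ) : ℤ) • f (toFront (y 0)) := by
  obtain ⟨σ, hσ⟩ := exists_extPerm (σ := (toFront (y 0))⁻¹ * y) (by
    rw [Perm.mul_apply, Perm.inv_eq_iff_eq, toFront_zero])
  have hy : y = toFront (y 0) * extPerm σ := by rw [← hσ, mul_inv_cancel_left]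
  have h1 : f y = ((Perm.sign σ : ℤˣ) : ℤ) • f (toFront (y 0)) := by
    rw [← hf]
    congr 1
    exact congrArg _ hy
  have h2 : Perm.sign y = Perm.sign (toFront (y 0)) * Perm.sign σ := by
    conv_lhs => rw [hy]
    rw [Perm.sign_mul, sign_extPerm]
  rw [h1, smul_smul, h2, ← Units.val_mul, mul_assoc, Int.units_mul_self, mul_one, sign_toFront_int]

theorem tail_comp_extPerm {α : Type*} (w : Fin (k + 1) → α) (σ : Perm (Fin k)) :
    Fin.tail (w ∘ extPerm σ) = Fin.tail w ∘ σ := by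
  ext1 i
  simp [Fin.tail, extPerm_succ]

theorem apply_tail_perm {f : (Fin k → Fin (k + 1)) → B}
    (hf : ∀ (σ : Perm (Fin k)) (w : Fin k → Fin (k + 1)),
      f (w ∘ σ) = ((Perm.sign σ : ℤˣ) : ℤ) • f w) (y : Perm (Fin (k + 1))) :
    ((Perm.sign y : ℤˣ) : ℤ) • f (Fin.tail y) =
      ((-1) ^ ((y 0 : Fin (k + 1)) : ℕ) : ℤ) • f (y 0).succAbove := by
  have := apply_perm_of_alternating (f := fun w => f (Fin.tail w))
    (fun σ w => by rw [tail_comp_extPerm, hf]) y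
  rwa [tail_toFront] at this

theorem alternating_eq_zero [IsAddTorsionFree B] {m n : ℕ} {f : (Fin m → Fin n) → B}
    (hf : ∀ (σ : Perm (Fin m)) (w : Fin m → Fin n),
      f (w ∘ σ) = ((Perm.sign σ : ℤˣ) : ℤ) • f w) {w : Fin m → Fin n} {a b : Fin m} (hab : a ≠ b)
    (hw : w a = w b) : f w = 0 := by
  have h := hf (swap a b) w
  have h2 : w ∘ swap a b = w := by
    ext1 i
    rw [Function.comp_apply, swap_apply_def]
    split_ifs with h1 h2
    · rw [h1, hw]
    · rw [h2, hw]
    · rfl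
  rw [h2, Perm.sign_swap hab] at h
  simp only [Units.val_neg, Units.val_one, neg_smul, one_smul] at h
  exact self_eq_neg.1 h

/-- For `c ≠ e` the index `c` already occurs in the complement of `e`, so the value vanishes; for `c
= e` the sequence is a cycle of sign `(-1)^e`. -/
theorem apply_cons_succAbove [IsAddTorsionFree B] {f : (Fin (k + 1) → Fin (k + 1)) → B}
    (hf : ∀ (σ : Perm (Fin (k + 1))) (w : Fin (k + 1) → Fin (k + 1)),
      f (w ∘ σ) = ((Perm.sign σ : ℤˣ) : ℤ) • f w) (c e : Fin (k + 1)) :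
    ((-1) ^ (e : ℕ) : ℤ) • f (Fin.cons c e.succAbove : Fin (k + 1) → Fin (k + 1)) =
      if c = e then f id else 0 := by
  split_ifs with h
  · subst h
    rw [← toFront_eq_cons, ← Function.id_comp (toFront c : Fin (k + 1) → Fin (k + 1)), hf,
      sign_toFront_int, smul_smul, ← mul_pow]
    simp
  · obtain ⟨q, hq⟩ := Fin.exists_succAbove_eq h
    rw [alternating_eq_zero hf (Fin.succ_ne_zero q), smul_zero]
    simp [hq]

/-- If `j ≠ c`, then `j` already occurs in the complement of `c` and only the replacement of `j` by
itself survives. If `j = c`, each replacement yields, up to sign, the complement of the index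
removed; the subtracted total sum supplies these terms and cancels the one at `c`. -/
theorem sum_update_succAbove [IsAddTorsionFree B] {f : (Fin k → Fin (k + 1)) → B}
    (hf : ∀ (σ : Perm (Fin k)) (w : Fin k → Fin (k + 1)),
      f (w ∘ σ) = ((Perm.sign σ : ℤˣ) : ℤ) • f w) (h : Fin (k + 1) → B) (c j : Fin (k + 1)) :
    ((-1) ^ (c : ℕ) : ℤ) • ∑ q, f (Function.update c.succAbove q j) * h (c.succAbove q) =
      (((-1) ^ (c : ℕ) : ℤ) • f c.succAbove) * h j -
        if j = c then ∑ b : Fin (k + 1), (((-1) ^ (b : ℕ) : ℤ) • f b.succAbove) * h b else 0 := by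
  split_ifs with hj
  · subst hj
    rw [Fin.sum_univ_succAbove _ j, sub_add_cancel_left, Finset.smul_sum, ← Finset.sum_neg_distrib]
    refine Finset.sum_congr rfl fun q _ => ?_
    have h1 := apply_tail_perm hf (toFront j * swap 0 q.succ)
    have h2 : Fin.tail (toFront j * swap 0 q.succ : Perm (Fin (k + 1))) =
        Function.update j.succAbove q j := by
      ext1 i
      by_cases hi : i = q
      · subst hi
        simp [Fin.tail, toFront_zero]
      · have : i.succ ≠ q.succ := fun h => hi (Fin.succ_injective _ h)
        simp only [Fin.tail, Perm.mul_apply, swap_apply_of_ne_of_ne (Fin.succ_ne_zero i) this, ne_eq,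
          hi, not_false_eq_true, Function.update_of_ne]
        exact congrFun (tail_toFront j) i
    have h3 : (toFront j * swap 0 q.succ) 0 = j.succAbove q := by
      rw [Perm.mul_apply, swap_apply_left]
      exact congrFun (tail_toFront j) q
    rw [h2, h3, Perm.sign_mul, Perm.sign_swap (Fin.succ_ne_zero q).symm, Units.val_mul,
      sign_toFront_int] at h1
    rw [← h1]
    simp [mul_assoc]
  · rw [sub_zero]
    obtain ⟨q, rfl⟩ := Fin.exists_succAbove_eq hj
    rw [Finset.sum_eq_single q, Function.update_eq_self, smul_mul_assoc]
    · intro q' _ hq'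
      rw [alternating_eq_zero hf hq', zero_mul]
      simp [hq'.symm]
    · simp

end Alternating

/-! ### Cofactor expansions of the determinant -/

namespace BracketData

variable {𝕜 : Type*} [CommRing 𝕜] {B : Type*} [Ring B] [Algebra 𝕜 B]

section

variable {k N : ℕ} {θ : Fin N → Fin N → 𝕜}

theorem siteQ_mul_onOne_apply (q : Fin k) (T : Matrix (Fin N) (Fin N) B)
    (v x : Fin (k + 1) → Fin N) :
    (siteQ B θ q.succ 0 * onOne 0 T :
        Matrix (Fin (k + 1) → Fin N) (Fin (k + 1) → Fin N) B) v x =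
      if Fin.tail v = Function.update (Fin.tail x) q (v 0).rev then
        θ (v 0) (x q.succ).rev • T (x q.succ).rev (x 0) else 0 := by
  rw [siteQ_mul_apply (Fin.succ_ne_zero q)]
  have h0 : (0 : Fin (k + 1)) ≠ q.succ := (Fin.succ_ne_zero q).symm
  by_cases hv : v 0 = (v q.succ).rev
  · rw [if_pos hv, Finset.sum_eq_single (x q.succ).rev]
    · simp only [onOne, Matrix.of_apply, Fin.rev_rev, Function.update_self]
      by_cases h : Fin.tail v = Function.update (Fin.tail x) q (v 0).rev
      · rw [if_pos h, if_pos]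
        intro w hw
        obtain ⟨w, rfl⟩ := Fin.exists_succ_eq.2 hw
        rw [Function.update_of_ne hw]
        by_cases hwq : w = q
        · subst hwq; simp
        · rw [Function.update_of_ne (fun h => hwq (Fin.succ_injective _ h))]
          have := congrFun h w
          rwa [Function.update_of_ne hwq] at this
      · rw [if_neg h, if_neg, smul_zero]
        intro h'
        refine h (funext fun w => ?_)
        by_cases hwq : w = q
        · subst hwq; simp [Fin.tail, hv]
        · have := h' w.succ (Fin.succ_ne_zero w)
          rw [Function.update_of_ne (Fin.succ_ne_zero w),
            Function.update_of_ne (fun h => hwq (Fin.succ_injective _ h))] at this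
          rw [Function.update_of_ne hwq]
          exact this
    · intro i _ hi
      simp only [onOne, Matrix.of_apply]
      rw [if_neg, smul_zero]
      intro h
      have := h q.succ h0.symm
      rw [Function.update_of_ne h0.symm, Function.update_self] at this
      exact hi (by rw [← this, Fin.rev_rev])
    · simp
  · rw [if_neg hv, if_neg]
    intro h
    have := congrFun h q
    rw [Function.update_self] at this
    exact hv (by rw [← Fin.rev_rev (v 0), ← this]; rfl)

/-- A contraction `Q_{q0}` replaces the `q`-th lower index of the minor by the opposite of the row
index at site `0`, while the removed index moves to the entry of `S_0`. -/
theorem extT_mul_contracted_apply (D : BracketData 𝕜 B θ (k + 1)) (y : 𝕜)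
    (M : Matrix (Fin k → Fin N) (Fin k → Fin N) B) (v x : Fin (k + 1) → Fin N) :
    (extT M * D.contracted y) v x = M (Fin.tail v) (Fin.tail x) * D.S 0 (v 0) (x 0) -
      y • ∑ q : Fin k, M (Fin.tail v) (Function.update (Fin.tail x) q (v 0).rev) *
        (θ (v 0) (x q.succ).rev • D.S 0 (x q.succ).rev (x 0)) := by
  rw [extT_mul_apply]
  have h1 : ∀ w : Fin k → Fin N, D.contracted y (Fin.cons (v 0) w) x =
      (if w = Fin.tail x then D.S 0 (v 0) (x 0) else 0) -
        y • ∑ q : Fin k, if w = Function.update (Fin.tail x) q (v 0).rev then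
          θ (v 0) (x q.succ).rev • D.S 0 (x q.succ).rev (x 0) else 0 := by
    intro w
    rw [contracted, sub_mul, one_mul, smul_mul_assoc, Finset.sum_mul, Matrix.sub_apply,
      Matrix.smul_apply, Matrix.sum_apply]
    congr 1
    · simp only [onOne, Matrix.of_apply, Fin.cons_zero]
      refine if_congr ?_ rfl rfl
      constructor
      · intro h
        ext1 i
        exact h i.succ (Fin.succ_ne_zero i)
      · rintro rfl q hq
        obtain ⟨q, rfl⟩ := Fin.exists_succ_eq.2 hq
        rfl
    · refine congrArg (fun t => y • t) (Finset.sum_congr rfl fun q _ => ?_)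
      rw [siteQ_mul_onOne_apply]
      simp
  simp only [h1, mul_sub, Finset.sum_sub_distrib]
  congr 1
  · rw [Finset.sum_eq_single (Fin.tail x)]
    · simp
    · intro w _ hw
      simp [hw]
    · simp
  · simp only [mul_smul_comm, ← Finset.smul_sum, Finset.mul_sum]
    rw [Finset.sum_comm]
    refine congrArg (fun t => y • t) (Finset.sum_congr rfl fun q _ => ?_)
    rw [Finset.sum_eq_single (Function.update (Fin.tail x) q (v 0).rev)]
    · simp
    · intro w _ hw
      simp [hw]
    · simp

/-- The data with the sites renumbered. -/
def reindex (D : BracketData 𝕜 B θ k) (ρ : Perm (Fin k)) : BracketData 𝕜 B θ k where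
  S p := D.S (ρ p)
  r p q := D.r (ρ p) (ρ q)
  d p q := D.d (ρ p) (ρ q)
  r_symm _ _ := D.r_symm _ _
  pair _ _ h := D.pair _ _ (ρ.injective.ne h)
  mul_r _ _ _ h := D.mul_r _ _ _ (ρ.injective.ne h)

theorem opP_mul_rt (D : BracketData 𝕜 B θ k) (ρ : Perm (Fin k)) {p q : Fin k} (hpq : p ≠ q) :
    opP B ρ * (D.reindex ρ).rt p q = D.rt (ρ p) (ρ q) * opP B ρ := by
  rw [rt, rt, mul_sub, sub_mul, mul_one, one_mul, mul_smul_comm, smul_mul_assoc,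
    opP_mul_siteQ _ hpq]
  rfl

/-- Conjugation by `P_ρ` renumbers sites; this is what permits a bracket whose site `0` comes last
to be compared with one in standard order. -/
theorem opP_mul_brk (D : BracketData 𝕜 B θ k) (ρ : Perm (Fin k)) {l : List (Fin k)}
    (hl : l.Nodup) : opP B ρ * (D.reindex ρ).brk l = D.brk (l.map ρ) * opP B ρ := by
  induction l with
  | nil => simp [brk]
  | cons p l ih =>
    rw [List.nodup_cons] at hl
    have h : ∀ l' : List (Fin k), p ∉ l' → opP B ρ * (l'.map ((D.reindex ρ).rt p)).prod =
        ((l'.map ρ).map (D.rt (ρ p))).prod * opP B ρ := by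
      intro l' hl'
      induction l' with
      | nil => simp
      | cons q l' ih' =>
        simp only [List.mem_cons, not_or] at hl'
        simp only [List.map_cons, List.prod_cons]
        rw [← mul_assoc, D.opP_mul_rt ρ hl'.1, mul_assoc, ih' hl'.2, mul_assoc]
    simp only [List.map_cons, brk]
    rw [← mul_assoc, opP_mul_onOne, mul_assoc, ← mul_assoc (opP B ρ), h l hl.1, mul_assoc _ (opP B ρ),
      ih hl.2]
    simp only [mul_assoc]
    rfl

end

section

variable {k : ℕ} {θ : Fin (k + 1) → Fin (k + 1) → 𝕜}

/-- The signed minors of order `k`. -/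
def cofactor (D : BracketData 𝕜 B θ k) : Matrix (Fin (k + 1)) (Fin (k + 1)) B :=
  Matrix.of fun i j => ((-1) ^ ((i : ℕ) + (j : ℕ)) : ℤ) • D.minors i.succAbove j.succAbove

theorem minors_comp [IsAddTorsionFree B] {n N : ℕ} {θ : Fin N → Fin N → 𝕜}
    (hθ : IsTheta θ) (D : BracketData 𝕜 B θ n)
    (hd : ∀ i j : Fin n, (j : ℕ) = i + 1 → D.d i j = 1) (x : Fin n → Fin N) (σ : Perm (Fin n))
    (w : Fin n → Fin N) :
    D.minors x (w ∘ σ) = ((Perm.sign σ : ℤˣ) : ℤ) • D.minors x w := by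
  have := congrFun (congrFun (minors_mul_opP hθ D hd σ⁻¹) x) w
  rw [mul_opP_apply, Perm.sign_inv] at this
  exact this

theorem minors_comp_left {n N : ℕ} {θ : Fin N → Fin N → 𝕜} (D : BracketData 𝕜 B θ n)
    (x : Fin n → Fin N) (σ : Perm (Fin n)) (w : Fin n → Fin N) :
    D.minors (w ∘ σ) x = ((Perm.sign σ : ℤˣ) : ℤ) • D.minors w x := by
  have := congrFun (congrFun (opP_mul_minors D σ) w) x
  rwa [opP_mul_apply] at this

/-- The swap `(0 q)` and the cycle bringing `q` to the front differ by a permutation fixing `0`, so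
alternation in the other arguments turns the coset sum into a signed Laplace sum. -/
theorem cosetSum_sum {f : (Fin (k + 1) → Fin (k + 1)) → B}
    (hf : ∀ (σ : Perm (Fin k)) (w : Fin (k + 1) → Fin (k + 1)),
      f (w ∘ extPerm σ) = ((Perm.sign σ : ℤˣ) : ℤ) • f w) :
    f id - ∑ q : Fin k, f (swap 0 q.succ) =
      ∑ p : Fin (k + 1), ((-1) ^ (p : ℕ) : ℤ) • f (toFront p) := by
  rw [Fin.sum_univ_succ, sub_eq_add_neg, ← Finset.sum_neg_distrib]
  congr 1
  · have := apply_perm_of_alternating hf 1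
    simpa using this
  · refine Finset.sum_congr rfl fun q _ => ?_
    have := apply_perm_of_alternating hf (swap 0 q.succ)
    rw [Perm.sign_swap (Fin.succ_ne_zero q).symm, swap_apply_left] at this
    rw [← this]
    simp

/-- Expansion of the Sklyanin determinant with respect to the first factor. -/
theorem cofactor_mul_first [IsAddTorsionFree B] (hθ : IsTheta θ)
    (D : BracketData 𝕜 B θ (k + 1))
    (hd : ∀ i j : Fin k, (j : ℕ) = i + 1 → D.d i.succ j.succ = 1)
    (hd0 : ∀ i : Fin k, D.d 0 i.succ * (1 + (i : ℕ)) = 1) {y : 𝕜}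
    (hr : ∀ i : Fin k, D.r i.succ 0 * (1 + (i : ℕ) * y) = y) (e c : Fin (k + 1)) :
    ∑ p, D.tail.cofactor e p * ((1 - y) • D.S 0 c p + y • θ c p.rev • D.S 0 p.rev c.rev) =
      if c = e then D.minors id id else 0 := by
  -- The usual device for off-diagonal expansions: the row index `c` followed by the complement of
  -- `e`, repeated unless `c = e`.
  set v : Fin (k + 1) → Fin (k + 1) := Fin.cons c e.succAbove with hv
  have hv0 : v 0 = c := rfl
  have hvt : Fin.tail v = e.succAbove := rfl
  rw [← apply_cons_succAbove (f := fun w => D.minors w id) (fun σ w => D.minors_comp_left id σ w) c e,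
    ← hv]
  have h1 := D.antisym_mul_brk_cons hθ hd hd0 hr
  set W := extT D.tail.minors * D.contracted y with hW
  have hWσ : ∀ (σ : Perm (Fin k)) (w : Fin (k + 1) → Fin (k + 1)),
      W v (w ∘ extPerm σ) = ((Perm.sign σ : ℤˣ) : ℤ) • W v w := by
    intro σ w
    have h2 : W * opP B (extPerm σ⁻¹) = ((Perm.sign σ : ℤˣ) : ℤ) • W := by
      rw [hW, mul_assoc, ← (D.commute_opP_contracted y σ⁻¹).eq, ← mul_assoc, ← extT_opP,
        ← extT_mul, minors_mul_opP hθ D.tail hd, extT_smul_int, smul_mul_assoc, Perm.sign_inv]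
    have h3 := congrFun (congrFun h2 v) w
    rw [mul_opP_apply, ← extPerm_inv] at h3
    exact h3
  have h4 : D.minors v id = W v id - ∑ q : Fin k, W v (swap 0 q.succ) := by
    rw [h1, cosetSum, mul_sub, mul_one, Finset.mul_sum, Matrix.sub_apply, Matrix.sum_apply]
    simp only [mul_opP_apply, symm_swap, Function.id_comp]
  rw [h4, cosetSum_sum hWσ]
  -- The contraction always subtracts `y` times the main term, whence `1 - y`; the full transposed
  -- sum appears only for the column `p = -c`.
  have h5 : ∀ p : Fin (k + 1), ((-1) ^ (p : ℕ) : ℤ) • W v (toFront p) =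
      (((-1) ^ (p : ℕ) : ℤ) • D.tail.minors e.succAbove p.succAbove) * ((1 - y) • D.S 0 c p) +
      if c.rev = p then y • ∑ b : Fin (k + 1), (((-1) ^ (b : ℕ) : ℤ) • D.tail.minors e.succAbove b.succAbove) *
        (θ c b.rev • D.S 0 b.rev p) else 0 := by
    intro p
    rw [hW, extT_mul_contracted_apply, hvt, hv0, tail_toFront, toFront_zero, smul_sub, smul_comm]
    have h6 := sum_update_succAbove (f := D.tail.minors e.succAbove)
      (fun σ w => minors_comp hθ D.tail hd _ σ w) (fun b => θ c b.rev • D.S 0 b.rev p) p c.rev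
    have h7 : ∀ q : Fin k, toFront p q.succ = p.succAbove q := fun q => congrFun (tail_toFront p) q
    simp only [h7]
    rw [h6, Fin.rev_rev, hθ.self, one_smul, smul_sub, sub_smul, one_smul, mul_sub]
    simp only [smul_mul_assoc, mul_smul_comm]
    split_ifs
    · abel
    · rw [smul_zero]; abel
  simp only [h5, Finset.sum_add_distrib, Finset.sum_ite_eq, Finset.mem_univ, if_true, smul_add,
    Finset.smul_sum, mul_add]
  congr 1
  · refine Finset.sum_congr rfl fun p _ => ?_
    rw [cofactor, Matrix.of_apply, pow_add, mul_smul, ← smul_mul_assoc]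
  · refine Finset.sum_congr rfl fun p _ => ?_
    rw [cofactor, Matrix.of_apply, pow_add, mul_smul, mul_smul_comm y, smul_comm _ y,
      ← smul_mul_assoc ((-1) ^ (e : ℕ) : ℤ)]

/-- Expansion of the Sklyanin determinant with respect to the last factor. -/
theorem cofactor_mul_last [IsAddTorsionFree B] (hθ : IsTheta θ)
    (D : BracketData 𝕜 B θ (k + 1))
    (hd : ∀ i j : Fin (k + 1), (j : ℕ) = i + 1 →
      (D.reindex (finRotate (k + 1))).d i j = 1) {y : 𝕜}
    (hr : ∀ i : Fin k, D.r i.succ 0 * (1 + (i : ℕ) * y) = y) (c e : Fin (k + 1)) :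
    ∑ p, ((1 - y) • D.tail.cofactor p c + y • θ c.rev p • D.tail.cofactor c.rev p.rev) *
        D.S 0 p e =
      if e = c then (D.reindex (finRotate (k + 1))).minors id id else 0 := by
  have hrot : ∀ i : Fin k, finRotate (k + 1) i.castSucc = i.succ := by
    intro i
    rw [finRotate_apply, Fin.coeSucc_eq_succ]
  have hd' : ∀ i j : Fin k, (j : ℕ) = i + 1 → D.d i.succ j.succ = 1 := by
    intro i j hij
    have := hd i.castSucc j.castSucc (by simpa using hij)
    simp only [reindex, hrot] at this
    exact this
  have hlist : (List.finRange (k + 1)).map (finRotate (k + 1)) =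
      (List.finRange k).map Fin.succ ++ [0] := by
    rw [List.finRange_succ_last, List.map_append, List.map_map, List.map_singleton, finRotate_last]
    congr 1
    exact List.map_congr_left fun i _ => hrot i
  -- The rotation numbers the sites so that site `0` comes last. Its permutation operator acts on
  -- both sides of the bracket, and skew-symmetry makes the two signs cancel.
  have h1 : (D.reindex (finRotate (k + 1))).minors =
      cosetSum B (k + 1) k * (extT D.tail.minors * D.contracted y) := by
    rw [← antisym_mul_brk_append hθ D hd' hr, ← hlist]
    have h2 := D.opP_mul_brk (finRotate (k + 1)) (List.nodup_finRange (k + 1))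
    have h3 := minors_mul_opP hθ (D.reindex (finRotate (k + 1))) hd (finRotate (k + 1))⁻¹
    have h4 : D.brk ((List.finRange (k + 1)).map (finRotate (k + 1))) =
        opP B (finRotate (k + 1)) * (D.reindex (finRotate (k + 1))).brk (List.finRange (k + 1)) *
          opP B (finRotate (k + 1))⁻¹ := by
      rw [h2, mul_assoc, ← opP_mul, mul_inv_cancel, opP_one, mul_one]
    rw [h4, ← mul_assoc, ← mul_assoc, antisym_mul_opP, smul_mul_assoc, smul_mul_assoc]
    rw [minors] at h3 ⊢
    rw [h3, Perm.sign_inv, smul_smul, ← Units.val_mul, Int.units_mul_self, Units.val_one, one_smul]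
  set D' := D.reindex (finRotate (k + 1)) with hD'
  set v : Fin (k + 1) → Fin (k + 1) := Fin.cons e c.succAbove with hv
  have hv0 : v 0 = e := rfl
  have hvt : Fin.tail v = c.succAbove := rfl
  rw [← apply_cons_succAbove (f := fun w => D'.minors id w)
    (fun σ w => minors_comp hθ D' hd id σ w) e c, ← hv]
  set W := extT D.tail.minors * D.contracted y with hW
  have hWσ : ∀ (σ : Perm (Fin k)) (w : Fin (k + 1) → Fin (k + 1)),
      W (w ∘ extPerm σ) v = ((Perm.sign σ : ℤˣ) : ℤ) • W w v := by
    intro σ w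
    have h2 : opP B (extPerm σ) * W = ((Perm.sign σ : ℤˣ) : ℤ) • W := by
      rw [hW, ← mul_assoc, ← extT_opP, ← extT_mul, opP_mul_minors, extT_smul_int, smul_mul_assoc]
    have h3 := congrFun (congrFun h2 w) v
    rwa [opP_mul_apply] at h3
  have h4 : D'.minors id v = W id v - ∑ q : Fin k, W (swap 0 q.succ) v := by
    rw [h1, cosetSum, sub_mul, one_mul, Finset.sum_mul, Matrix.sub_apply, Matrix.sum_apply]
    simp only [opP_mul_apply, Function.id_comp]
  rw [h4, cosetSum_sum (f := fun w => W w v) hWσ]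
  have h5 : ∀ p : Fin (k + 1), ((-1) ^ (c : ℕ) : ℤ) • W (toFront p) v =
      (((-1) ^ (c : ℕ) : ℤ) • D.tail.minors p.succAbove c.succAbove) * ((1 - y) • D.S 0 p e) +
      if c.rev = p then y • ∑ b : Fin (k + 1), (((-1) ^ (b : ℕ) : ℤ) • D.tail.minors p.succAbove b.succAbove) *
        (θ p b.rev • D.S 0 b.rev e) else 0 := by
    intro p
    rw [hW, extT_mul_contracted_apply, hvt, hv0, tail_toFront, toFront_zero, smul_sub, smul_comm]
    have h6 := sum_update_succAbove (f := D.tail.minors p.succAbove)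
      (fun σ w => minors_comp hθ D.tail hd' _ σ w) (fun b => θ p b.rev • D.S 0 b.rev e) c p.rev
    have h7 : ∀ q : Fin k, v q.succ = c.succAbove q := fun q => rfl
    simp only [h7]
    rw [h6, Fin.rev_rev, hθ.self, one_smul, smul_sub, sub_smul, one_smul, mul_sub]
    simp only [smul_mul_assoc, mul_smul_comm]
    have h8 : p.rev = c ↔ c.rev = p := ⟨fun h => by rw [← h, Fin.rev_rev], fun h => by
      rw [← h, Fin.rev_rev]⟩
    simp only [h8]
    split_ifs
    · abel
    · rw [smul_zero]; abel
  rw [Finset.smul_sum]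
  simp only [smul_comm ((-1) ^ (c : ℕ) : ℤ), h5]
  simp only [smul_add, Finset.sum_add_distrib, smul_ite, smul_zero, Finset.sum_ite_eq,
    Finset.mem_univ, if_true, add_mul]
  congr 1
  · refine Finset.sum_congr rfl fun p _ => ?_
    rw [cofactor, Matrix.of_apply, pow_add, mul_smul, mul_smul_comm, smul_mul_assoc (1 - y),
      ← smul_mul_assoc, smul_comm _ (1 - y)]
    simp only [smul_mul_assoc]
  -- The transposed sum has the summation index negated in the entry of `S_0`; reversing it matches
  -- the stated form.
  · rw [← Equiv.sum_comp Fin.revPerm, Finset.smul_sum, Finset.smul_sum]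
    refine Finset.sum_congr rfl fun p _ => ?_
    rw [Fin.revPerm_apply, Fin.rev_rev, cofactor, Matrix.of_apply, pow_add, mul_smul,
      smul_comm _ y, smul_mul_assoc, smul_mul_assoc, mul_smul_comm, ← smul_mul_assoc]
    rw [smul_comm _ (θ _ _), smul_mul_assoc, smul_mul_assoc]

end

end BracketData

end

end SkewTwisted

namespace SkewTwisted

noncomputable section

open PowerSeries Equiv

attribute [local instance] seriesAlgebra

/-! ### Compatibility of brackets with ring homomorphisms -/

section Transport

variable {𝕜 : Type*} [CommRing 𝕜] {B B' : Type*} [Ring B] [Ring B'] [Algebra 𝕜 B] [Algebra 𝕜 B']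
  {k N : ℕ} {θ : Fin N → Fin N → 𝕜}

theorem map_onOne (φ : B →+* B') (p : Fin k) (M : Matrix (Fin N) (Fin N) B) :
    (onOne p M).map φ = onOne p (M.map φ) := by
  ext x y
  simp only [onOne, Matrix.map_apply, Matrix.of_apply]
  split_ifs
  · rfl
  · exact map_zero φ

theorem map_opP (φ : B →+* B') (σ : Perm (Fin k)) :
    (opP B σ : Matrix (Fin k → Fin N) (Fin k → Fin N) B).map φ = opP B' σ := by
  ext x y
  simp only [opP, Matrix.map_apply, Matrix.of_apply]
  split_ifs
  · exact map_one φ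
  · exact map_zero φ

theorem map_antisym (φ : B →+* B') : (antisym k N B).map φ = antisym k N B' := by
  ext x y
  simp only [antisym, Matrix.map_apply, Matrix.sum_apply, Matrix.smul_apply, map_sum, map_zsmul]
  refine Finset.sum_congr rfl fun σ _ => ?_
  rw [← map_opP φ, Matrix.map_apply]

namespace BracketData

/-- The map `φ` is semilinear over `ψ` rather than linear, because a substitution in `u` also acts
on the scalar series. -/
theorem map_rt {D : BracketData 𝕜 B θ k} {D' : BracketData 𝕜 B' θ k} {φ : B →+* B'}
    {ψ : 𝕜 →+* 𝕜} (hφ : ∀ (f : 𝕜), φ (algebraMap 𝕜 B f) = algebraMap 𝕜 B' (ψ f))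
    (hθ : ∀ i j, ψ (θ i j) = θ i j) (hr : ∀ p q, ψ (D.r p q) = D'.r p q) (p q : Fin k) :
    (D.rt p q).map φ = D'.rt p q := by
  have hQ : ∀ x y, φ (siteQ B θ p q x y) = siteQ B' θ p q x y := by
    intro x y
    simp only [siteQ, Matrix.of_apply]
    split_ifs
    · rw [hφ, hθ]
    · exact map_zero φ
  ext x y
  rw [rt, rt, Matrix.map_apply, Matrix.sub_apply, Matrix.sub_apply, map_sub, Matrix.smul_apply,
    Matrix.smul_apply, Algebra.smul_def, Algebra.smul_def, map_mul, hφ, hr, hQ, Matrix.one_apply,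
    Matrix.one_apply]
  split_ifs <;> simp

theorem map_brk {D : BracketData 𝕜 B θ k} {D' : BracketData 𝕜 B' θ k} {φ : B →+* B'}
    {ψ : 𝕜 →+* 𝕜} (hφ : ∀ (f : 𝕜), φ (algebraMap 𝕜 B f) = algebraMap 𝕜 B' (ψ f))
    (hθ : ∀ i j, ψ (θ i j) = θ i j) (hS : ∀ p, (D.S p).map φ = D'.S p)
    (hr : ∀ p q, ψ (D.r p q) = D'.r p q) (l : List (Fin k)) :
    (D.brk l).map φ = D'.brk l := by
  induction l with
  | nil => exact Matrix.map_one φ (map_zero φ) (map_one φ)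
  | cons p l ih =>
    have h : ∀ l' : List (Fin k), ((l'.map (D.rt p)).prod).map φ = (l'.map (D'.rt p)).prod := by
      intro l'
      induction l' with
      | nil => exact Matrix.map_one φ (map_zero φ) (map_one φ)
      | cons q l' ih' =>
        rw [List.map_cons, List.prod_cons, Matrix.map_mul, ih', map_rt hφ hθ hr, List.map_cons,
          List.prod_cons]
    rw [brk, brk, Matrix.map_mul, Matrix.map_mul, map_onOne, hS, h, ih]

theorem map_minors {D : BracketData 𝕜 B θ k} {D' : BracketData 𝕜 B' θ k} {φ : B →+* B'}
    {ψ : 𝕜 →+* 𝕜} (hφ : ∀ (f : 𝕜), φ (algebraMap 𝕜 B f) = algebraMap 𝕜 B' (ψ f))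
    (hθ : ∀ i j, ψ (θ i j) = θ i j) (hS : ∀ p, (D.S p).map φ = D'.S p)
    (hr : ∀ p q, ψ (D.r p q) = D'.r p q) : D.minors.map φ = D'.minors := by
  rw [minors, minors, Matrix.map_mul, map_antisym, map_brk hφ hθ hS hr]

theorem brk_congr {D D' : BracketData 𝕜 B θ k} (hS : D.S = D'.S) (hr : D.r = D'.r)
    (l : List (Fin k)) : D.brk l = D'.brk l := by
  induction l with
  | nil => rfl
  | cons p l ih =>
    have h : D.rt = D'.rt := by
      ext1 p; ext1 q
      rw [rt, rt, hr]
    rw [brk, brk, hS, h, ih]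

theorem minors_congr {D D' : BracketData 𝕜 B θ k} (hS : D.S = D'.S) (hr : D.r = D'.r) :
    D.minors = D'.minors := by
  rw [minors, minors, brk_congr hS hr]

end BracketData

end Transport

/-! ### Identification with the Sklyanin minors -/

section Concrete

variable {A : Type*} [Ring A] [Algebra ℂ A] {c : LieCase} {k N : ℕ}
  {S : Matrix (Fin N) (Fin N) A⟦X⟧}

instance : IsAddTorsionFree A⟦X⟧ where
  nsmul_right_injective n hn f g h := by
    have h' : (n : ℂ) • f = (n : ℂ) • g := by
      simpa only [Nat.cast_smul_eq_nsmul] using h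
    simpa [smul_smul, hn] using congrArg (fun t => (n : ℂ)⁻¹ • t) h'

/-- The numbers `θ_{ij}` as constant series. -/
def thetaSeries (c : LieCase) {N : ℕ} (i j : Fin N) : ℂ⟦X⟧ := C (theta c i j)

theorem isTheta_thetaSeries (hN : c = LieCase.symplectic → Even N) :
    IsTheta (thetaSeries c (N := N)) where
  mul i j l := by simp only [thetaSeries]; rw [← map_mul, theta_mul hN]
  self i := by rw [thetaSeries, theta_self hN, map_one]
  rev_rev i j := by rw [thetaSeries, theta_rev_rev, thetaSeries]

theorem invLin_sub_invLin {a : ℂ} (ha : a ≠ 0) (b b' : ℂ) :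
    invLin a b - invLin a b' = C (b' - b) * (invLin a b * invLin a b') := by
  have h := invLin_mul ha b
  have h' := invLin_mul ha b'
  apply mul_left_cancel₀ (X_ne_zero (R := ℂ))
  rw [map_sub]
  linear_combination invLin a b' * h - invLin a b * h'

/-- This is the recursion required by `fusion_contract`: for `y = 1/(a u + b)`, the value `r = 1/(a
u + b + z)` satisfies `r (1 + z y) = y`. -/
theorem invLin_mul_one_add {a : ℂ} (ha : a ≠ 0) (b z : ℂ) :
    invLin a (b + z) * (1 + C z * invLin a b) = invLin a b := by
  have h := invLin_sub_invLin ha (b + z) b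
  rw [show b - (b + z) = -z by ring, map_neg] at h
  linear_combination h

/-- The matrices `S(u + t_p)` with `R^t_{pq}(-2u - t_p - t_q)`. -/
def shiftData (hS : IsQuaternary c S) (t : Fin k → ℂ) (ht : Function.Injective t) :
    BracketData ℂ⟦X⟧ A⟦X⟧ (thetaSeries c (N := N)) k where
  S p := substMat 1 (t p) S
  r p q := invLin (-2) (-t p - t q)
  d p q := C (t p - t q)⁻¹
  r_symm p q := by rw [show -t p - t q = -t q - t p by ring]
  pair p q hpq i j k l := by
    simp only [substMat, Matrix.map_apply, thetaSeries, C_smul]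
    have := hS.eval (ht.ne hpq) i j k l
    simpa only [C_smul] using this
  mul_r p q s hpq := by
    have h : t p - t q ≠ 0 := sub_ne_zero.2 (ht.ne hpq)
    rw [invLin_sub_invLin (by norm_num), ← mul_assoc, ← map_mul,
      show -t s - t q - (-t s - t p) = t p - t q by ring, inv_mul_cancel₀ h, map_one, one_mul]

theorem shift_injective (a : ℂ) : Function.Injective fun p : Fin k => a - ((p : ℕ) : ℂ) := by
  intro p q h
  exact Fin.ext (by exact_mod_cast sub_right_injective h)

theorem opQ_apply (x y : Fin N × Fin N) :
    opQ c N x y = if x.2 = x.1.rev ∧ y.2 = y.1.rev then theta c y.2 x.2 else 0 := by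
  have h : ∀ i j : Fin N, (theta c i j •
      (Matrix.single j.rev i.rev (1 : ℂ) ⊗ₖ Matrix.single j i (1 : ℂ)) :
        Matrix (Fin N × Fin N) (Fin N × Fin N) ℂ) x y =
      if j = x.2 then (if i = y.2 then
        (if x.2 = x.1.rev ∧ y.2 = y.1.rev then theta c y.2 x.2 else 0) else 0) else 0 := by
    intro i j
    rw [Matrix.smul_apply, Matrix.kroneckerMap_apply, Matrix.single_apply, Matrix.single_apply]
    by_cases h1 : j = x.2
    · by_cases h2 : i = y.2
      · subst h1 h2
        have e1 : ∀ a b : Fin N, a.rev = b ↔ a = b.rev :=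
          fun a b => ⟨fun h => by rw [← h, Fin.rev_rev], fun h => by rw [h, Fin.rev_rev]⟩
        simp only [e1, and_self, if_true, mul_one, smul_eq_mul, mul_ite, mul_zero]
      · simp [h2]
    · simp [h1]
  rw [opQ, Matrix.sum_apply]
  simp only [Matrix.sum_apply, h]
  simp

theorem onTwo_opQ (p q : Fin k) :
    onTwo p q ((opQ c N).map (algebraMap ℂ A⟦X⟧)) = siteQ A⟦X⟧ (thetaSeries c) p q := by
  ext1 x y
  simp only [onTwo, siteQ, Matrix.of_apply, Matrix.map_apply, opQ_apply]
  have h : ∀ z : ℂ, algebraMap ℂ A⟦X⟧ z = algebraMap ℂ⟦X⟧ A⟦X⟧ (C z) := fun z => by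
    rw [Algebra.algebraMap_eq_smul_one, Algebra.algebraMap_eq_smul_one, C_smul]
  by_cases h1 : ∀ w, w ≠ p → w ≠ q → x w = y w
  · by_cases h2 : x q = (x p).rev ∧ y q = (y p).rev
    · rw [if_pos h1, if_pos h2, if_pos ⟨h1, h2⟩, h, theta_symm, thetaSeries]
    · rw [if_pos h1, if_neg h2, if_neg fun h => h2 h.2, map_zero]
  · rw [if_neg h1, if_neg fun h => h1 h.1]

/-- The data for the specialization `u_p = u + a - p`. -/
abbrev standardData (hS : IsQuaternary c S) (k : ℕ) (a : ℂ) :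
    BracketData ℂ⟦X⟧ A⟦X⟧ (thetaSeries c (N := N)) k :=
  shiftData hS (fun p : Fin k => a - ((p : ℕ) : ℂ)) (shift_injective a)

theorem opRt_eq_rt (hS : IsQuaternary c S) (p q : Fin k) :
    opRt A c p q (-2) (((p : ℕ) : ℂ) + ((q : ℕ) : ℂ)) = (standardData hS k 0).rt p q := by
  rw [opRt, BracketData.rt, onTwo_opQ]
  have hr : (standardData hS k 0).r p q = invLin (-2) (((p : ℕ) : ℂ) + ((q : ℕ) : ℂ)) :=
    congrArg (invLin (-2)) (by ring)
  rw [hr]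
  rfl

/-- Along an increasing list of sites, the filter `p < q` selects exactly the sites still to come,
so the recursive and filtered products agree. -/
theorem bracket_eq_brk (hS : IsQuaternary c S) :
    bracket c k S = (standardData hS k 0).brk (List.finRange k) := by
  have h : ∀ l : List (Fin k), l.Pairwise (· < ·) → (l.map fun p =>
      onOne p (substMat 1 (-((p : ℕ) : ℂ)) S) *
        ((l.filter fun q => p < q).map fun q =>
          opRt A c p q (-2) (((p : ℕ) : ℂ) + ((q : ℕ) : ℂ))).prod).prod =
      (standardData hS k 0).brk l := by
    intro l hl
    induction l with
    | nil => rfl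
    | cons p l ih =>
      rw [List.pairwise_cons] at hl
      have h1 : ((p :: l).filter fun q => p < q) = l := by
        rw [List.filter_cons_of_neg (by simp), List.filter_eq_self]
        simpa using hl.1
      have h2 : ∀ q ∈ l, ((p :: l).filter fun q' => q < q') = l.filter fun q' => q < q' := by
        intro q hq
        rw [List.filter_cons_of_neg]
        simpa using (hl.1 q hq).le
      have h3 : (standardData hS k 0).S p = substMat 1 (-((p : ℕ) : ℂ)) S :=
        congrArg (substMat 1 · S) (zero_sub _)
      have h4 : l.map (fun q => opRt A c p q (-2) (((p : ℕ) : ℂ) + ((q : ℕ) : ℂ))) =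
          l.map ((standardData hS k 0).rt p) :=
        List.map_congr_left fun q _ => opRt_eq_rt hS p q
      rw [List.map_cons, List.prod_cons, h1, BracketData.brk, ← ih hl.2, mul_assoc, h3, h4]
      refine congrArg₂ (· * ·) rfl (congrArg₂ (· * ·) rfl
        (congrArg List.prod (List.map_congr_left fun q hq => ?_)))
      rw [h2 q hq]
  exact h _ (List.pairwise_lt_finRange k)

theorem skMinor_eq_minors (hS : IsQuaternary c S) (x y : Fin k → Fin N) :
    skMinor c S x y = (standardData hS k 0).minors x y := by
  rw [skMinor, bracket_eq_brk hS, BracketData.minors]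

theorem substMat_map_substHom {a b : ℂ} (ha : a ≠ 0) (s : ℂ) :
    (substMat 1 s S).map (substHom A a b) = substMat a (b + s) S := by
  ext1 i j
  simp only [substMat, Matrix.map_apply, substHom_apply]
  rw [substLin_substLin ha one_ne_zero]
  simp

theorem substLin_minors (hS : IsQuaternary c S) (a b : ℂ) (x y : Fin k → Fin N) :
    substLin 1 b ((standardData hS k a).minors x y) = (standardData hS k (b + a)).minors x y := by
  have h := BracketData.map_minors (D := standardData hS k a) (D' := standardData hS k (b + a))
    (φ := substHom A 1 b) (ψ := substHom ℂ 1 b)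
    (fun f => by exact substLin_scal 1 b f) (fun i j => substLin_C _ _ _)
    (fun p => by
      simp only [shiftData]
      rw [substMat_map_substHom one_ne_zero, add_sub_assoc])
    (fun p q => by
      simp only [shiftData, substHom_apply]
      rw [substLin_invLin one_ne_zero (by norm_num)]
      congr 1 <;> ring)
  exact congrFun (congrFun h x) y

end Concrete

/-! ### Expansions of `sdet` in terms of the signed minors -/

section Square

variable {A : Type*} [Ring A] [Algebra ℂ A] {c : LieCase} {k : ℕ}
  {S : Matrix (Fin (k + 1)) (Fin (k + 1)) A⟦X⟧}

theorem skip_eq_succAbove (j : Fin (k + 1)) : (skip j : Fin k → Fin (k + 1)) = j.succAbove := by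
  ext p
  simp only [skip, Fin.succAbove, Fin.lt_def, Fin.val_castSucc]
  split_ifs <;> rfl

/-- The signed minors `(-1)^{i+j} s^{1 … î … N}_{1 … ĵ … N}(u)`. -/
def signedMinor (c : LieCase) (S : Matrix (Fin (k + 1)) (Fin (k + 1)) A⟦X⟧) :
    Matrix (Fin (k + 1)) (Fin (k + 1)) A⟦X⟧ :=
  Matrix.of fun i j => ((-1) ^ ((i : ℕ) + (j : ℕ)) : ℤ) • skMinor c S i.succAbove j.succAbove

/-- The shifts `1, 0, -1, …` make the last `k` sites form the minors at `u` and the whole bracket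
the determinant at `u + 1`. The parameter `y = 1/(-2u-1)` belongs to sites `0` and `1`. -/
theorem signedMinor_mul_first (hN : c = LieCase.symplectic → Even (k + 1))
    (hS : IsQuaternary c S) (i j : Fin (k + 1)) :
    ∑ p, signedMinor c S i p * ((1 - invLin (-2) (-1)) • substLin 1 1 (S j p) +
      invLin (-2) (-1) • theta c j p.rev • substLin 1 1 (S p.rev j.rev)) =
      if j = i then substLin 1 1 (sdet c S) else 0 := by
  have hθ := isTheta_thetaSeries hN
  set D := standardData hS (k + 1) 1 with hD
  have htail : D.tail.minors = (standardData hS k 0).minors := by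
    apply BracketData.minors_congr
    · ext1 p
      simp only [hD, BracketData.tail, shiftData, Fin.val_succ, Nat.cast_succ]
      congr 1
      ring
    · ext1 p; ext1 q
      simp only [hD, BracketData.tail, shiftData, Fin.val_succ, Nat.cast_succ]
      congr 1
      ring
  have h := D.cofactor_mul_first hθ (y := invLin (-2) (-1)) ?_ ?_ ?_ i j
  · have hcof : D.tail.cofactor = signedMinor c S := by
      ext1 a b
      rw [BracketData.cofactor, signedMinor, Matrix.of_apply, Matrix.of_apply, htail,
        skMinor_eq_minors hS]
    have hdet : D.minors id id = substLin 1 1 (sdet c S) := by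
      rw [sdet, skMinor_eq_minors hS, substLin_minors, add_zero]
    have hS0 : ∀ a b, D.S 0 a b = substLin 1 1 (S a b) := by
      intro a b
      simp [hD, shiftData, substMat]
    simpa only [hcof, hdet, hS0, thetaSeries, C_smul] using h
  · intro a b hab
    simp only [hD, shiftData, Fin.val_succ, hab]
    push_cast
    ring_nf
    simp
  · intro a
    simp only [hD, shiftData, Fin.val_succ, Fin.val_zero]
    have : (1 + (a : ℕ) : ℂ) ≠ 0 := by exact_mod_cast Nat.succ_ne_zero _ ∘ (Nat.add_comm _ _).trans
    rw [show (1 - ((0 : ℕ) : ℂ) - (1 - (((a : ℕ) + 1 : ℕ) : ℂ))) = 1 + (a : ℕ) by push_cast; ring,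
      show (1 + ((a : ℕ) : ℂ⟦X⟧)) = C (1 + (a : ℕ) : ℂ) by simp, ← map_mul, inv_mul_cancel₀ this,
      map_one]
  · intro a
    simp only [hD, shiftData, Fin.val_succ, Fin.val_zero]
    have := invLin_mul_one_add (a := -2) (by norm_num) (-1) ((a : ℕ) : ℂ)
    rw [map_natCast] at this
    convert this using 3
    push_cast
    ring

/-- Site `0` receives the shift `-k`, continuing `0, -1, …, 1 - k`, so placing it last restores the
standard determinant at `u`. The parameter `y = 1/(-2u+k)` belongs to the sites with shifts `-k` and
`0`. -/
theorem signedMinor_mul_last (hN : c = LieCase.symplectic → Even (k + 1))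
    (hS : IsQuaternary c S) (i j : Fin (k + 1)) :
    ∑ p, ((1 - invLin (-2) k) • signedMinor c S p i +
      invLin (-2) k • theta c i.rev p • signedMinor c S i.rev p.rev) * substLin 1 (-k) (S p j) =
      if j = i then sdet c S else 0 := by
  have hθ := isTheta_thetaSeries hN
  have ht : Function.Injective (Fin.cons (-k : ℂ) fun p : Fin k => 0 - ((p : ℕ) : ℂ)) := by
    rw [Fin.cons_injective_iff]
    refine ⟨?_, shift_injective 0⟩
    rintro ⟨p, hp⟩
    have : (p : ℕ) = k := by
      have h : ((p : ℕ) : ℂ) = k := by linear_combination -hp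
      exact_mod_cast h
    exact absurd this p.isLt.ne
  set D := shiftData hS (Fin.cons (-k : ℂ) fun p : Fin k => 0 - ((p : ℕ) : ℂ)) ht with hD
  have hrot : ∀ a : Fin (k + 1), (Fin.cons (-k : ℂ) fun p : Fin k => 0 - ((p : ℕ) : ℂ) :
      Fin (k + 1) → ℂ) (finRotate (k + 1) a) = 0 - ((a : ℕ) : ℂ) := by
    intro a
    induction a using Fin.lastCases with
    | last => simp
    | cast a => rw [finRotate_apply, Fin.coeSucc_eq_succ, Fin.cons_succ]; rfl
  have htail : D.tail.minors = (standardData hS k 0).minors :=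
    BracketData.minors_congr rfl rfl
  have h := D.cofactor_mul_last hθ (y := invLin (-2) k) ?_ ?_ i j
  · have hcof : D.tail.cofactor = signedMinor c S := by
      ext1 a b
      rw [BracketData.cofactor, signedMinor, Matrix.of_apply, Matrix.of_apply, htail,
        skMinor_eq_minors hS]
    have hdet : (D.reindex (finRotate (k + 1))).minors id id = sdet c S := by
      rw [sdet, skMinor_eq_minors hS]
      refine congrFun (congrFun (BracketData.minors_congr ?_ ?_) _) _
      · ext1 p
        simp only [hD, BracketData.reindex, shiftData, hrot]
      · ext1 p; ext1 q
        simp only [hD, BracketData.reindex, shiftData, hrot]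
    have hS0 : ∀ a b, D.S 0 a b = substLin 1 (-k) (S a b) := by
      intro a b
      simp [hD, shiftData, substMat]
    simpa only [hcof, hdet, hS0, thetaSeries, C_smul] using h
  · intro a b hab
    simp only [hD, BracketData.reindex, shiftData, hrot, hab]
    push_cast
    ring_nf
    simp
  · intro a
    simp only [hD, shiftData, Fin.cons_zero, Fin.cons_succ]
    have := invLin_mul_one_add (a := -2) (by norm_num) k ((a : ℕ) : ℂ)
    rw [map_natCast] at this
    convert this using 3
    ring

end Square

end

end SkewTwisted

namespace SkewTwisted

noncomputable section

open PowerSeries Equiv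

attribute [local instance] seriesAlgebra

/-! ### Series invariant under `u ↦ u + 1` -/

section Periodic

theorem isUnit_of_constantCoeff_eq_one {A : Type*} [Ring A] {f : A⟦X⟧} (h : constantCoeff f = 1) : IsUnit f := by
  have h' : constantCoeff f = ((1 : Aˣ) : A) := by simpa using h
  exact ⟨⟨f, invOfUnit f 1, mul_invOfUnit f 1 h', invOfUnit_mul f 1 h'⟩, rfl⟩

theorem coeff_invLin_pow_self (b : ℂ) (r : ℕ) : coeff r (invLin 1 b ^ r) = 1 := by
  rw [invLin, mul_pow, coeff_X_pow_mul', if_pos le_rfl, Nat.sub_self]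
  simp

theorem coeff_succ_invLin_pow (r : ℕ) : coeff (r + 1) (invLin 1 1 ^ r) = -(r : ℂ) := by
  induction r with
  | zero => simp [coeff_one]
  | succ r ih =>
    have h : invLin 1 1 = X * (1 - invLin 1 1) := by
      have := invLin_mul (one_ne_zero (α := ℂ)) 1
      rw [map_one, one_mul] at this
      linear_combination this
    have h2 : invLin 1 1 ^ (r + 1) = X * (invLin 1 1 ^ r - invLin 1 1 ^ (r + 1)) := by
      linear_combination invLin 1 1 ^ r * h
    rw [h2, coeff_succ_X_mul, map_sub, ih, coeff_invLin_pow_self 1]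
    push_cast
    ring

variable {A : Type*} [Ring A] [Algebra ℂ A]

/-- A series `f` in `u⁻¹` with `f(u + 1) = f(u)` is constant. -/
theorem eq_C_of_periodic {f : A⟦X⟧} (h : substLin 1 1 f = f) : f = C (constantCoeff f) := by
  have key : ∀ r : ℕ, coeff (r + 1) f = 0 := by
    intro r
    induction r using Nat.strong_induction_on with
    | _ r ih =>
      -- If `f_1, …, f_r` vanish, the coefficient of `u^(-r-2)` in `f(u+1) - f(u)` is `-(r+1)
      -- f_(r+1)`.
      have h1 := congrArg (coeff (r + 2)) h
      rw [coeff_substLin 1 1 f (Nat.lt_succ_self _), Finset.sum_range_succ, Finset.sum_range_succ,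
        Finset.sum_eq_zero, zero_add, coeff_invLin_pow_self 1, one_smul, coeff_succ_invLin_pow,
        add_eq_right] at h1
      · exact (smul_eq_zero_iff_right (neg_ne_zero.2 (Nat.cast_ne_zero.2 r.succ_ne_zero))).1 h1
      · intro t ht
        rcases t with _ | t
        · simp [coeff_one]
        · rw [ih t (by simpa using ht), smul_zero]
  ext m
  rcases m with _ | m
  · simp
  · rw [key, coeff_C, if_neg m.succ_ne_zero]

end Periodic

/-! ### Behaviour at infinity -/

section Constant

theorem BracketData.map_brk_eq_one {𝕜 : Type*} [CommRing 𝕜] {B B' : Type*} [Ring B] [Ring B']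
    [Algebra 𝕜 B] {k N : ℕ} {θ : Fin N → Fin N → 𝕜} {D : BracketData 𝕜 B θ k} {φ : B →+* B'}
    (hS : ∀ p, (D.S p).map φ = 1) (hr : ∀ p q, φ (algebraMap 𝕜 B (D.r p q)) = 0)
    (l : List (Fin k)) : (D.brk l).map φ = 1 := by
  have hone : (onOne (N := N) · (1 : Matrix (Fin N) (Fin N) B')) =
      fun _ : Fin k => (1 : Matrix (Fin k → Fin N) (Fin k → Fin N) B') := by
    ext p x y
    simp only [onOne, Matrix.of_apply, Matrix.one_apply]
    by_cases h : x = y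
    · simp [h]
    · rw [if_neg h]
      by_cases h1 : ∀ q, q ≠ p → x q = y q
      · rw [if_pos h1, if_neg]
        intro h2
        refine h (funext fun q => ?_)
        by_cases hq : q = p
        · rw [hq, h2]
        · exact h1 q hq
      · rw [if_neg h1]
  have hrt : ∀ p q, (D.rt p q).map φ = 1 := by
    intro p q
    ext x y
    rw [rt, Matrix.map_apply, Matrix.sub_apply, Matrix.smul_apply, Algebra.smul_def, map_sub, map_mul,
      hr, zero_mul, sub_zero, Matrix.one_apply, Matrix.one_apply]
    split_ifs <;> simp
  induction l with
  | nil => exact Matrix.map_one φ (map_zero φ) (map_one φ)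
  | cons p l ih =>
    have h : ∀ l' : List (Fin k), ((l'.map (D.rt p)).prod).map φ = 1 := by
      intro l'
      induction l' with
      | nil => exact Matrix.map_one φ (map_zero φ) (map_one φ)
      | cons q l' ih' => rw [List.map_cons, List.prod_cons, Matrix.map_mul, ih', hrt, mul_one]
    rw [brk, Matrix.map_mul, Matrix.map_mul, map_onOne, hS, h, ih, mul_one, mul_one]
    exact congrFun hone p

variable {A : Type*} [Ring A] [Algebra ℂ A] {c : LieCase} {N : ℕ}
  {S : Matrix (Fin N) (Fin N) A⟦X⟧}

theorem constantCoeff_scal_invLin (a b : ℂ) : constantCoeff (scal A (invLin a b)) = 0 := by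
  rw [← coeff_zero_eq_constantCoeff_apply]
  simp [scal, invLin]

/-- At `u = ∞` all `S_p` and `R^t_{pq}` become the identity, leaving a diagonal entry of `A_N` to
which only the identity permutation contributes. -/
theorem constantCoeff_sdet (hS : IsQuaternary c S)
    (hS1 : ∀ i j, constantCoeff (S i j) = if i = j then 1 else 0) :
    constantCoeff (sdet c S) = 1 := by
  have h : (standardData hS N 0).minors.map (constantCoeff (R := A)) = antisym N N A := by
    rw [BracketData.minors, Matrix.map_mul, map_antisym, BracketData.map_brk_eq_one, mul_one]
    · intro p
      ext1 i j
      simp only [shiftData, substMat, Matrix.map_apply, constantCoeff_substLin, hS1,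
        Matrix.one_apply]
    · intro p q
      exact constantCoeff_scal_invLin _ _
  rw [sdet, skMinor_eq_minors hS]
  refine (congrFun (congrFun h id) id).trans ?_
  rw [antisym, Matrix.sum_apply, Finset.sum_eq_single 1]
  · simp [opP_one]
  · intro σ _ hσ
    rw [Matrix.smul_apply, opP, Matrix.of_apply, if_neg, smul_zero]
    intro h
    refine hσ (Equiv.ext fun i => ?_)
    have := congrFun h (σ i)
    simpa using this
  · simp

end Constant

/-! ### Transposition and substitution -/

section Transposition

variable {A : Type*} [Ring A] [Algebra ℂ A] {c : LieCase} {N : ℕ}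

theorem transp_transp (hN : c = LieCase.symplectic → Even N) (M : Matrix (Fin N) (Fin N) A⟦X⟧) :
    transp c (transp c M) = M := by
  ext1 i j
  simp only [transp, Matrix.of_apply, Fin.rev_rev]
  rw [smul_smul, theta_rev_rev, theta_mul hN, theta_self hN, one_smul]

theorem substMat_transp (a b : ℂ) (M : Matrix (Fin N) (Fin N) A⟦X⟧) :
    substMat a b (transp c M) = transp c (substMat a b M) := by
  ext1 i j
  simp only [transp, substMat, Matrix.map_apply, Matrix.of_apply, substLin_smul]

end Transposition

/-! ### The scalar factor from the symmetry relation -/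

section Kappa

/-- The expansion of `(2 v + 1) / (2 v - 1)` with `v = a u + b` in the symplectic case and `1` in
the orthogonal case. -/
def kappa (c : LieCase) (a b : ℂ) : ℂ⟦X⟧ := 1 - C (1 - c.sign) * invLin (-2 * a) (1 - 2 * b)

theorem substLin_kappa (c : LieCase) {a a' : ℂ} (ha : a ≠ 0) (ha' : a' ≠ 0) (b b' : ℂ) :
    substLin a b (kappa c a' b') = kappa c (a' * a) (a' * b + b') := by
  rw [kappa, ← substHom_apply, map_sub, map_one, map_mul, substHom_apply, substHom_apply,
    substLin_C, substLin_invLin ha (by simpa using ha'), kappa]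
  congr 3 <;> ring

variable {A : Type*} [Ring A] [Algebra ℂ A] {c : LieCase} {N : ℕ}
  {S : Matrix (Fin N) (Fin N) A⟦X⟧}

theorem smul_combination {𝕜 M : Type*} [CommRing 𝕜] [AddCommGroup M] [Module 𝕜 M] {y q ε : 𝕜}
    (hyq : y + q = y * q) (f g : M) :
    (1 - y) • f + y • ε • (g + ε • -q • (g - f)) =
      (1 - (1 - ε) * y) • (f + ε • q • (f - g)) := by
  have e1 : 1 - y + y * ε * (ε * q) = (1 - (1 - ε) * y) * (1 + ε * q) := by
    linear_combination -ε * hyq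
  have e2 : y * ε * (1 - ε * q) = -((1 - (1 - ε) * y) * (ε * q)) := by
    linear_combination ε * hyq
  linear_combination (norm := module) e1 • f + e2 • g

/-- A form of the symmetry relation. -/
theorem IsSymmetric.combination (h : IsSymmetric c S) (i j : Fin N) :
    (1 - invLin (-2) (-1)) • substLin 1 1 (S i j) +
      invLin (-2) (-1) • theta c i j.rev • substLin 1 1 (S j.rev i.rev) =
    kappa c 1 1 • theta c i j • substLin (-1) (-1) (S j.rev i.rev) := by
  -- The symmetry relation at `u + 1` and at `-u - 1` expresses both transposed entries through
  -- `S_{ij}(u+1)` and `S_{ij}(-u-1)`. The claim then reduces to the scalar identity `y + q = y q`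
  -- for `y = 1/(-2u-1)` and `q = 1/(2u+2)`.
  have h1 := congrArg (substLin 1 1) (h i j)
  have h2 := congrArg (substLin (-1) (-1)) (h i j)
  simp only [← substHom_apply, map_add] at h1 h2
  simp only [substHom_apply, substLin_smul, substLin_series_smul] at h1 h2
  simp only [← substHom_apply, map_sub] at h1 h2
  simp only [substHom_apply] at h1 h2
  rw [substLin_substLin one_ne_zero (by norm_num), substLin_substLin one_ne_zero (by norm_num),
    substLin_invLin one_ne_zero two_ne_zero] at h1
  rw [substLin_substLin (by norm_num) (by norm_num), substLin_substLin (by norm_num) (by norm_num),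
    substLin_invLin (by norm_num) two_ne_zero] at h2
  norm_num at h1 h2
  set q := invLin 2 2 with hq
  set y := invLin (-2) (-1) with hy
  have hq' : invLin (-2) (-2) = -q := by
    symm; apply eq_invLin (by norm_num)
    have := invLin_mul (two_ne_zero (α := ℂ)) 2
    simp only [map_neg, map_ofNat] at this ⊢
    linear_combination this
  have hyq : y + q = y * q := by
    have e1 := invLin_mul (two_ne_zero (α := ℂ)) 2
    have e2 := invLin_mul (show (-2 : ℂ) ≠ 0 by norm_num) (-1)
    apply mul_left_cancel₀ (X_ne_zero (R := ℂ))
    rw [← hq] at e1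
    rw [← hy] at e2
    simp only [map_neg, map_one, map_ofNat] at e1 e2
    linear_combination -y * e1 - q * e2
  rw [hq'] at h2
  have hk : kappa c 1 1 = 1 - C (1 - c.sign) * y := by
    rw [kappa, hy]; norm_num
  have hε : (C c.sign : ℂ⟦X⟧) * C c.sign = 1 := by rw [← map_mul, sign_mul_sign, map_one]
  rw [theta_rev_right, mul_smul, h1, h2, hk, map_sub, map_one]
  simp only [← C_smul c.sign]
  generalize (C c.sign : ℂ⟦X⟧) = ε at *
  generalize substLin 1 1 (S i j) = f
  generalize substLin (-1) (-1) (S i j) = g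
  exact smul_combination hyq f g

end Kappa

end

end SkewTwisted

namespace SkewTwisted

noncomputable section

open PowerSeries Equiv

attribute [local instance] seriesAlgebra

/-! ### The comatrix and the functional equation of `sdet` -/

section Comatrix

theorem apply_of_mul_unit {k : ℕ} {B : Type*} [Ring B] {D : B} {M : Matrix (Fin k) (Fin k) B}
    {V : (Matrix (Fin k) (Fin k) B)ˣ} (h : M * (V : Matrix (Fin k) (Fin k) B) =
      D • (1 : Matrix (Fin k) (Fin k) B)) (i j : Fin k) :
    M i j = D * (↑V⁻¹ : Matrix (Fin k) (Fin k) B) i j := by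
  have h2 := congrArg (· * (↑V⁻¹ : Matrix (Fin k) (Fin k) B)) h
  simp only [mul_assoc, Units.mul_inv, mul_one, Matrix.smul_mul, one_mul] at h2
  exact congrFun (congrFun h2 i) j

variable {A : Type*} [Ring A] [Algebra ℂ A] {c : LieCase} {k : ℕ}
  {S : Matrix (Fin (k + 1)) (Fin (k + 1)) A⟦X⟧}

theorem comatrix_mul (hN : c = LieCase.symplectic → Even (k + 1)) (hS : IsQuaternary c S) :
    (Matrix.of fun i j => (1 - invLin (-2) k) • (signedMinor c S).transpose i j +
      invLin (-2) k • c.sign • transp c (signedMinor c S).transpose i j) * substMat 1 (-(k : ℂ)) S =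
      sdet c S • (1 : Matrix (Fin (k + 1)) (Fin (k + 1)) A⟦X⟧) := by
  ext1 i j
  rw [Matrix.mul_apply, Matrix.smul_apply, smul_eq_mul, Matrix.one_apply, mul_ite, mul_one, mul_zero]
  have h := signedMinor_mul_last hN hS i j
  simp only [eq_comm (a := j)] at h
  rw [← h]
  refine Finset.sum_congr rfl fun p _ => ?_
  rw [theta_rev_left, mul_smul]
  rfl

/-- By the symmetry relation, the combination of `S(u+1)` and its transpose in the first expansion
is a multiple of the transpose of `S(-u-1)`, so the expansion becomes a one-term matrix product. -/
theorem kappa_smul_mul (hN : c = LieCase.symplectic → Even (k + 1)) (hS : IsQuaternary c S)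
    (hS' : IsSymmetric c S) :
    (Matrix.of fun i j => kappa c 1 1 • transp c (signedMinor c S).transpose i j) * substMat (-1) (-1) S =
      substLin 1 1 (sdet c S) • (1 : Matrix (Fin (k + 1)) (Fin (k + 1)) A⟦X⟧) := by
  ext1 i j
  rw [Matrix.mul_apply, Matrix.smul_apply, smul_eq_mul, Matrix.one_apply, mul_ite, mul_one, mul_zero]
  have h := signedMinor_mul_first hN hS i.rev j.rev
  simp only [hS'.combination] at h
  rw [← Equiv.sum_comp Fin.revPerm] at h
  have h2 := congrArg (fun t => theta c i j • t) h
  simp only [Finset.smul_sum, Fin.revPerm_apply, Fin.rev_rev, Fin.rev_inj, theta_rev_rev] at h2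
  have h3 : (if i = j then substLin 1 1 (sdet c S) else 0) =
      theta c i j • if j = i then substLin 1 1 (sdet c S) else 0 := by
    by_cases hij : i = j
    · subst hij
      rw [theta_self hN, one_smul]
    · rw [if_neg hij, if_neg (Ne.symm hij), smul_zero]
  rw [h3, ← h2]
  refine Finset.sum_congr rfl fun p _ => ?_
  simp only [Matrix.of_apply, transp, Matrix.transpose_apply, substMat, Matrix.map_apply]
  rw [← theta_mul hN i j p]
  simp only [← C_smul, map_mul, smul_smul, smul_mul_assoc, mul_smul_comm]
  congr 1
  ring

/-- The substitution `u ↦ a u + b` in matrices. -/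
theorem substMat_mul (a b : ℂ) (M M' : Matrix (Fin k) (Fin k) A⟦X⟧) :
    substMat a b (M * M') = substMat a b M * substMat a b M' :=
  Matrix.map_mul (f := substHom A a b)

theorem substMat_one (a b : ℂ) : substMat a b (1 : Matrix (Fin k) (Fin k) A⟦X⟧) = 1 :=
  Matrix.map_one (substHom A a b) (map_zero _) (map_one _)

theorem substMat_substMat {a a' : ℂ} (ha : a ≠ 0) (ha' : a' ≠ 0) (b b' : ℂ)
    (M : Matrix (Fin k) (Fin k) A⟦X⟧) :
    substMat a b (substMat a' b' M) = substMat (a' * a) (a' * b + b') M := by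
  ext1 i j
  exact substLin_substLin ha ha' b b' _

/-- The expansion of `(u + 1/2) / (u - p - 1/2)` in the symplectic case and `1` in the orthogonal
case. -/
def ratio (c : LieCase) (p b : ℂ) : ℂ⟦X⟧ :=
  1 + C ((1 - c.sign) / 2 * (p + 1)) * invLin 1 (b - p - 1 / 2)

theorem substLin_ratio (c : LieCase) (p b b' : ℂ) :
    substLin 1 b (ratio c p b') = ratio c p (b' + b) := by
  rw [ratio, ← substHom_apply, map_add, map_one, map_mul, substHom_apply, substHom_apply,
    substLin_C, substLin_invLin one_ne_zero one_ne_zero, ratio]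
  congr 3 <;> ring

theorem invLin_eq {a b : ℂ} (ha : a ≠ 0) {t : ℂ} (ht : t ≠ 0) :
    invLin (t * a) (t * b) = C t⁻¹ * invLin a b := by
  symm
  apply eq_invLin (mul_ne_zero ht ha)
  have h : (C t⁻¹ * C t : ℂ⟦X⟧) = 1 := by rw [← map_mul, inv_mul_cancel₀ ht, map_one]
  rw [map_mul, map_mul]
  linear_combination (C t⁻¹ * C t) * invLin_mul ha b + X * h

theorem kappa_symplectic (a b : ℂ) (ha : a ≠ 0) :
    kappa .symplectic a b = 1 + invLin a (b - 1 / 2) := by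
  have h := invLin_eq (b := b - 1 / 2) ha (t := -2) (by norm_num)
  rw [kappa, show 1 - 2 * b = -2 * (b - 1 / 2) by ring, h, ← mul_assoc, ← map_mul]
  norm_num [LieCase.sign]

theorem one_add_mul_one_add {b d e : ℂ} :
    (1 + C d * invLin 1 b) * (1 + C e * invLin 1 (b + d)) = 1 + C (d + e) * invLin 1 b := by
  have h := invLin_sub_invLin (one_ne_zero (α := ℂ)) (b + d) b
  rw [sub_add_cancel_left, map_neg] at h
  rw [map_add]
  linear_combination C e * h

/-- In the symplectic case `κ(p-u) = (u-p-1/2)/(u-p+1/2)`, whose numerator cancels the denominator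
of `ratio`. -/
theorem ratio_mul_kappa (c : LieCase) (p : ℂ) : ratio c p 0 * kappa c (-1) p = alpha c p := by
  cases c with
  | orthogonal => simp [ratio, kappa, alpha, LieCase.sign]
  | symplectic =>
    have h := invLin_eq (a := 1) (b := 1 / 2 - p) one_ne_zero (t := -1) (by norm_num)
    rw [mul_one] at h
    have h2 : kappa .symplectic (-1) p = 1 + C (-1) * invLin 1 (1 / 2 - p) := by
      rw [kappa_symplectic _ _ (by norm_num), show p - 1 / 2 = -1 * (1 / 2 - p) by ring,
        h]
      norm_num
    have h3 : ratio .symplectic p 0 = 1 + C (p + 1) * invLin 1 (-p - 1 / 2) := by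
      rw [ratio]; norm_num [LieCase.sign]
    have h4 := one_add_mul_one_add (b := 1 / 2 - p) (d := -1) (e := p + 1)
    rw [show (1 / 2 - p + -1 : ℂ) = -p - 1 / 2 by ring, show (-1 + (p + 1) : ℂ) = p by ring] at h4
    rw [h2, h3, mul_comm, h4, alpha, invLin, map_one]
    have h5 : (1 + C (1 / 2 - p) * X : ℂ⟦X⟧) * (1 + C (1 / 2 - p) * X)⁻¹ = 1 :=
      PowerSeries.mul_inv_cancel _ (by simp)
    have h6 : (C (1 / 2) : ℂ⟦X⟧) = C (1 / 2 - p) + C p := by rw [← map_add]; congr 1; ring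
    rw [h6] 
    linear_combination -h5

/-- The factor `ratio` solves the difference equation `ratio(u+1) = κ(u+1) κ(p-u) ratio(u)`; it is
the rational correction that makes the quotient of determinants periodic. -/
theorem ratio_mul_kappa_mul_kappa (c : LieCase) (p : ℂ) :
    ratio c p 0 * (kappa c 1 1 * kappa c (-1) p) = ratio c p 1 := by
  rw [mul_left_comm, ratio_mul_kappa]
  cases c with
  | orthogonal => simp [ratio, kappa, alpha, LieCase.sign]
  | symplectic =>
    rw [alpha, kappa_symplectic _ _ one_ne_zero, ratio]
    have h5 : (1 + C (1 / 2 - p) * X : ℂ⟦X⟧) * (1 + C (1 / 2 - p) * X)⁻¹ = 1 :=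
      PowerSeries.mul_inv_cancel _ (by simp)
    have h6 : (1 + C (1 / 2) * X : ℂ⟦X⟧) * (1 + C (1 / 2) * X)⁻¹ = 1 :=
      PowerSeries.mul_inv_cancel _ (by simp)
    have e1 : ((1 - LieCase.symplectic.sign) / 2 * (p + 1)) = p + 1 := by norm_num [LieCase.sign]
    rw [e1, show (1 - 1 / 2 : ℂ) = 1 / 2 by norm_num, show (1 - p - 1 / 2 : ℂ) = 1 / 2 - p by ring,
      invLin, invLin, map_one]
    have h7 : (C (p + 1) : ℂ⟦X⟧) = C (1 / 2) + 1 - C (1 / 2 - p) := by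
      rw [← map_one (C (R := ℂ)), ← map_add, ← map_sub]; congr 1; ring
    rw [h7]
    linear_combination h5 + X * (1 + C (1 / 2 - p) * X : ℂ⟦X⟧)⁻¹ * h6

theorem invLin_reflect (p : ℂ) : invLin (-2) p + invLin 2 (2 - p) =
    2 * (invLin (-2) p * invLin 2 (2 - p)) := by
  have h := invLin_mul (show (-2 : ℂ) ≠ 0 by norm_num) p
  have h' := invLin_mul (two_ne_zero (α := ℂ)) (2 - p)
  apply mul_left_cancel₀ (X_ne_zero (R := ℂ))
  simp only [map_sub, map_neg, map_ofNat] at h h'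
  linear_combination -invLin 2 (2 - p) * h - invLin (-2) p * h'


theorem isUnit_sdet (hS : IsQuaternary c S)
    (hS1 : ∀ i j, constantCoeff (S i j) = if i = j then 1 else 0) : IsUnit (sdet c S) :=
  isUnit_of_constantCoeff_eq_one (constantCoeff_sdet hS hS1)

/-- For an involution `t` with `g' = t g`, the operators `(1 - r) + r ε t` and `(1 - r') + r' ε t`
are inverse to each other when `r + r' = 2 r r'`. -/
theorem reflected_smul {𝕜 M : Type*} [CommRing 𝕜] [AddCommGroup M] [Module 𝕜 M] {r r' ε : 𝕜}
    (hr : r + r' = 2 * (r * r')) (hε : ε * ε = 1) (g g' : M) :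
    (1 - r) • ((1 - r') • g + r' • ε • g') + r • ε • ((1 - r') • g' + r' • ε • g) = g := by
  have e1 : (1 - r) * (1 - r') + r * r' * (ε * ε) = 1 := by
    rw [hε]; linear_combination -hr
  have e2 : (1 - r) * r' * ε + r * (1 - r') * ε = 0 := by
    linear_combination ε * hr
  linear_combination (norm := module) e1 • g + e2 • g'

theorem substMat_units_inv {V W : (Matrix (Fin k) (Fin k) A⟦X⟧)ˣ} {a b : ℂ}
    (h : substMat a b (V : Matrix (Fin k) (Fin k) A⟦X⟧) = W) :
    substMat a b (↑V⁻¹ : Matrix (Fin k) (Fin k) A⟦X⟧) = ↑W⁻¹ := by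
  rw [← Units.mul_eq_one_iff_eq_inv, ← h, ← substMat_mul, Units.inv_mul, substMat_one]

theorem transp_of_apply_eq (hN : c = LieCase.symplectic → Even k) {f r : ℂ⟦X⟧} {D D' : A⟦X⟧}
    {H G : Matrix (Fin k) (Fin k) A⟦X⟧}
    (h : ∀ i j, f • (D * H i j) = D' * ((1 - r) • transp c G i j + r • c.sign • G i j))
    (i j : Fin k) : f • (D * transp c H i j) =
      D' * ((1 - r) • G i j + r • c.sign • transp c G i j) := by
  have h1 : G i j = theta c i j • transp c G j.rev i.rev := by
    conv_lhs => rw [← transp_transp hN G]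
    rfl
  have h2 := congrArg (fun t => theta c i j • t) (h j.rev i.rev)
  rw [h1]
  simp only [transp, Matrix.of_apply, Fin.rev_rev] at h2 ⊢
  simp only [← C_smul, smul_add, mul_add, mul_smul_comm, smul_comm (C (theta c i j) : ℂ⟦X⟧)] at h2 ⊢
  exact h2

/-- The relations between the Sklyanin determinant, the signed minors and the inverse matrix. -/
theorem comatrix_relations (hN : c = LieCase.symplectic → Even (k + 1)) (hS : IsQuaternary c S)
    (hS' : IsSymmetric c S) (hS1 : ∀ i j, constantCoeff (S i j) = if i = j then 1 else 0) :
    ∃ G : Matrix (Fin (k + 1)) (Fin (k + 1)) A⟦X⟧, G * substMat 1 (-(k : ℂ)) S = 1 ∧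
      (∀ i j, kappa c (-1) k • substLin (-1) (k - 1) (transp c (signedMinor c S).transpose i j) =
        substLin (-1) k (sdet c S) * G i j) ∧
      (kappa c 1 1 * kappa c (-1) k) • sdet c S =
        substLin 1 1 (sdet c S) * (Ring.inverse (substLin (-1) (k - 1) (sdet c S)) *
          substLin (-1) k (sdet c S)) := by
  obtain ⟨V, hV⟩ := isUnit_substMat 1 (-(k : ℂ)) S hS1
  obtain ⟨W, hW⟩ := isUnit_substMat (-1) (-1) S hS1
  -- The reflection `u ↦ -u + k - 1` is an involution exchanging `S(u-k)` and `S(-u-1)`, hence their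
  -- inverses `G` and `H`.
  have hGH : substMat (-1) (k - 1) (↑V⁻¹ : Matrix (Fin (k + 1)) (Fin (k + 1)) A⟦X⟧) = ↑W⁻¹ := by
    apply substMat_units_inv
    rw [hV, hW, substMat_substMat (by norm_num) one_ne_zero]
    congr 1 <;> ring
  have hHG : substMat (-1) (k - 1) (↑W⁻¹ : Matrix (Fin (k + 1)) (Fin (k + 1)) A⟦X⟧) = ↑V⁻¹ := by
    apply substMat_units_inv
    rw [hV, hW, substMat_substMat (by norm_num) (by norm_num)]
    congr 1 <;> ring
  have h1 := kappa_smul_mul hN hS hS'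
  have h2 := comatrix_mul hN hS
  rw [← hW] at h1
  rw [← hV] at h2
  replace h1 := apply_of_mul_unit h1
  replace h2 := apply_of_mul_unit h2
  simp only [Matrix.of_apply] at h1 h2
  have hVG : (↑V⁻¹ : Matrix (Fin (k + 1)) (Fin (k + 1)) A⟦X⟧) * substMat 1 (-(k : ℂ)) S = 1 := by
    rw [← hV, Units.inv_mul]
  generalize (↑V⁻¹ : Matrix (Fin (k + 1)) (Fin (k + 1)) A⟦X⟧) = G at *
  generalize (↑W⁻¹ : Matrix (Fin (k + 1)) (Fin (k + 1)) A⟦X⟧) = H at *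
  have hσ1 : substLin (-1) (k - 1) (substLin 1 1 (sdet c S)) = substLin (-1) k (sdet c S) := by
    rw [substLin_substLin (by norm_num) one_ne_zero]
    congr 1 <;> ring
  have hσκ : substLin (-1) (k - 1) (kappa c 1 1) = kappa c (-1) k := by
    rw [substLin_kappa c (by norm_num) one_ne_zero]
    congr 1 <;> ring
  have hσr : substLin (-1) (k - 1) (invLin (-2) k) = invLin 2 (2 - k) := by
    rw [substLin_invLin (by norm_num) (by norm_num)]
    congr 1 <;> ring
  refine ⟨G, hVG, fun i j => ?_, ?_⟩
  · have := congrArg (substLin (-1) (k - 1)) (h1 i j)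
    rw [substLin_series_smul, substLin_mul, hσκ, hσ1] at this
    rw [this, ← hHG]
    rfl
  have h3 : ∀ i j, kappa c 1 1 • (signedMinor c S).transpose i j =
      substLin 1 1 (sdet c S) * transp c H i j := by
    intro i j
    conv_lhs => rw [← transp_transp hN (signedMinor c S).transpose]
    change _ • theta c i j • transp c (signedMinor c S).transpose j.rev i.rev =
      _ * theta c i j • H j.rev i.rev
    rw [mul_smul_comm, ← h1, smul_comm]
  -- The minors are eliminated: the last expansion expresses `sdet · G` through them, and the first
  -- expresses them through `H`.
  have h4 : ∀ i j, kappa c 1 1 • (sdet c S * G i j) = substLin 1 1 (sdet c S) *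
      ((1 - invLin (-2) k) • transp c H i j + invLin (-2) k • c.sign • H i j) := by
    intro i j
    rw [← h2, smul_add, mul_add, smul_comm (kappa c 1 1) (1 - invLin (-2) (k : ℂ)), h3,
      smul_comm (kappa c 1 1) (invLin (-2) (k : ℂ)), smul_comm (kappa c 1 1) c.sign, h1,
      mul_smul_comm, mul_smul_comm, mul_smul_comm]
  -- The reflected form of the preceding relation expresses `H` back through `G`.
  have h5 : ∀ i j, kappa c (-1) k • (substLin (-1) (k - 1) (sdet c S) * H i j) =
      substLin (-1) k (sdet c S) * ((1 - invLin 2 (2 - k)) • transp c G i j +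
        invLin 2 (2 - k) • c.sign • G i j) := by
    intro i j
    have h := congrArg (substHom A (-1) (k - 1)) (h4 i j)
    have e1 : substLin (-1) (k - 1) (transp c H i j) = transp c G i j := by
      rw [← hHG, ← substMat_transp]; rfl
    have e2 : substLin (-1) (k - 1) (H i j) = G i j := by rw [← hHG]; rfl
    have e3 : substLin (-1) (k - 1) (G i j) = H i j := by rw [← hGH]; rfl
    have e4 : substLin (-1) (k - 1) (1 - invLin (-2) (k : ℂ)) = 1 - invLin 2 (2 - k) := by
      rw [← substHom_apply, map_sub, map_one, substHom_apply, hσr]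
    rw [substHom_apply, substLin_series_smul, substLin_mul, map_mul, map_add] at h
    simp only [substHom_apply, substLin_series_smul, substLin_smul, hσκ, hσ1, hσr, e1, e2, e3, e4] at h
    exact h
  have h6 := transp_of_apply_eq hN h5
  have hu : IsUnit (substLin (-1) (k - 1) (sdet c S)) :=
    (isUnit_sdet hS hS1).map (substHom A (-1) (k - 1))
  have hcancel : ∀ {x y : A⟦X⟧}, kappa c (-1) k • (substLin (-1) (k - 1) (sdet c S) * x) =
      substLin (-1) k (sdet c S) * y → kappa c (-1) k • x =
        Ring.inverse (substLin (-1) (k - 1) (sdet c S)) * substLin (-1) k (sdet c S) * y := by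
    intro x y h
    rw [mul_assoc, ← h, mul_smul_comm, ← mul_assoc, Ring.inverse_mul_cancel _ hu, one_mul]
  -- Substituting `H` and its transpose composes the two mutually inverse operators of
  -- `reflected_smul`, so only `G` remains on the right.
  have h7 : ∀ i j, (kappa c 1 1 * kappa c (-1) k) • sdet c S * G i j =
      substLin 1 1 (sdet c S) * (Ring.inverse (substLin (-1) (k - 1) (sdet c S)) *
          substLin (-1) k (sdet c S)) * G i j := by
    intro i j
    rw [smul_mul_assoc, mul_comm (kappa c 1 1), mul_smul, h4, ← mul_smul_comm, smul_add,
      smul_comm _ (1 - invLin (-2) (k : ℂ)), smul_comm _ (invLin (-2) (k : ℂ)),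
      smul_comm _ c.sign, hcancel (h5 i j), hcancel (h6 i j), ← mul_smul_comm c.sign,
      ← mul_smul_comm, ← mul_smul_comm, ← mul_add, ← mul_assoc]
    congr 1
    have hε : (C c.sign : ℂ⟦X⟧) * C c.sign = 1 := by rw [← map_mul, sign_mul_sign, map_one]
    have := reflected_smul (invLin_reflect (k : ℂ)) hε (G i j) (transp c G i j)
    simpa only [C_smul] using this
  have h8 : ((kappa c 1 1 * kappa c (-1) k) • sdet c S) • G =
      (substLin 1 1 (sdet c S) * (Ring.inverse (substLin (-1) (k - 1) (sdet c S)) *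
          substLin (-1) k (sdet c S))) • G := by
    ext1 i j
    exact h7 i j
  -- Multiplication by `S(u-k)` on the right cancels `G`, and a diagonal entry is the relation
  -- between determinants.
  have h9 := congrArg (· * substMat 1 (-(k : ℂ)) S) h8
  simp only [Matrix.smul_mul, hVG] at h9
  simpa using congrFun (congrFun h9 0) 0

/-- The functional equation of the Sklyanin determinant. -/
theorem sdet_eq (hN : c = LieCase.symplectic → Even (k + 1)) (hS : IsQuaternary c S)
    (hS' : IsSymmetric c S) (hS1 : ∀ i j, constantCoeff (S i j) = if i = j then 1 else 0) :
    sdet c S = ratio c k 0 • substLin (-1) k (sdet c S) := by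
  obtain ⟨G, -, -, h⟩ := comatrix_relations hN hS hS' hS1
  have hu := isUnit_sdet hS hS1
  have hc := constantCoeff_sdet hS hS1
  have hu' : IsUnit (substLin (-1) (k - 1) (sdet c S)) := hu.map (substHom A (-1) (k - 1))
  obtain ⟨d, hd⟩ := hu
  have hd1 : substLin 1 1 (↑d⁻¹ : A⟦X⟧) * substLin 1 1 (sdet c S) = 1 := by
    rw [← hd, ← substLin_mul, Units.inv_mul, ← substHom_apply, map_one]
  -- This quotient is the candidate periodic series; the relation between determinants together with
  -- the difference equation for `ratio` gives `P(u+1) = P(u)`.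
  set P : A⟦X⟧ := ratio c k 0 • (substLin (-1) k (sdet c S) * ↑d⁻¹) with hP
  have hper : substLin 1 1 P = P := by
    rw [hP, substLin_series_smul, substLin_ratio, zero_add, substLin_mul,
      substLin_substLin one_ne_zero (by norm_num), ← ratio_mul_kappa_mul_kappa, mul_smul]
    congr 1
    rw [show (-1 : ℂ) * 1 = -1 by ring, show (-1 : ℂ) + k = k - 1 by ring]
    have h2 := congrArg (fun t => substLin 1 1 (↑d⁻¹ : A⟦X⟧) * t * (↑d⁻¹ : A⟦X⟧)) h
    simp only [← mul_assoc, hd1, one_mul] at h2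
    have h3 := congrArg (fun t => substLin (-1) (k - 1) (sdet c S) * t) h2
    simp only [← mul_assoc, Ring.mul_inverse_cancel _ hu', one_mul] at h3
    rw [← h3, ← hd]
    simp only [mul_smul_comm, smul_mul_assoc, mul_assoc, Units.mul_inv, mul_one]
  have hconst : constantCoeff P = 1 := by
    have h1 : constantCoeff (↑d⁻¹ : A⟦X⟧) = 1 := by
      have h2 := congrArg (constantCoeff (R := A)) (d.inv_mul)
      rwa [map_mul, hd, hc, mul_one, map_one] at h2
    rw [hP, series_smul_def, map_mul, map_mul, constantCoeff_substLin, hc, h1, ratio, scal, map_add,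
      map_one, map_mul, map_add, map_one, map_mul]
    have h2 : constantCoeff (scal A (invLin 1 (0 - k - 1 / 2))) = 0 := constantCoeff_scal_invLin _ _
    rw [scal] at h2
    rw [h2]
    simp
  have h1 : P = 1 := by rw [eq_C_of_periodic hper, hconst, map_one]
  have h2 := congrArg (· * (d : A⟦X⟧)) h1
  simp only [hP, smul_mul_assoc, mul_assoc, Units.inv_mul, mul_one, one_mul] at h2
  rw [h2, hd]

/-- The reflected first expansion gives the comatrix with `sdet(-u+k)` in place of `sdet(u)`. The
functional equation trades one for the other at the cost of `ratio`, and `ratio · κ = α`. -/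
theorem transp_skComatrix (hN : c = LieCase.symplectic → Even (k + 1)) (hS : IsQuaternary c S)
    (hS' : IsSymmetric c S) (hS1 : ∀ i j, constantCoeff (S i j) = if i = j then 1 else 0)
    (i j : Fin (k + 1)) : transp c (skComatrix c S) i j =
      (-1) ^ ((i : ℕ) + (j : ℕ)) * scal A (alpha c k) *
        substLin (-1) (k - 1) (skMinor c S j.succAbove i.succAbove) := by
  obtain ⟨G, hG, h, -⟩ := comatrix_relations hN hS hS' hS1
  have h1 : sdet c S • G = skComatrix c S := by
    apply skComatrix_unique c S _ hS1
    rw [show (-((k + 1 : ℕ) : ℂ) + 1) = -k by push_cast; ring, Matrix.smul_mul, hG]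
  have h2 : ∀ i j, skComatrix c S i j =
      alpha c k • substLin (-1) (k - 1) (transp c (signedMinor c S).transpose i j) := by
    intro i j
    rw [← h1, Matrix.smul_apply, smul_eq_mul, ← ratio_mul_kappa, mul_smul, h, ← smul_mul_assoc,
      ← sdet_eq hN hS hS' hS1]
  have h3 : skComatrix c S = Matrix.of fun i j =>
      alpha c k • substMat (-1) (k - 1) (transp c (signedMinor c S).transpose) i j := by
    ext1 i j
    exact h2 i j
  rw [transp, Matrix.of_apply, h2, smul_comm, transp, Matrix.of_apply, substLin_smul, smul_smul,
    Fin.rev_rev, Fin.rev_rev, theta_rev_rev, theta_mul hN, theta_self hN, one_smul]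
  rw [Matrix.transpose_apply, signedMinor, Matrix.of_apply, zsmul_eq_mul, substLin_mul,
    series_smul_def, ← mul_assoc, ← substHom_apply, map_intCast, (Int.commute_cast _ _).eq,
    add_comm (j : ℕ)]
  push_cast
  rfl

end Comatrix

end

end SkewTwisted

theorem proposition3p4 (c : SkewTwisted.LieCase) (N : ℕ)
    (hN : c = SkewTwisted.LieCase.symplectic → Even N) (i j : Fin N) :
    SkewTwisted.transp c (SkewTwisted.skComatrix c (SkewTwisted.genS c N)) i j =
      (-1) ^ ((i : ℕ) + (j : ℕ)) *
        SkewTwisted.scal (SkewTwisted.TwYangian c N) (SkewTwisted.alpha c ((N : ℂ) - 1)) *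
        SkewTwisted.substLin (-1) ((N : ℂ) - 2)
          (SkewTwisted.skMinor c (SkewTwisted.genS c N)
            (SkewTwisted.skip j) (SkewTwisted.skip i)) := by
  rcases N with _ | k
  · exact i.elim0
  have h1 : (((k + 1 : ℕ) : ℂ) - 1) = k := by push_cast; ring
  have h2 : (((k + 1 : ℕ) : ℂ) - 2) = k - 1 := by push_cast; ring
  rw [h1, h2, SkewTwisted.transp_skComatrix hN (SkewTwisted.isQuaternary_genS c (k + 1))
    (SkewTwisted.isSymmetric_genS c (k + 1)) (SkewTwisted.constantCoeff_genS c (k + 1)),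
    ← SkewTwisted.skip_eq_succAbove, ← SkewTwisted.skip_eq_succAbove]
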